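/- Let $(M,\omega)$ be a smooth (Hausdorff) symplectic manifold of dimension $2n$ and let $\nabla$ be a symplectic connection on $M$, i.e. a smooth torsion-free linear connection on $TM$ with $\nabla\omega=0$. Let $\pi:\mathcal Z^0\to M$ be the twistor bundle whose fibre over $x$ consists of all $j\in\mathrm{End}(T_xM)$ with $j^2=-\mathrm{Id}$, $\omega(j\cdot,j\cdot)=\omega$ and $\omega(v,jv)>0$ for $v\neq 0$; it is an embedded submanifold of the total space of $\mathrm{End}(TM)$. Let $\pi^*\nabla$ be the pulled-back connection on $E=\pi^*TM$ (and on $\mathrm{End}\,E$), let $R^{\pi^*\nabla}_{X,Y}=[(\pi^*\nabla)_X,(\pi^*\nabla)_Y]-(\pi^*\nabla)_{[X,Y]}$ be its curvature, and let $\Phi$ be the canonical section of $\mathrm{End}\,E$, $\Phi_j=j$. Put $\mathcal V=\ker d\pi$ and $\mathcal H^\nabla=\{X\in T\mathcal Z^0:(\pi^*\nabla)_X\Phi=0\}$; these are complementary subbundles of $T\mathcal Z^0$. Let $P:T\mathcal Z^0\to\mathcal V$ be the projection with kernel $\mathcal H^\nabla$, where for $j\in\pi^{-1}(x)$ the space $\mathcal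 V_j=T_j(\pi^{-1}(x))\subset\mathrm{End}(T_xM)$ is identified with $\mathfrak m_j=\{A\in\mathfrak{sp}(T_xM,\omega):Aj=-jA\}$ by letting $A\in\mathfrak m_j$ correspond to the tangent vector $[A,j]=2Aj$ of the fibre (so that $(\pi^*\nabla)_X\Phi=[PX,\Phi]=2(PX)\Phi$). Define the 2-form $\tau$ on $\mathcal Z^0$ by $$\tau(X,Y)=\tfrac12\,\mathrm{Tr}\big((PX)\,\Phi\,(PY)\big).$$ Then, for every point of $\mathcal Z^0$ and all tangent vectors $X,Y,Z$ of $\mathcal Z^0$ at that point, $$d\tau(X,Y,Z)=-\tfrac14\,\mathrm{Tr}\Big(R^{\pi^*\nabla}_{X,Y}\circ(\pi^*\nabla)_Z\Phi+R^{\pi^*\nabla}_{Y,Z}\circ(\pi^*\nabla)_X\Phi+R^{\pi^*\nabla}_{Z,X}\circ(\pi^*\nabla)_Y\Phi\Big),$$ where $d$ is normalized by $d\tau(X,Y,Z)=X\,\tau(Y,Z)+Y\,\tau(Z,X)+Z\,\tau(X,Y)-\tau([X,Y],Z)-\tau([Y,Z],X)-\tau([Z,X],Y)$ for vector fields. -/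

import Mathlib

open scoped Manifold ContDiff Topology InnerProductSpace Bundle
open Bundle Set

theorem exists_unitary_family {E : Type*} [AddCommGroup E] [Module ℝ E] [FiniteDimensional ℝ E]
    {n : ℕ} (hn : Module.finrank ℝ E = 2 * n) (B : E →ₗ[ℝ] E →ₗ[ℝ] ℝ) (j : E →ₗ[ℝ] E)
    (hB : ∀ v w, B v w = -B w v) (hj : ∀ v, j (j v) = -v) (hBj : ∀ v w, B (j v) (j w) = B v w)
    (hpos : ∀ v, v ≠ 0 → 0 < B v (j v)) :
    ∃ b : Fin n → E, ∀ k l, B (b k) (b l) = 0 ∧ B (b k) (j (b l)) = if k = l then 1 else 0 := by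
  have hjj : j * j = -1 := by ext v; simp [hj]
  let φ : ℂ →ₐ[ℝ] Module.End ℝ E := Complex.lift ⟨j, hjj⟩
  let : Module ℂ E := Module.compHom E φ.toRingHom
  have hsm : ∀ (c : ℂ) (v : E), c • v = c.re • v + c.im • j v := by
    intro c v
    change φ c v = _
    simp [φ, Complex.liftAux_apply, Module.algebraMap_end_apply]
  have hswap : ∀ v w, B v (j w) = B w (j v) := by
    intro v w
    rw [← hBj v (j w), hj, hB, map_neg]; simp
  have hswap' : ∀ v w, B (j v) w = - B v (j w) := by
    intro v w; rw [hB, hswap]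
  have hself : ∀ v, B v v = 0 := by intro v; have := hB v v; linarith
  let core : InnerProductSpace.Core ℂ E :=
    { inner := fun u v => ⟨B u (j v), B u v⟩
      conj_inner_symm := by
        intro u v
        apply Complex.ext
        · simpa using hswap v u
        · simpa using (hB u v).symm
      re_inner_nonneg := by
        intro v
        by_cases h : v = 0
        · simp [h]
        · exact (hpos v h).le
      add_left := by
        intro u v w
        apply Complex.ext <;> simp
      smul_left := by
        intro u v r
        apply Complex.ext
        · simp [hsm, hswap', hj]
        · simp [hsm, hswap']
      definite := by
        intro v hv
        by_contra h
        have := hpos v h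
        have h2 := congrArg Complex.re hv
        simp at h2
        linarith }
  let : NormedAddCommGroup E := core.toNormedAddCommGroup
  let : InnerProductSpace ℂ E := InnerProductSpace.ofCore core.toCore
  have : IsScalarTower ℝ ℂ E := ⟨fun a c v => by simp [hsm, smul_add, smul_smul]⟩
  have : FiniteDimensional ℂ E := FiniteDimensional.right ℝ ℂ E
  have hfr : Module.finrank ℂ E = n := by
    have h := Module.finrank_mul_finrank ℝ ℂ E
    rw [Complex.finrank_real_complex, hn] at h
    omega
  let b := (stdOrthonormalBasis ℂ E).reindex (finCongr hfr)
  refine ⟨b, fun k l => ?_⟩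
  have h := orthonormal_iff_ite.1 b.orthonormal k l
  have h' : (⟨B (b k) (j (b l)), B (b k) (b l)⟩ : ℂ) = if k = l then 1 else 0 := h
  constructor
  · have := congrArg Complex.im h'
    split_ifs at this <;> simpa using this
  · have := congrArg Complex.re h'
    split_ifs at this ⊢ <;> simpa using this

/-- The standard complex structure of `ℝ^{2n}`. -/
noncomputable def stdJ (n : ℕ) :
    EuclideanSpace ℝ (Fin n ⊕ Fin n) →L[ℝ] EuclideanSpace ℝ (Fin n ⊕ Fin n) :=
  LinearMap.toContinuousLinearMap
    { toFun := fun v => WithLp.toLp 2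
        (Sum.elim (fun k => -v (Sum.inr k)) (fun k => v (Sum.inl k)))
      map_add' := fun v w => by
        ext i; rcases i with i | i <;> simp; ring
      map_smul' := fun c v => by
        ext i; rcases i with i | i <;> simp }

@[simp] theorem stdJ_inl {n : ℕ} (v : EuclideanSpace ℝ (Fin n ⊕ Fin n)) (k : Fin n) :
    stdJ n v (Sum.inl k) = -v (Sum.inr k) := rfl

@[simp] theorem stdJ_inr {n : ℕ} (v : EuclideanSpace ℝ (Fin n ⊕ Fin n)) (k : Fin n) :
    stdJ n v (Sum.inr k) = v (Sum.inl k) := rfl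

theorem stdJ_stdJ {n : ℕ} (v : EuclideanSpace ℝ (Fin n ⊕ Fin n)) : stdJ n (stdJ n v) = -v := by
  ext i; rcases i with i | i <;> simp

theorem inner_stdJ_stdJ {n : ℕ} (u v : EuclideanSpace ℝ (Fin n ⊕ Fin n)) :
    ⟪stdJ n u, stdJ n v⟫_ℝ = ⟪u, v⟫_ℝ := by
  simp [PiLp.inner_apply, Fintype.sum_sum_type, add_comm]

theorem exists_adapted_frame {E : Type*} [NormedAddCommGroup E] [NormedSpace ℝ E] [FiniteDimensional ℝ E]
    {n : ℕ} (hn : Module.finrank ℝ E = 2 * n) (B : E →L[ℝ] E →L[ℝ] ℝ) (j : E →L[ℝ] E)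
    (hB : ∀ v w, B v w = -B w v) (hj : ∀ v, j (j v) = -v) (hBj : ∀ v w, B (j v) (j w) = B v w)
    (hpos : ∀ v, v ≠ 0 → 0 < B v (j v)) :
    ∃ q : E ≃L[ℝ] EuclideanSpace ℝ (Fin n ⊕ Fin n), (∀ v, q (j v) = stdJ n (q v)) ∧
      ∀ u v, B u v = ⟪stdJ n (q u), q v⟫_ℝ := by
  obtain ⟨b, hb⟩ := exists_unitary_family hn
    ((ContinuousLinearMap.coeLM ℝ).comp (B : E →ₗ[ℝ] E →L[ℝ] ℝ)) (j : E →ₗ[ℝ] E)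
    (fun v w => hB v w) hj hBj hpos
  replace hb : ∀ k l, B (b k) (b l) = 0 ∧ B (b k) (j (b l)) = if k = l then 1 else 0 := hb
  have hjb : ∀ k l, B (j (b k)) (b l) = if k = l then -1 else 0 := by
    intro k l; rw [hB, (hb l k).2]; simp only [eq_comm]; split_ifs <;> simp
  have hjjb : ∀ k l, B (j (b k)) (j (b l)) = 0 := by
    intro k l; rw [hBj, (hb k l).1]
  let p : EuclideanSpace ℝ (Fin n ⊕ Fin n) →ₗ[ℝ] E :=
    { toFun := fun v => ∑ k, (v (Sum.inl k) • b k + v (Sum.inr k) • j (b k))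
      map_add' := fun v w => by
        rw [← Finset.sum_add_distrib]
        refine Finset.sum_congr rfl fun k _ => ?_
        simp only [PiLp.add_apply]; module
      map_smul' := fun c v => by
        simp only [PiLp.smul_apply, smul_eq_mul, mul_smul, RingHom.id_apply, Finset.smul_sum, smul_add] }
  have hp : ∀ v, p v = ∑ k, (v (Sum.inl k) • b k + v (Sum.inr k) • j (b k)) := fun v => rfl
  have hpB : ∀ u v, B (p u) (p v) = ⟪stdJ n u, v⟫_ℝ := by
    intro u v
    simp only [hp, map_sum, sum_apply, map_add, map_smul,
      add_apply, smul_apply, (hb _ _).1, (hb _ _).2, hjb, hjjb]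
    simp [PiLp.inner_apply, Fintype.sum_sum_type, Finset.sum_add_distrib, mul_comm, add_comm]
  have hpj : ∀ v, p (stdJ n v) = j (p v) := by
    intro v
    simp only [hp, map_sum, map_add, map_smul, hj, stdJ_inl, stdJ_inr]
    refine Finset.sum_congr rfl fun k _ => ?_
    module
  have hinj : Function.Injective p := by
    rw [injective_iff_map_eq_zero]
    intro v hv
    have := hpB v (stdJ n v)
    rw [hv, inner_stdJ_stdJ] at this
    simpa using this.symm
  have hfin : Module.finrank ℝ (EuclideanSpace ℝ (Fin n ⊕ Fin n)) = Module.finrank ℝ E := by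
    rw [hn]; simp; ring
  let P := (LinearEquiv.ofInjectiveOfFinrankEq p hinj hfin).toContinuousLinearEquiv
  have hP : ∀ v, P v = p v := fun v => rfl
  refine ⟨P.symm, fun v => ?_, fun u v => ?_⟩
  · apply P.injective
    rw [P.apply_symm_apply, hP, hpj, ← hP, P.apply_symm_apply]
  · rw [← hpB, ← hP, ← hP, P.apply_symm_apply, P.apply_symm_apply]

/-- A complex structure `A` on `V` that is compatible with the bilinear form `β`: it satisfies
`A² = -1`, it preserves `β`, and `β(·, A ·)` is positive definite. -/
structure CompatWith {V : Type*} [AddCommGroup V] [Module ℝ V] [TopologicalSpace V]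
    (β : V → V → ℝ) (A : V →L[ℝ] V) : Prop where
  sq : ∀ v, A (A v) = -v
  inv : ∀ u v, β (A u) (A v) = β u v
  pos : ∀ v, v ≠ 0 → 0 < β v (A v)

theorem CompatWith.conj {E V : Type*} [AddCommGroup E] [Module ℝ E] [TopologicalSpace E]
    [AddCommGroup V] [Module ℝ V] [TopologicalSpace V] {β : E → E → ℝ}
    {Ω : V → V → ℝ} {A : E →L[ℝ] E} (hA : CompatWith β A)
    (h : E →L[ℝ] V) (h' : V →L[ℝ] E) (h1 : ∀ u, h' (h u) = u) (h2 : ∀ u, h (h' u) = u)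
    (hβ : ∀ u v, β u v = Ω (h u) (h v)) : CompatWith Ω (h.comp (A.comp h')) := by
  refine ⟨fun v => by simp [h1, hA.sq, h2], fun u v => ?_, fun v hv => ?_⟩
  · simp only [ContinuousLinearMap.comp_apply]
    rw [← hβ, hA.inv, hβ, h2, h2]
  · have h3 : h' v ≠ 0 := fun h0 => hv (by rw [← h2 v, h0, map_zero])
    have := hA.pos _ h3
    rw [hβ, h2] at this
    simpa using this

section linear
variable {V : Type*} [NormedAddCommGroup V] [InnerProductSpace ℝ V] [FiniteDimensional ℝ V]

/-- The space of endomorphisms `S` with `S J = -J S` that lie in the symplectic Lie algebra of the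
form `⟪J u, v⟫`. It serves as the model space of the fibres of the twistor space. -/
def antiSp (J : V →L[ℝ] V) : Submodule ℝ (V →L[ℝ] V) where
  carrier := {S | (∀ v, S (J v) = -J (S v)) ∧ ∀ u v, ⟪J (S u), v⟫_ℝ = -⟪J u, S v⟫_ℝ}
  add_mem' := by
    rintro S T ⟨h1, h2⟩ ⟨h3, h4⟩
    refine ⟨fun v => by simp [h1, h3]; abel, fun u v => by simp [inner_add_left, inner_add_right, h2, h4]; ring⟩
  zero_mem' := by simp
  smul_mem' := by
    rintro c S ⟨h1, h2⟩
    refine ⟨fun v => by simp [h1], fun u v => by simp [inner_smul_left, inner_smul_right, h2]⟩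

variable {J : V →L[ℝ] V}

/-- The symplectic form `(u, v) ↦ ⟪J u, v⟫`. -/
noncomputable def stdForm (J : V →L[ℝ] V) : V →L[ℝ] V →L[ℝ] ℝ := (innerSL ℝ).comp J

theorem stdForm_apply (u v : V) : stdForm J u v = ⟪J u, v⟫_ℝ := rfl

theorem stdForm_J (hJ2 : ∀ v, J (J v) = -v)
    (hJ : ∀ u v, ⟪J u, J v⟫_ℝ = ⟪u, v⟫_ℝ) (u v : V) : stdForm J (J u) v = - stdForm J u (J v) := by
  simp only [stdForm_apply, hJ, hJ2]; simp

/-- The Cayley transform centred at `J`, a coordinate on compatible complex structures near `J`. -/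
noncomputable def cay (J A : V →L[ℝ] V) : V →L[ℝ] V := (A - J) * Ring.inverse (A + J)
/-- The inverse of the Cayley transform centred at `J`. -/
noncomputable def cayInv (J S : V →L[ℝ] V) : V →L[ℝ] V := Ring.inverse (1 - S) * ((1 + S) * J)

theorem cay_mul {A : V →L[ℝ] V} (h : IsUnit (A + J)) : cay J A * (A + J) = A - J := by
  rw [cay, mul_assoc, Ring.inverse_mul_cancel _ h, mul_one]

theorem isUnit_surj {A : V →L[ℝ] V} (h : IsUnit A) (v : V) : ∃ u, A u = v :=
  ⟨Ring.inverse A v, by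
    have := congrArg (fun T : V →L[ℝ] V => T v) (Ring.mul_inverse_cancel _ h)
    simpa using this⟩

theorem cay_mem (hJ2 : ∀ v, J (J v) = -v)
    (hJ : ∀ u v, ⟪J u, J v⟫_ℝ = ⟪u, v⟫_ℝ) {A : V →L[ℝ] V} (h : IsUnit (A + J)) (hA : CompatWith (fun u v => stdForm J u v) A) :
    cay J A ∈ antiSp J := by
  have key : ∀ u, cay J A (A u + J u) = A u - J u := fun u => by
    have := congrArg (fun T : V →L[ℝ] V => T u) (cay_mul h)
    simpa using this
  constructor
  · intro v
    obtain ⟨u, rfl⟩ := isUnit_surj h v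
    have : J ((A + J) u) = A (A u) + J (A u) := by simp [hA.sq, hJ2, add_comm]
    rw [this, key, hA.sq]
    simp only [add_apply, key, map_sub, hJ2]; abel
  · intro u v
    obtain ⟨u, rfl⟩ := isUnit_surj h u
    obtain ⟨v, rfl⟩ := isUnit_surj h v
    simp only [add_apply, key]
    have h1 := hA.inv u v
    have h2 : stdForm J (J u) (J v) = stdForm J u v := by
      rw [stdForm_J hJ2 hJ, hJ2]; simp
    simp only [stdForm_apply] at h1 h2
    simp only [map_sub, map_add, inner_sub_left, inner_add_left, inner_sub_right, inner_add_right]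
    linarith

theorem cayInv_rel {S : V →L[ℝ] V} (h : ‖S‖ < 1) : (1 - S) * cayInv J S = (1 + S) * J := by
  rw [cayInv, ← mul_assoc, Ring.mul_inverse_cancel _ (isUnit_one_sub_of_norm_lt_one h), one_mul]

theorem cayInv_cay {A : V →L[ℝ] V} (h : IsUnit (A + J)) (h1 : ‖cay J A‖ < 1) :
    cayInv J (cay J A) = A := by
  have e : (1 - cay J A) * A = (1 + cay J A) * J := by
    have := cay_mul h
    rw [mul_add] at this
    rw [sub_mul, add_mul, one_mul, one_mul]
    rw [sub_eq_iff_eq_add] ; rw [eq_comm, ← sub_eq_iff_eq_add'] at this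
    rw [← sub_eq_zero] at this ⊢
    rw [← this]; abel
  rw [cayInv, ← e, ← mul_assoc, Ring.inverse_mul_cancel _ (isUnit_one_sub_of_norm_lt_one h1), one_mul]

theorem cayInv_unit (hJ2 : ∀ v, J (J v) = -v) {S : V →L[ℝ] V} (h : ‖S‖ < 1) : IsUnit (cayInv J S + J) := by
  have hu := isUnit_one_sub_of_norm_lt_one h
  have hJu : IsUnit J := by
    exact ⟨⟨J, -J, by ext v; simp [hJ2], by ext v; simp [hJ2]⟩, rfl⟩
  have e : (1 - S) * (cayInv J S + J) = (2 : ℝ) • J := by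
    rw [mul_add, cayInv_rel h]; ext v; simp [two_smul]
  have : cayInv J S + J = Ring.inverse (1 - S) * ((2 : ℝ) • J) := by
    rw [← e, ← mul_assoc, Ring.inverse_mul_cancel _ hu, one_mul]
  rw [this]
  refine (isUnit_ringInverse.2 hu).mul ?_
  exact hJu.smul (Units.mk0 (2:ℝ) two_ne_zero)

theorem cay_cayInv (hJ2 : ∀ v, J (J v) = -v) {S : V →L[ℝ] V} (h : ‖S‖ < 1) : cay J (cayInv J S) = S := by
  have hu := cayInv_unit hJ2 h
  have e : cayInv J S - J = S * (cayInv J S + J) := by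
    have := cayInv_rel (J := J) h
    rw [sub_mul, one_mul, add_mul, one_mul] at this
    rw [mul_add, ← sub_eq_zero]; rw [← sub_eq_zero] at this
    rw [← this]; abel
  rw [cay, e, mul_assoc, Ring.mul_inverse_cancel _ hu, mul_one]

theorem cayInv_compat (hJ2 : ∀ v, J (J v) = -v)
    (hJ : ∀ u v, ⟪J u, J v⟫_ℝ = ⟪u, v⟫_ℝ) {S : V →L[ℝ] V} (h : ‖S‖ < 1) (hS : S ∈ antiSp J) :
    CompatWith (fun u v => stdForm J u v) (cayInv J S) := by
  have hu := isUnit_one_sub_of_norm_lt_one h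
  have hrel := cayInv_rel (J := J) h
  have hSJ : (1 + S) * J = J * (1 - S) := by
    ext v; simp [hS.1]; abel
  have key : ∀ u, S (cayInv J S u + J u) = cayInv J S u - J u := fun u => by
    have := congrArg (fun T : V →L[ℝ] V => T u) hrel
    simp only [mul_apply_eq_comp, sub_apply, add_apply, one_apply_eq_self] at this
    rw [map_add]
    rw [← sub_eq_zero] at this ⊢
    rw [← neg_eq_zero, ← this]; abel
  have e : ∀ u, cayInv J S u = (1/2 : ℝ) • ((cayInv J S u + J u) + S (cayInv J S u + J u)) := by
    intro u; rw [key]; module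
  have e' : ∀ u, J u = (1/2 : ℝ) • ((cayInv J S u + J u) - S (cayInv J S u + J u)) := by
    intro u; rw [key]; module
  have hinvJ : ∀ u v, stdForm J (J u) (J v) = stdForm J u v := by
    intro u v; rw [stdForm_J hJ2 hJ, hJ2]; simp
  have hskew : ∀ u v, stdForm J (S u) v = - stdForm J u (S v) := hS.2
  refine ⟨?_, ?_, ?_⟩
  · have h2 : cayInv J S * cayInv J S = -1 := by
      have e1 : (1 - S) * (cayInv J S * cayInv J S) = (1 - S) * (-1) := by
        rw [← mul_assoc, hrel, hSJ, mul_assoc, hrel, hSJ, ← mul_assoc]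
        ext v; simp [hJ2]; abel
      exact hu.mul_left_cancel e1
    intro v
    have := congrArg (fun T : V →L[ℝ] V => T v) h2
    simpa using this
  · intro u v
    have e2 : ∀ u, ∃ a, cayInv J S u = (1/2 : ℝ) • (a + S a) ∧ J u = (1/2 : ℝ) • (a - S a) :=
      fun u => ⟨_, e u, e' u⟩
    obtain ⟨a, ha, ha'⟩ := e2 u
    obtain ⟨b, hb, hb'⟩ := e2 v
    rw [← hinvJ u v, ha, hb, ha', hb']
    simp only [map_smul, map_add, map_sub, smul_apply, add_apply, sub_apply]
    have := hskew a b
    simp only [smul_eq_mul]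
    linarith
  · intro v hv
    have h4 : stdForm J v (cayInv J S v) =
        (1/4 : ℝ) * (‖cayInv J S v + J v‖ ^ 2 - ‖S (cayInv J S v + J v)‖ ^ 2) := by
      rw [key, stdForm_apply, norm_add_sq_real, norm_sub_sq_real, real_inner_comm]; ring
    rw [h4]
    set y := cayInv J S v + J v with hy
    have hy0 : y ≠ 0 := by
      intro h0
      have k := e' v
      rw [← hy, h0] at k
      simp at k
      apply hv
      have := hJ2 v
      rw [k, map_zero] at this
      simpa using this.symm
    have : ‖S y‖ < ‖y‖ := by
      calc ‖S y‖ ≤ ‖S‖ * ‖y‖ := S.le_opNorm y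
        _ < 1 * ‖y‖ := by
          have := norm_pos_iff.2 hy0
          gcongr
        _ = ‖y‖ := one_mul _
    have h0 := norm_nonneg (S y)
    nlinarith

/-- The adjoint of an endomorphism for the form `⟪J u, v⟫`. -/
noncomputable def spAdj (J : V →L[ℝ] V) : (V →L[ℝ] V) →L[ℝ] (V →L[ℝ] V) :=
  LinearMap.toContinuousLinearMap
  { toFun := fun A => -(J * ContinuousLinearMap.adjoint A * J)
    map_add' := fun A B => by rw [map_add]; noncomm_ring
    map_smul' := fun c A => by ext v; simp }

theorem stdForm_spAdj (hJ : ∀ u v, ⟪J u, J v⟫_ℝ = ⟪u, v⟫_ℝ) (hJ2 : ∀ v, J (J v) = -v) (A : V →L[ℝ] V) (u v : V) :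
    stdForm J (A u) v = stdForm J u (spAdj J A v) := by
  have h1 : spAdj J A v = -(J (ContinuousLinearMap.adjoint A (J v))) := rfl
  have h2 := hJ (J (A u)) v
  rw [hJ2, inner_neg_left] at h2
  rw [h1, stdForm_apply, stdForm_apply, inner_neg_right, hJ,
    ContinuousLinearMap.adjoint_inner_right, ← h2]

theorem spAdj_mul (hJ2 : ∀ v, J (J v) = -v) (A B : V →L[ℝ] V) :
    spAdj J (A * B) = spAdj J B * spAdj J A := by
  have h1 : ∀ A v, spAdj J A v = -(J (ContinuousLinearMap.adjoint A (J v))) := fun A v => rfl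
  ext v
  simp only [mul_apply_eq_comp, h1, map_neg, hJ2, neg_neg]
  rw [ContinuousLinearMap.mul_def, ContinuousLinearMap.adjoint_comp]; simp

theorem spAdj_one (hJ2 : ∀ v, J (J v) = -v) : spAdj J (1 : V →L[ℝ] V) = 1 := by
  have h1 : ∀ A v, spAdj J A v = -(J (ContinuousLinearMap.adjoint A (J v))) := fun A v => rfl
  ext v
  rw [h1, ContinuousLinearMap.one_def, ContinuousLinearMap.adjoint_id]; simp [hJ2]

/-- A smooth square root near `1`. -/
theorem exists_sqrt {R : Type*} [NormedRing R] [NormedAlgebra ℝ R] [CompleteSpace R] : ∃ s : R → R, ContDiffAt ℝ ω s 1 ∧ s 1 = 1 ∧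
    (∀ᶠ A in 𝓝 1, s A * s A = A) ∧ ∀ᶠ g in 𝓝 1, s (g * g) = g := by
  let f : R → R := fun g => g * g
  have hω : (ω : WithTop ℕ∞) ≠ 0 := by simp
  have hf : ContDiffAt ℝ ω f 1 := contDiffAt_id.mul contDiffAt_id
  let e : R ≃L[ℝ] R := ContinuousLinearEquiv.smulLeft (Units.mk0 (2:ℝ) two_ne_zero)
  have hf' : HasFDerivAt f (e : R →L[ℝ] R) 1 := by
    have := (hasFDerivAt_id (𝕜 := ℝ) (1 : R)).mul' (hasFDerivAt_id (𝕜 := ℝ) (1 : R))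
    refine this.congr_fderiv (ContinuousLinearMap.ext fun A => ?_)
    have h2 : (e : R →L[ℝ] R) A = (2 : ℝ) • A := rfl
    rw [h2, two_smul]
    simp
  have hs := hf.hasStrictFDerivAt' hf' hω
  have h11 : f 1 = 1 := mul_one 1
  refine ⟨hf.localInverse hf' hω, ?_, ?_, ?_, ?_⟩
  · have := hf.to_localInverse hf' hω
    rwa [h11] at this
  · have := hf.localInverse_apply_image hf' hω
    rwa [h11] at this
  · have := hs.eventually_right_inverse
    rwa [h11] at this
  · exact hs.eventually_left_inverse

theorem exists_sqrt' (hJ2 : ∀ v, J (J v) = -v) : ∃ s : (V →L[ℝ] V) → (V →L[ℝ] V), s 1 = 1 ∧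
    ∀ᶠ A in 𝓝 1, ContDiffAt ℝ ∞ s A ∧ IsUnit (s A) ∧ s A * s A = A ∧
      (spAdj J A = A → spAdj J (s A) = s A) := by
  obtain ⟨s, h1, h2, h3, h4⟩ := exists_sqrt (R := V →L[ℝ] V)
  refine ⟨s, h2, ?_⟩
  have hc : Filter.Tendsto s (𝓝 1) (𝓝 1) := by
    have := h1.continuousAt.tendsto; rwa [h2] at this
  have hd : Filter.Tendsto (fun A => spAdj J (s A)) (𝓝 1) (𝓝 1) := by
    have := ((spAdj J).continuous.tendsto 1).comp hc
    rwa [spAdj_one hJ2] at this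
  have hun : ∀ᶠ A in 𝓝 (1 : V →L[ℝ] V), IsUnit A := Units.isOpen.mem_nhds isUnit_one
  filter_upwards [h1.eventually (by simp), h3, hc.eventually hun, hc.eventually h4, hd.eventually h4]
    with A a1 a2 a3 a4 a5
  refine ⟨a1.of_le le_top, a3, a2, fun h => ?_⟩
  rw [← spAdj_mul hJ2, a2, h] at a5
  exact a5.symm

end linear
section model
variable {E V : Type*} [NormedAddCommGroup E] [NormedSpace ℝ E]

variable [NormedAddCommGroup V] [InnerProductSpace ℝ V] [FiniteDimensional ℝ V]
  [FiniteDimensional ℝ E]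

set_option synthInstance.maxHeartbeats 100000 in
theorem exists_form_operator {J : V →L[ℝ] V} (hJ2 : ∀ v, J (J v) = -v) (q : E ≃L[ℝ] V) :
    ∃ L : (E →L[ℝ] E →L[ℝ] ℝ) →L[ℝ] (V →L[ℝ] V),
      ∀ b u v, stdForm J (L b u) v = b (q.symm u) (q.symm v) := by
  let D : (E →L[ℝ] ℝ) → V := fun φ => (InnerProductSpace.toDual ℝ V).symm (φ.comp (q.symm : V →L[ℝ] E))
  have hD : ∀ φ v, ⟪D φ, v⟫_ℝ = φ (q.symm v) := fun φ v => by
    simp [D, InnerProductSpace.toDual_symm_apply]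
  have hadd : ∀ φ ψ, D (φ + ψ) = D φ + D ψ := fun φ ψ => by
    refine ext_inner_right ℝ fun v => ?_
    simp [inner_add_left, hD]
  have hsmul : ∀ (c : ℝ) φ, D (c • φ) = c • D φ := fun c φ => by
    refine ext_inner_right ℝ fun v => ?_
    simp [inner_smul_left, hD]
  let L0 : (E →L[ℝ] E →L[ℝ] ℝ) → (V →L[ℝ] V) := fun b => LinearMap.toContinuousLinearMap
    { toFun := fun u => -(J (D (b (q.symm u))))
      map_add' := fun u v => by simp [hadd]; abel
      map_smul' := fun c u => by simp [hsmul] }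
  have hL0 : ∀ b u, L0 b u = -(J (D (b (q.symm u)))) := fun b u => rfl
  refine ⟨LinearMap.toContinuousLinearMap
    { toFun := L0
      map_add' := fun a b => by ext u; simp [hL0, hadd]; abel
      map_smul' := fun c b => by ext u; simp [hL0, hsmul] }, fun b u v => ?_⟩
  change stdForm J (L0 b u) v = _
  rw [stdForm_apply, hL0, map_neg, hJ2, neg_neg, hD]

set_option synthInstance.maxHeartbeats 100000 in
theorem exists_local_model {J : V →L[ℝ] V} (hJ2 : ∀ v, J (J v) = -v)
    (hJ : ∀ u v, ⟪J u, J v⟫_ℝ = ⟪u, v⟫_ℝ) {O : Set E} (hO : IsOpen O)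
    {β : E → E →L[ℝ] E →L[ℝ] ℝ} (hβ : ContDiffOn ℝ ∞ β O)
    (hanti : ∀ x ∈ O, ∀ v w, β x v w = -β x w v) {x0 : E} (hx0 : x0 ∈ O) {j0 : E →L[ℝ] E}
    (q : E ≃L[ℝ] V) (hqj : ∀ v, q (j0 v) = J (q v)) (hqβ : ∀ u v, β x0 u v = ⟪J (q u), q v⟫_ℝ) :
    ∃ (W : Set (E × (E →L[ℝ] E))) (T : Set (E × antiSp J))
      (f : E × (E →L[ℝ] E) → E × antiSp J) (g : E × antiSp J → E × (E →L[ℝ] E)),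
      IsOpen W ∧ IsOpen T ∧ (x0, j0) ∈ W ∧ (∀ p ∈ W, p.1 ∈ O) ∧
      (∀ p ∈ W, ContDiffAt ℝ ∞ f p) ∧ (∀ t ∈ T, ContDiffAt ℝ ∞ g t) ∧
      (∀ p ∈ W, CompatWith (fun u v => β p.1 u v) p.2 → f p ∈ T ∧ g (f p) = p) ∧
      (∀ t ∈ T, g t ∈ W ∧ CompatWith (fun u v => β (g t).1 u v) (g t).2 ∧ f (g t) = t) := by
  obtain ⟨L, hL⟩ := exists_form_operator hJ2 q
  obtain ⟨s, s1, hs⟩ := exists_sqrt' (V := V) hJ2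
  obtain ⟨N, hN, hNo, h1N⟩ := mem_nhds_iff.1 hs
  obtain ⟨pr, hpr⟩ : (antiSp J).ClosedComplemented :=
    Submodule.ClosedComplemented.of_finiteDimensional_quotient (Submodule.closed_of_finiteDimensional _)
  have hJJ : J * J = -1 := by ext v; simp [hJ2]
  have hJu : IsUnit J := ⟨⟨J, -J, by ext v; simp [hJ2], by ext v; simp [hJ2]⟩, rfl⟩
  have hΩanti : ∀ u v, stdForm J u v = -stdForm J v u := by
    intro u v
    have h := hJ u (J v)
    rw [hJ2, inner_neg_right] at h
    rw [stdForm_apply, stdForm_apply, real_inner_comm u, ← h, neg_neg]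
  have hΩnd : ∀ a b : V, (∀ v, stdForm J v a = stdForm J v b) → a = b := by
    intro a b h
    refine ext_inner_left ℝ fun v => ?_
    have := h (-(J v))
    simpa [stdForm_apply, hJ2] using this
  let A : E → (V →L[ℝ] V) := fun x => L (β x)
  have hLc : ContDiff ℝ ∞ (fun b => L b) := by fun_prop
  have hprc : ContDiff ℝ ∞ (fun a => pr a) := by fun_prop
  have hAc : ContDiffOn ℝ ∞ A O := hLc.comp_contDiffOn hβ
  have hA0 : A x0 = 1 := by
    ext u : 1
    refine hΩnd _ _ fun v => ?_
    rw [hΩanti, hL, hqβ, hΩanti v]; simp [stdForm_apply]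
  have hAadj : ∀ x ∈ O, spAdj J (A x) = A x := by
    intro x hx
    ext u : 1
    refine hΩnd _ _ fun v => ?_
    rw [← stdForm_spAdj hJ hJ2, hL, hΩanti v, hL, hanti x hx]
  let O' := O ∩ A ⁻¹' N
  have hO' : IsOpen O' := hAc.continuousOn.isOpen_inter_preimage hO hNo
  have hx0' : x0 ∈ O' := ⟨hx0, by change A x0 ∈ N; rw [hA0]; exact h1N⟩
  have hG : ∀ x ∈ O', ContDiffAt ℝ ∞ (fun y => s (A y)) x := fun x hx =>
    (hN hx.2).1.comp x (hAc.contDiffAt (hO.mem_nhds hx.1))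
  let H : E → (E →L[ℝ] V) := fun x => (s (A x)).comp (q : E →L[ℝ] V)
  let H' : E → (V →L[ℝ] E) := fun x => (q.symm : V →L[ℝ] E).comp (Ring.inverse (s (A x)))
  have hH : ∀ x ∈ O', ContDiffAt ℝ ∞ H x := fun x hx => (hG x hx).clm_comp contDiffAt_const
  have hH' : ∀ x ∈ O', ContDiffAt ℝ ∞ H' x := fun x hx => by
    refine contDiffAt_const.clm_comp ?_
    obtain ⟨u, hu⟩ := (hN hx.2).2.1
    have h1 : ContDiffAt ℝ ∞ Ring.inverse (s (A x)) := by
      rw [← hu]; exact contDiffAt_ringInverse ℝ u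
    exact h1.comp x (hG x hx)
  have hHH' : ∀ x ∈ O', ∀ v, H x (H' x v) = v := fun x hx v => by
    have := congrArg (fun T : V →L[ℝ] V => T v) (Ring.mul_inverse_cancel _ (hN hx.2).2.1)
    simpa [H, H'] using this
  have hH'H : ∀ x ∈ O', ∀ v, H' x (H x v) = v := fun x hx v => by
    have := congrArg (fun T : V →L[ℝ] V => T (q v)) (Ring.inverse_mul_cancel _ (hN hx.2).2.1)
    simp only [mul_apply_eq_comp, one_apply_eq_self] at this
    simp [H, H', this]
  have hHβ : ∀ x ∈ O', ∀ u v, β x u v = stdForm J (H x u) (H x v) := fun x hx u v => by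
    obtain ⟨-, -, h3, h4⟩ := hN hx.2
    have h5 := h4 (hAadj x hx.1)
    simp only [H, ContinuousLinearMap.comp_apply, ContinuousLinearEquiv.coe_coe]
    rw [hΩanti, stdForm_spAdj hJ hJ2, h5, ← mul_apply_eq_comp, h3, hΩanti, neg_neg, hL]
    simp
  let C : E × (E →L[ℝ] E) → (V →L[ℝ] V) := fun p => (H p.1).comp (p.2.comp (H' p.1))
  have hC : ∀ p : E × (E →L[ℝ] E), p.1 ∈ O' → ContDiffAt ℝ ∞ C p := fun p hp => by
    have a1 : ContDiffAt ℝ ∞ (fun p : E × (E →L[ℝ] E) => H p.1) p := (hH p.1 hp).comp p contDiffAt_fst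
    have a2 : ContDiffAt ℝ ∞ (fun p : E × (E →L[ℝ] E) => H' p.1) p := (hH' p.1 hp).comp p contDiffAt_fst
    exact a1.clm_comp (contDiffAt_snd.clm_comp a2)
  have hcay : ∀ p : E × (E →L[ℝ] E), p.1 ∈ O' → IsUnit (C p + J) →
      ContDiffAt ℝ ∞ (fun p => cay J (C p)) p := fun p hp hu => by
    have h1 : ContDiffAt ℝ ∞ (fun p => C p + J) p := (hC p hp).add contDiffAt_const
    have h2 : ContDiffAt ℝ ∞ (fun p => Ring.inverse (C p + J)) p := by
      obtain ⟨u, hu⟩ := hu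
      have h1' : ContDiffAt ℝ ∞ Ring.inverse (C p + J) := by
        rw [← hu]; exact contDiffAt_ringInverse ℝ u
      exact h1'.comp p h1
    exact ((hC p hp).sub contDiffAt_const).mul h2
  let W1 : Set (E × (E →L[ℝ] E)) := (Prod.fst ⁻¹' O') ∩ (fun p => C p + J) ⁻¹' {u | IsUnit u}
  have hW1 : IsOpen W1 := by
    refine ContinuousOn.isOpen_inter_preimage (fun p hp => ?_) (hO'.preimage continuous_fst) Units.isOpen
    exact ((hC p hp).continuousAt.add continuousAt_const).continuousWithinAt
  let W : Set (E × (E →L[ℝ] E)) := W1 ∩ (fun p => cay J (C p)) ⁻¹' Metric.ball 0 1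
  have hW : IsOpen W := ContinuousOn.isOpen_inter_preimage
    (fun p hp => (hcay p hp.1 hp.2).continuousAt.continuousWithinAt) hW1 Metric.isOpen_ball
  let T : Set (E × antiSp J) := O' ×ˢ Metric.ball 0 1
  have hT : ∀ t ∈ T, ‖(t.2 : V →L[ℝ] V)‖ < 1 := fun t ht => by simpa using ht.2
  let f : E × (E →L[ℝ] E) → E × antiSp J := fun p => (p.1, pr (cay J (C p)))
  let g : E × antiSp J → E × (E →L[ℝ] E) := fun t =>
    (t.1, (H' t.1).comp ((cayInv J t.2).comp (H t.1)))
  have hCg : ∀ t ∈ T, C (g t) = cayInv J t.2 := fun t ht => by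
    ext v
    simp [C, g, hHH' t.1 ht.1]
  refine ⟨W, T, f, g, hW, hO'.prod Metric.isOpen_ball, ?_, fun p hp => hp.1.1.1, ?_, ?_, ?_, ?_⟩
  · have hC0 : C (x0, j0) = J := by
      ext v
      simp [C, H, H', hA0, s1, hqj]
    refine ⟨⟨hx0', ?_⟩, ?_⟩
    · change IsUnit (C (x0, j0) + J)
      rw [hC0, ← two_smul ℝ J]
      exact hJu.smul (Units.mk0 (2:ℝ) two_ne_zero)
    · change cay J (C (x0, j0)) ∈ Metric.ball 0 1
      rw [hC0]; simp [cay]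
  · intro p hp
    exact contDiffAt_fst.prodMk (hprc.contDiffAt.comp p (hcay p hp.1.1 hp.1.2))
  · intro t ht
    have a1 : ContDiffAt ℝ ∞ (fun t : E × antiSp J => H t.1) t := (hH t.1 ht.1).comp t contDiffAt_fst
    have a2 : ContDiffAt ℝ ∞ (fun t : E × antiSp J => H' t.1) t := (hH' t.1 ht.1).comp t contDiffAt_fst
    have a3 : ContDiffAt ℝ ∞ (fun t : E × antiSp J => (t.2 : V →L[ℝ] V)) t :=
      (ContinuousLinearMap.contDiff (𝕜 := ℝ) (E := antiSp J) (F := V →L[ℝ] V) (antiSp J).subtypeL).contDiffAt.comp t contDiffAt_snd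
    have a4 : ContDiffAt ℝ ∞ (fun t : E × antiSp J => cayInv J (t.2 : V →L[ℝ] V)) t := by
      have b1 : ContDiffAt ℝ ∞ (fun t : E × antiSp J => Ring.inverse (1 - (t.2 : V →L[ℝ] V))) t := by
        obtain ⟨u, hu⟩ := isUnit_one_sub_of_norm_lt_one (hT t ht)
        have h1' : ContDiffAt ℝ ∞ Ring.inverse (1 - (t.2 : V →L[ℝ] V)) := by
          rw [← hu]; exact contDiffAt_ringInverse ℝ u
        exact h1'.comp t (contDiffAt_const.sub a3)
      exact b1.mul ((contDiffAt_const.add a3).mul contDiffAt_const)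
    exact contDiffAt_fst.prodMk (a2.clm_comp (a4.clm_comp a1))
  · rintro p ⟨⟨hp1, hp2⟩, hp3⟩ hcomp
    have hCc : CompatWith (fun u v => stdForm J u v) (C p) := hcomp.conj (H p.1) (H' p.1) (hH'H p.1 hp1)
      (hHH' p.1 hp1) (hHβ p.1 hp1)
    have hm : cay J (C p) ∈ antiSp J := cay_mem hJ2 hJ hp2 hCc
    have hprm : pr (cay J (C p)) = ⟨cay J (C p), hm⟩ := hpr ⟨_, hm⟩
    have hn : ‖cay J (C p)‖ < 1 := by simpa using hp3
    refine ⟨⟨hp1, ?_⟩, ?_⟩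
    · change pr (cay J (C p)) ∈ _
      rw [hprm]; simpa using hn
    · change (p.1, (H' p.1).comp ((cayInv J (pr (cay J (C p)) : V →L[ℝ] V)).comp (H p.1))) = p
      rw [hprm]
      refine Prod.ext rfl ?_
      simp only
      rw [cayInv_cay hp2 hn]
      ext v
      simp [C, hH'H p.1 hp1]
  · intro t ht
    have hc := cayInv_compat hJ2 hJ (hT t ht) t.2.2
    have hcay2 := cay_cayInv hJ2 (J := J) (hT t ht)
    refine ⟨⟨⟨ht.1, ?_⟩, ?_⟩, ?_, ?_⟩
    · change IsUnit (C (g t) + J)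
      rw [hCg t ht]; exact cayInv_unit hJ2 (hT t ht)
    · change cay J (C (g t)) ∈ Metric.ball 0 1
      rw [hCg t ht, hcay2]; simpa using hT t ht
    · refine hc.conj (H' t.1) (H t.1) (hHH' t.1 ht.1) (hH'H t.1 ht.1) fun u v => ?_
      change _ = β t.1 _ _
      rw [hHβ t.1 ht.1, hHH' t.1 ht.1, hHH' t.1 ht.1]
    · change (t.1, pr (cay J (C (g t)))) = t
      rw [hCg t ht, hcay2]
      exact Prod.ext rfl (hpr t.2)

end model
section slice
variable {EN HN N F : Type*} [NormedAddCommGroup EN] [NormedSpace ℝ EN] [TopologicalSpace HN]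
  (IN : ModelWithCorners ℝ EN HN) [TopologicalSpace N] [ChartedSpace HN N]
  [NormedAddCommGroup F] [NormedSpace ℝ F] (S : Set N)

/-- A chart `c` of the subset `S` of the manifold `N` (with its subspace topology) with values in the
model space `F` is compatible with the embedded submanifold structure of `S` if the local
parametrization `c.symm` is smooth as a map into `N` and `c` is locally the restriction to `S` of a smooth
map on `N`. Any two such charts are smoothly compatible with each other
(see `IsSliceChart.contDiffOn`). -/
structure IsSliceChart (c : OpenPartialHomeomorph S F) : Prop where
  symm_smooth : ∀ t ∈ c.target, ContMDiffAt 𝓘(ℝ, F) IN ∞ (fun t => (c.symm t : N)) t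
  exists_extension : ∀ z ∈ c.source, ∃ f : N → F,
    ContMDiffAt IN 𝓘(ℝ, F) ∞ f (z : N) ∧ ∀ᶠ z' : S in 𝓝 z, f z' = c z'

variable {IN S}

theorem IsSliceChart.contDiffOn {c c' : OpenPartialHomeomorph S F} (hc : IsSliceChart IN S c)
    (hc' : IsSliceChart IN S c') : ContDiffOn ℝ ∞ (c' ∘ c.symm) (c.symm ≫ₕ c').source := by
  intro t ht
  rw [OpenPartialHomeomorph.trans_source] at ht
  obtain ⟨f, hf, hfe⟩ := hc'.exists_extension (c.symm t) ht.2
  have h1 : ContMDiffAt 𝓘(ℝ, F) 𝓘(ℝ, F) ∞ (fun t => f (c.symm t)) t :=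
    ContMDiffAt.comp t hf (hc.symm_smooth t ht.1)
  have h2 : (fun t => f (c.symm t)) =ᶠ[𝓝 t] c' ∘ c.symm :=
    (c.symm.continuousAt ht.1).eventually hfe
  exact (contMDiffAt_iff_contDiffAt.1 (h1.congr_of_eventuallyEq h2.symm)).contDiffWithinAt

/-- If slice charts cover `S`, then `S` is a manifold modelled on `F`, with the atlas of all slice
charts: this is the structure of an embedded submanifold. -/
noncomputable abbrev sliceChartedSpace
    (h : ∀ z : S, ∃ c : OpenPartialHomeomorph S F, IsSliceChart IN S c ∧ z ∈ c.source) :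
    ChartedSpace F S where
  atlas := {c | IsSliceChart IN S c}
  chartAt z := (h z).choose
  mem_chart_source z := (h z).choose_spec.2
  chart_mem_atlas z := (h z).choose_spec.1

theorem exists_sliceChart [IN.Boundaryless] [IsManifold IN ∞ N] (p : S)
    {W : Set EN} {T : Set F} {f : EN → F} {g : F → EN} (hW : IsOpen W) (hT : IsOpen T)
    (hWt : W ⊆ (extChartAt IN (p : N)).target) (hp : extChartAt IN (p : N) p ∈ W)
    (hf : ∀ y ∈ W, ContDiffAt ℝ ∞ f y) (hg : ∀ t ∈ T, ContDiffAt ℝ ∞ g t)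
    (h1 : ∀ y ∈ W, (extChartAt IN (p : N)).symm y ∈ S → f y ∈ T ∧ g (f y) = y)
    (h2 : ∀ t ∈ T, g t ∈ W ∧ (extChartAt IN (p : N)).symm (g t) ∈ S ∧ f (g t) = t) :
    ∃ c : OpenPartialHomeomorph S F, IsSliceChart IN S c ∧ p ∈ c.source := by
  classical
  set Ψ := extChartAt IN (p : N) with hΨ
  let src : Set N := Ψ.source ∩ Ψ ⁻¹' W
  have hsrc : IsOpen src := (continuousOn_extChartAt (I := IN) (p : N)).isOpen_inter_preimage
    (isOpen_extChartAt_source _) hW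
  have hΨs : ∀ x ∈ Ψ.source, ContMDiffAt IN 𝓘(ℝ, EN) ∞ Ψ x := fun x hx =>
    (contMDiffOn_extChartAt (I := IN) (x := (p : N))).contMDiffAt
      (by
        rw [hΨ, extChartAt_source] at hx
        exact (chartAt HN (p : N)).open_source.mem_nhds hx)
  have hΨt : ∀ y ∈ Ψ.target, ContMDiffAt 𝓘(ℝ, EN) IN ∞ Ψ.symm y := fun y hy =>
    (contMDiffOn_extChartAt_symm (I := IN) (p : N)).contMDiffAt
      ((isOpen_extChartAt_target (I := IN) (p : N)).mem_nhds hy)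
  let inv : F → S := fun t => if h : t ∈ T then ⟨Ψ.symm (g t), (h2 t h).2.1⟩ else p
  have hinv : ∀ t ∈ T, (inv t : N) = Ψ.symm (g t) := fun t ht => by simp [inv, ht]
  have hfΨ : ∀ x ∈ src, ContMDiffAt IN 𝓘(ℝ, F) ∞ (fun x => f (Ψ x)) x := fun x hx =>
    ContMDiffAt.comp x (hf _ hx.2).contMDiffAt (hΨs x hx.1)
  have hgΨ : ∀ t ∈ T, ContMDiffAt 𝓘(ℝ, F) IN ∞ (fun t => Ψ.symm (g t)) t := fun t ht =>
    ContMDiffAt.comp t (hΨt _ (hWt (h2 t ht).1)) (hg t ht).contMDiffAt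
  have hinvs : ∀ t ∈ T, ContMDiffAt 𝓘(ℝ, F) IN ∞ (fun t => (inv t : N)) t := fun t ht =>
    (hgΨ t ht).congr_of_eventuallyEq
      (Filter.eventuallyEq_of_mem (hT.mem_nhds ht) fun t ht => hinv t ht)
  let c : OpenPartialHomeomorph S F :=
    { toFun := fun z => f (Ψ z)
      invFun := inv
      source := Subtype.val ⁻¹' src
      target := T
      map_source' := fun z hz => (h1 _ hz.2 (by rw [Ψ.left_inv hz.1]; exact z.2)).1
      map_target' := fun t ht => by
        change (inv t : N) ∈ src
        rw [hinv t ht]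
        refine ⟨Ψ.map_target (hWt (h2 t ht).1), ?_⟩
        change Ψ (Ψ.symm (g t)) ∈ W
        rw [Ψ.right_inv (hWt (h2 t ht).1)]
        exact (h2 t ht).1
      left_inv' := fun z hz => by
        have h3 := h1 _ hz.2 (by rw [Ψ.left_inv hz.1]; exact z.2)
        apply Subtype.ext
        rw [hinv _ h3.1, h3.2, Ψ.left_inv hz.1]
      right_inv' := fun t ht => by
        rw [hinv t ht, Ψ.right_inv (hWt (h2 t ht).1), (h2 t ht).2.2]
      open_source := hsrc.preimage continuous_subtype_val
      open_target := hT
      continuousOn_toFun := fun z hz =>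
        ((hfΨ z hz).continuousAt.comp continuous_subtype_val.continuousAt).continuousWithinAt
      continuousOn_invFun := by
        rw [Topology.IsInducing.subtypeVal.continuousOn_iff]
        exact fun t ht => (hinvs t ht).continuousAt.continuousWithinAt }
  refine ⟨c, ⟨hinvs, fun z hz => ⟨_, hfΨ z hz, Filter.Eventually.of_forall fun _ => rfl⟩⟩, ?_⟩
  exact ⟨mem_extChartAt_source (I := IN) (p : N), hp⟩

end slice

section forms
variable {E H M : Type*} [NormedAddCommGroup E] [NormedSpace ℝ E] [TopologicalSpace H]
  (I : ModelWithCorners ℝ E H) [TopologicalSpace M] [ChartedSpace H M] {k : ℕ}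

/-- A differential `k`-form `η` in the chart at `x₀`: the pullback of `η` by the inverse of the
chart. -/
noncomputable def formInChart (η : Π x : M, TangentSpace I x [⋀^Fin k]→L[ℝ] ℝ) (x₀ : M) :
    E → E [⋀^Fin k]→L[ℝ] ℝ := fun u =>
  (η ((extChartAt I x₀).symm u)).compContinuousLinearMap
    (mfderivWithin 𝓘(ℝ, E) I (extChartAt I x₀).symm (range I) u)

/-- A differential form is smooth if it is smooth in each chart. -/
def IsSmoothForm (η : Π x : M, TangentSpace I x [⋀^Fin k]→L[ℝ] ℝ) : Prop :=
  ∀ x₀ : M, ContDiffOn ℝ ∞ (formInChart I η x₀) (extChartAt I x₀).target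

/-- The exterior derivative of a differential form on a manifold: at `x`, it is the exterior
derivative of the form in the chart at `x`, pulled back to `M` by the chart. For a `2`-form and vector fields,
`dη(X, Y, Z) = X η(Y, Z) - Y η(X, Z) + Z η(X, Y) - η([X, Y], Z) + η([X, Z], Y) - η([Y, Z], X)`,
without a numerical factor. -/
noncomputable def mextDeriv (η : Π x : M, TangentSpace I x [⋀^Fin k]→L[ℝ] ℝ) (x : M) :
    TangentSpace I x [⋀^Fin (k + 1)]→L[ℝ] ℝ :=
  (extDerivWithin (formInChart I η x) (range I) (extChartAt I x x)).compContinuousLinearMap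
    (mfderiv I 𝓘(ℝ, E) (extChartAt I x) x)

end forms

section twistor

/-- A smooth family of `2`-forms is a smooth family of bilinear forms. -/
theorem exists_bilinear {E : Type*} [NormedAddCommGroup E] [NormedSpace ℝ E] [FiniteDimensional ℝ E]
    {O : Set E} {η : E → E [⋀^Fin 2]→L[ℝ] ℝ} (hη : ContDiffOn ℝ ∞ η O) :
    ∃ β : E → E →L[ℝ] E →L[ℝ] ℝ, ContDiffOn ℝ ∞ β O ∧ ∀ u v w, β u v w = η u ![v, w] := by
  let β : E → E →L[ℝ] E →L[ℝ] ℝ := fun u =>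
    ((ContinuousAlternatingMap.ofSubsingletonLIE (𝕜 := ℝ) (E := E) (F := ℝ) (0 : Fin 1)).symm.toContinuousLinearEquiv :
      E [⋀^Fin 1]→L[ℝ] ℝ →L[ℝ] E →L[ℝ] ℝ).comp (η u).curryLeft
  have hβ : ∀ u v w, β u v w = η u ![v, w] := by
    intro u v w
    change (η u).curryLeft v (fun _ => w) = _
    rw [ContinuousAlternatingMap.curryLeft_apply_apply]
    congr 1
    ext i; fin_cases i <;> rfl
  refine ⟨β, ?_, hβ⟩
  rw [contDiffOn_clm_apply]; intro v
  rw [contDiffOn_clm_apply]; intro w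
  simp only [hβ]
  exact (ContinuousAlternatingMap.apply ℝ E ℝ ![v, w]).contDiff.comp_contDiffOn hη

variable {n : ℕ} {M : Type*} [TopologicalSpace M] [ChartedSpace (EuclideanSpace ℝ (Fin (2 * n))) M]
  [IsManifold (𝓡 (2 * n)) ∞ M]

variable (n M) in
/-- A symplectic form on the `2n`-dimensional manifold `M`: a smooth, closed, nondegenerate
differential `2`-form. -/
structure SymplecticForm where
  toForm : Π x : M, TangentSpace (𝓡 (2 * n)) x [⋀^Fin 2]→L[ℝ] ℝ
  smooth : IsSmoothForm (𝓡 (2 * n)) toForm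
  closed : ∀ x, mextDeriv (𝓡 (2 * n)) toForm x = 0
  nondegenerate : ∀ x v, (∀ w, toForm x ![v, w] = 0) → v = 0

variable (n M) in
/-- The total space of the vector bundle `End(TM)`, a smooth manifold. -/
abbrev EndTM : Type _ :=
  TotalSpace (EuclideanSpace ℝ (Fin (2 * n)) →L[ℝ] EuclideanSpace ℝ (Fin (2 * n)))
    (fun x : M => TangentSpace (𝓡 (2 * n)) x →L[ℝ] TangentSpace (𝓡 (2 * n)) x)

/-- The twistor space as a subset of the total space of `End(TM)`: all pairs `(x, j)`, with `j` a
complex structure on `T_x M`, `ω(j u, j v) = ω(u, v)`, and `ω(v, j v) > 0` for `v ≠ 0`. -/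
def compatSet (Ω : SymplecticForm n M) : Set (EndTM n M) :=
  {p | CompatWith (fun v w => Ω.toForm p.1 ![v, w]) p.2}

/-- The model vector space `ℝ^{2n} × 𝔪_J` of the twistor space. -/
abbrev twistorModel (n : ℕ) : Type :=
  EuclideanSpace ℝ (Fin (2 * n)) × antiSp (stdJ n)

instance : ContMDiffVectorBundle ∞ (EuclideanSpace ℝ (Fin (2 * n)))
    (TangentSpace (𝓡 (2 * n)) : M → Type _) (𝓡 (2 * n)) := by
  have : IsManifold (𝓡 (2 * n)) (∞ + 1) M := ‹IsManifold (𝓡 (2 * n)) ∞ M›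
  exact TangentBundle.contMDiffVectorBundle

/-- The twistor space is an embedded submanifold of the total space of `End(TM)`. -/
theorem exists_twistorChart (Ω : SymplecticForm n M) (p : compatSet Ω) :
    ∃ c : OpenPartialHomeomorph (compatSet Ω) (twistorModel n),
      IsSliceChart ((𝓡 (2 * n)).prod 𝓘(ℝ, EuclideanSpace ℝ (Fin (2 * n)) →L[ℝ] EuclideanSpace ℝ (Fin (2 * n))))
        (compatSet Ω) c ∧ p ∈ c.source := by
  obtain ⟨⟨x₀, j₀⟩, hj₀⟩ := p
  set p : EndTM n M := ⟨x₀, j₀⟩ with hpdef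
  set IN := ((𝓡 (2 * n)).prod 𝓘(ℝ, EuclideanSpace ℝ (Fin (2 * n)) →L[ℝ] EuclideanSpace ℝ (Fin (2 * n)))) with hIN
  obtain ⟨β, hβs, hβ⟩ := exists_bilinear (Ω.smooth x₀)
  set e := trivializationAt (EuclideanSpace ℝ (Fin (2 * n))) (TangentSpace (𝓡 (2 * n)) : M → Type _) x₀ with he
  set φ := extChartAt (𝓡 (2 * n)) x₀ with hφ
  have hes : e.baseSet = φ.source := by
    rw [hφ, extChartAt_source]; rfl
  let ex : ∀ x, x ∈ e.baseSet → TangentSpace (𝓡 (2 * n)) x ≃L[ℝ] EuclideanSpace ℝ (Fin (2 * n)) :=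
    fun x hx => e.continuousLinearEquivAt ℝ x hx
  have hβω : ∀ x (hx : x ∈ e.baseSet) v w, β (φ x) (ex x hx v) (ex x hx w) = Ω.toForm x ![v, w] := by
    intro x hx v w
    have hx' : x ∈ (chartAt (EuclideanSpace ℝ (Fin (2 * n))) x₀).source := hx
    have hsymm := TangentBundle.symmL_trivializationAt (I := 𝓡 (2 * n)) hx'
    rw [hβ, formInChart, ← hsymm]
    have key : ∀ y (hy : y = x) (L : EuclideanSpace ℝ (Fin (2 * n)) →L[ℝ] EuclideanSpace ℝ (Fin (2 * n))),
        (∀ v, L (ex x hx v) = v) →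
        ((Ω.toForm y).compContinuousLinearMap
          (L : EuclideanSpace ℝ (Fin (2 * n)) →L[ℝ] TangentSpace (𝓡 (2 * n)) y))
          ![ex x hx v, ex x hx w] = Ω.toForm x ![v, w] := by
      rintro _ rfl L hL
      change Ω.toForm _ (fun i => L (![ex _ hx v, ex _ hx w] i)) = _
      congr 1
      ext i : 1
      fin_cases i
      · exact hL v
      · exact hL w
    have hL : ∀ v : TangentSpace (𝓡 (2 * n)) x, e.symmL ℝ x (ex x hx v) = v := fun v => by
      rw [← e.symm_continuousLinearEquivAt_eq (R := ℝ) hx]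
      exact (ex x hx).symm_apply_apply v
    exact key _ (φ.left_inv (by rw [← hes]; exact hx)) _ hL
  have hsrc : ∀ q : EndTM n M, q ∈ (extChartAt IN p).source ↔ q.1 ∈ e.baseSet := by
    intro q
    rw [hIN, FiberBundle.extChartAt]
    simp only [PartialEquiv.trans_source, PartialEquiv.prod_source, PartialEquiv.refl_source]
    constructor
    · intro h
      exact ((trivializationAt (EuclideanSpace ℝ (Fin (2 * n)) →L[ℝ] EuclideanSpace ℝ (Fin (2 * n)))
        (fun x : M => TangentSpace (𝓡 (2 * n)) x →L[ℝ] TangentSpace (𝓡 (2 * n)) x) x₀).mem_source.1 h.1).1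
    · intro h
      refine ⟨(Trivialization.mem_source _).2 ⟨h, h⟩, ?_, mem_univ _⟩
      change _ ∈ φ.source
      rw [← hes]
      exact h
  have hext : ∀ (q : EndTM n M) (hq : q.1 ∈ e.baseSet), extChartAt IN p q =
     (φ q.1, (ex q.1 hq : _ →L[ℝ] _).comp (q.2.comp ((ex q.1 hq).symm : _ →L[ℝ] _))) := by
    intro q hq
    have h := hom_chart (HB := EuclideanSpace ℝ (Fin (2 * n))) p q
    rw [ContinuousLinearMap.inCoordinates_eq hq hq] at h
    exact h
  have hcompat : ∀ q : EndTM n M, q.1 ∈ e.baseSet → (q ∈ compatSet Ω ↔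
      CompatWith (fun u v => β (extChartAt IN p q).1 u v) (extChartAt IN p q).2) := by
    intro q hq
    rw [hext q hq]
    have e1 : ∀ u, (ex q.1 hq).symm (ex q.1 hq u) = u := (ex q.1 hq).symm_apply_apply
    have e2 : ∀ u, ex q.1 hq ((ex q.1 hq).symm u) = u := (ex q.1 hq).apply_symm_apply
    constructor
    · intro h
      have h' : CompatWith (fun v w => Ω.toForm q.1 ![v, w]) q.2 := h
      exact h'.conj (ex q.1 hq : TangentSpace (𝓡 (2 * n)) q.1 →L[ℝ] EuclideanSpace ℝ (Fin (2 * n)))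
        ((ex q.1 hq).symm : EuclideanSpace ℝ (Fin (2 * n)) →L[ℝ] TangentSpace (𝓡 (2 * n)) q.1)
        e1 e2 fun u v => (hβω _ hq u v).symm
    · intro h
      have := CompatWith.conj h
        ((ex q.1 hq).symm : EuclideanSpace ℝ (Fin (2 * n)) →L[ℝ] TangentSpace (𝓡 (2 * n)) q.1)
        (ex q.1 hq : TangentSpace (𝓡 (2 * n)) q.1 →L[ℝ] EuclideanSpace ℝ (Fin (2 * n)))
        (Ω := fun v w => Ω.toForm q.1 ![v, w]) e2 e1 (by
          intro u v
          have := hβω _ hq ((ex q.1 hq).symm u) ((ex q.1 hq).symm v)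
          rw [e2, e2] at this
          exact this)
      have h3 : q.2 = ((ex q.1 hq).symm : EuclideanSpace ℝ (Fin (2 * n)) →L[ℝ] TangentSpace (𝓡 (2 * n)) q.1).comp
          (((ex q.1 hq : TangentSpace (𝓡 (2 * n)) q.1 →L[ℝ] EuclideanSpace ℝ (Fin (2 * n))).comp (q.2.comp
          ((ex q.1 hq).symm : EuclideanSpace ℝ (Fin (2 * n)) →L[ℝ] TangentSpace (𝓡 (2 * n)) q.1))).comp
          (ex q.1 hq : TangentSpace (𝓡 (2 * n)) q.1 →L[ℝ] EuclideanSpace ℝ (Fin (2 * n)))) := by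
        ext v
        simp [e1]
      change CompatWith (fun v w => Ω.toForm q.1 ![v, w]) q.2
      rw [h3]
      exact this
  have hx₀ : x₀ ∈ e.baseSet := FiberBundle.mem_baseSet_trivializationAt' x₀
  have hjc := (hcompat p hx₀).1 hj₀
  have hp1 : (extChartAt IN p p).1 = φ x₀ := by rw [hext p hx₀]
  have htgt : ∀ y ∈ φ.target, ∀ v w, β y v w = - β y w v := by
    intro y hy v w
    have h3 := (formInChart (𝓡 (2 * n)) Ω.toForm x₀ y).toAlternatingMap.map_swap ![w, v]
      (i := 0) (j := 1) (by decide)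
    rw [hβ, hβ]
    refine Eq.trans ?_ h3
    change _ = formInChart (𝓡 (2 * n)) Ω.toForm x₀ y _
    congr 1
    ext i : 1
    fin_cases i <;> rfl
  obtain ⟨q, hqj, hqβ⟩ := exists_adapted_frame (n := n) (by simp) (β (φ x₀)) (extChartAt IN p p).2
    (htgt _ (mem_extChartAt_target x₀)) hjc.sq (by rw [← hp1]; exact hjc.inv) (by rw [← hp1]; exact hjc.pos)
  obtain ⟨W, T, f, g, hW, hT, h0, hWO, hf, hg, h1, h2⟩ := exists_local_model (J := stdJ n) stdJ_stdJ
    inner_stdJ_stdJ (isOpen_extChartAt_target (I := 𝓡 (2 * n)) x₀) hβs htgt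
    (mem_extChartAt_target x₀) q hqj hqβ
  have hWt : W ⊆ (extChartAt IN p).target := by
    intro y hy
    have := hWO y hy
    rw [hIN, FiberBundle.extChartAt_target]
    refine ⟨⟨this, ?_⟩, mem_univ _⟩
    have h3 : φ.symm y.1 ∈ e.baseSet := by rw [hes]; exact φ.map_target this
    exact ⟨h3, h3⟩
  have hback : ∀ y ∈ W, ((extChartAt IN p).symm y ∈ compatSet Ω ↔ CompatWith (fun u v => β y.1 u v) y.2) := by
    intro y hy
    rw [hcompat _ ((hsrc _).1 ((extChartAt IN p).map_target (hWt hy))), (extChartAt IN p).right_inv (hWt hy)]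
  exact exists_sliceChart (IN := IN) (S := compatSet Ω) ⟨p, hj₀⟩ hW hT hWt
    (by
      have : extChartAt IN p p = (φ x₀, (extChartAt IN p p).2) := Prod.ext hp1 rfl
      change extChartAt IN p p ∈ W
      rw [this]; exact h0) hf hg
    (fun y hy hS => h1 y hy ((hback y hy).1 hS))
    (fun t ht => ⟨(h2 t ht).1, (hback _ (h2 t ht).1).2 (h2 t ht).2.1, (h2 t ht).2.2⟩)
end twistor

section pullback
variable {E H M EN HN N : Type*} [NormedAddCommGroup E] [NormedSpace ℝ E] [TopologicalSpace H]
  {I : ModelWithCorners ℝ E H} [TopologicalSpace M] [ChartedSpace H M] [IsManifold I 1 M]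
  [NormedAddCommGroup EN] [NormedSpace ℝ EN] [TopologicalSpace HN]
  (IN : ModelWithCorners ℝ EN HN) [TopologicalSpace N] [ChartedSpace HN N] [IsManifold IN 1 N]

instance [FiniteDimensional ℝ E] (x : M) : FiniteDimensional ℝ (TangentSpace I x) :=
  inferInstanceAs (FiniteDimensional ℝ E)

noncomputable section

/-- The pullback connection `f*∇` on `f*TM`, for a map `f : N → M` and a connection `∇` on `TM`:
`pullbackCov f ∇ σ z X` is `(f*∇)_X σ` at `z`, for a section `σ` of `f*TM`. In the local frame `e_i` of `TM`
given by the chart at `f z`, with `σ = ∑ σ^i (e_i ∘ f)`, it is the usual formula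
`(f*∇)_X σ = ∑ dσ^i(X) e_i + ∑ σ^i ∇_{df(X)} e_i`. The first term below is the first sum; in the second
term, `FiberBundle.extend E (σ z)` is the section `∑ σ^i(z) e_i` with constant coefficients. -/
def pullbackCov (f : N → M) (nab : CovariantDerivative I E (TangentSpace I : M → Type _))
    (σ : Π z : N, TangentSpace I (f z)) (z : N) :
    TangentSpace IN z →L[ℝ] TangentSpace I (f z) :=
  ((trivializationAt E (TangentSpace I : M → Type _) (f z)).symmL ℝ (f z)).comp
      (mfderiv IN 𝓘(ℝ, E)
        (fun z' => (trivializationAt E (TangentSpace I : M → Type _) (f z) ⟨f z', σ z'⟩).2) z)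
    + (nab (FiberBundle.extend E (σ z)) (f z)).comp (mfderiv IN I f z)

/-- The section of `f*TM` obtained by pulling back the local extension of the tangent vector `v` with
constant coefficients in the chart at its base point. -/
def pullbackSection (f : N → M) {x : M} (v : TangentSpace I x) (z : N) : TangentSpace I (f z) :=
  FiberBundle.extend E v (f z)

/-- The connection induced by `f*∇` on `End(f*TM)`: for a section `A` of `End(f*TM)`,
`((f*∇)_X A) v = (f*∇)_X (A s) - A ((f*∇)_X s)`, where `s` is a local section of `f*TM` with `s z = v`. The
expression depends only on `v`; it is evaluated on a basis of the fibre and extended linearly. -/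
def pullbackCovEnd [FiniteDimensional ℝ E] (f : N → M) (nab : CovariantDerivative I E (TangentSpace I : M → Type _))
    (A : Π z : N, TangentSpace I (f z) →L[ℝ] TangentSpace I (f z)) (z : N) :
    TangentSpace IN z →ₗ[ℝ] Module.End ℝ (TangentSpace I (f z)) where
  toFun X := (Module.finBasis ℝ (TangentSpace I (f z))).constr ℝ fun i =>
    let s : Π z' : N, TangentSpace I (f z') := pullbackSection f (Module.finBasis ℝ (TangentSpace I (f z)) i)
    pullbackCov IN f nab (fun z' => A z' (s z')) z X - A z (pullbackCov IN f nab s z X)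
  map_add' X Y := by
    refine (Module.finBasis ℝ (TangentSpace I (f z))).ext fun i => ?_
    simp only [Module.Basis.constr_basis, LinearMap.add_apply, map_add]; abel
  map_smul' c X := by
    refine (Module.finBasis ℝ (TangentSpace I (f z))).ext fun i => ?_
    simp only [Module.Basis.constr_basis, LinearMap.smul_apply, map_smul, smul_sub, RingHom.id_apply]

/-- The curvature `R_{X,Y} = [(f*∇)_X, (f*∇)_Y] - (f*∇)_{[X,Y]}` of the pullback connection. To evaluate
it on vectors, `X`, `Y` and the elements of a basis of the fibre are extended to local vector fields and
sections; the result does not depend on the extensions. -/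
def pullbackCurvature [FiniteDimensional ℝ E] (f : N → M) (nab : CovariantDerivative I E (TangentSpace I : M → Type _))
    (z : N) (X Y : TangentSpace IN z) : Module.End ℝ (TangentSpace I (f z)) :=
  (Module.finBasis ℝ (TangentSpace I (f z))).constr ℝ fun i =>
    let s : Π z' : N, TangentSpace I (f z') := pullbackSection f (Module.finBasis ℝ (TangentSpace I (f z)) i)
    let X' : Π z' : N, TangentSpace IN z' := FiberBundle.extend EN X
    let Y' : Π z' : N, TangentSpace IN z' := FiberBundle.extend EN Y
    pullbackCov IN f nab (fun z' => pullbackCov IN f nab s z' (Y' z')) z X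
      - pullbackCov IN f nab (fun z' => pullbackCov IN f nab s z' (X' z')) z Y
      - pullbackCov IN f nab s z (VectorField.mlieBracket IN X' Y' z)

/-- A bilinear form `B` with `B v v = 0` for all `v`, as an alternating `2`-form. -/
def twoFormOfBilin {F : Type*} [NormedAddCommGroup F] [NormedSpace ℝ F] [FiniteDimensional ℝ F]
    (B : F →ₗ[ℝ] F →ₗ[ℝ] ℝ) (hB : ∀ v, B v v = 0) : F [⋀^Fin 2]→L[ℝ] ℝ where
  toFun m := B (m 0) (m 1)
  map_update_add' := by
    intro inst m i x y
    rw [Subsingleton.elim inst (instDecidableEqFin 2)]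
    fin_cases i <;> simp
  map_update_smul' := by
    intro inst m i c x
    rw [Subsingleton.elim inst (instDecidableEqFin 2)]
    fin_cases i <;> simp
  map_eq_zero_of_eq' m i j h hij := by
    have : m 0 = m 1 := by
      fin_cases i <;> fin_cases j <;> simp_all
    rw [this, hB]
  cont := by
    have h : Continuous fun m : Fin 2 → F => B.toContinuousBilinearMap (m 0) (m 1) := by fun_prop
    exact h
end
end pullback

/-- The alternating form `(X, Y) ↦ ½ Tr (A X ∘ J ∘ A Y)`, for a linear map `A` with values in the
endomorphisms that anticommute with `J`. -/
noncomputable def skewTraceForm {F V : Type*} [NormedAddCommGroup F] [NormedSpace ℝ F] [FiniteDimensional ℝ F]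
    [AddCommGroup V] [Module ℝ V] (J : Module.End ℝ V) (A : F →ₗ[ℝ] Module.End ℝ V)
    (hA : ∀ X, A X * J = -(J * A X)) : F [⋀^Fin 2]→L[ℝ] ℝ :=
  twoFormOfBilin
    (LinearMap.mk₂ ℝ (fun X Y => (1 / 2 : ℝ) * LinearMap.trace ℝ V (A X * J * A Y))
      (fun X X' Y => by simp only [map_add, add_mul, mul_add])
      (fun c X Y => by simp only [map_smul, smul_mul_assoc, smul_eq_mul]; ring)
      (fun X Y Y' => by simp only [map_add, mul_add])
      (fun c X Y => by simp only [map_smul, mul_smul_comm, smul_eq_mul]; ring))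
    (fun X => by
      have h2 : LinearMap.trace ℝ V (A X * J * A X) = - LinearMap.trace ℝ V (A X * J * A X) := by
        conv_lhs => rw [hA, neg_mul, map_neg, mul_assoc, LinearMap.trace_mul_comm, mul_assoc,
          LinearMap.trace_mul_comm]
      change (1 / 2 : ℝ) * _ = 0
      linarith)

section twistorSpace

variable {n : ℕ} {M : Type*} [TopologicalSpace M] [ChartedSpace (EuclideanSpace ℝ (Fin (2 * n))) M]
  [IsManifold (𝓡 (2 * n)) ∞ M]

/-- The twistor space `𝒵⁰` of a symplectic manifold, with the subspace topology and the structure of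
an embedded submanifold of the total space of `End(TM)`. -/
def TwistorSpace (Ω : SymplecticForm n M) : Type _ := compatSet Ω

namespace TwistorSpace

noncomputable section

variable (Ω : SymplecticForm n M)

instance : TopologicalSpace (TwistorSpace Ω) := inferInstanceAs (TopologicalSpace (compatSet Ω))

instance : ChartedSpace (twistorModel n) (TwistorSpace Ω) :=
  sliceChartedSpace (S := compatSet Ω) (exists_twistorChart Ω)

instance : IsManifold 𝓘(ℝ, twistorModel n) ∞ (TwistorSpace Ω) := by
  refine isManifold_of_contDiffOn _ _ _ fun c c' hc hc' => ?_
  have := IsSliceChart.contDiffOn (S := compatSet Ω) hc hc'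
  simp only [modelWithCornersSelf_coe, modelWithCornersSelf_coe_symm, Function.id_comp, Function.comp_id, preimage_id, range_id, inter_univ]
  exact this

instance : IsManifold 𝓘(ℝ, twistorModel n) 1 (TwistorSpace Ω) := IsManifold.of_le (n := ∞) (by simp)

variable {Ω}
/-- The bundle projection `π` from the twistor space to `M`. -/
def proj (z : TwistorSpace Ω) : M := z.1.1

/-- The canonical section `Φ` of `End(π*TM)`: at the point `j` of the twistor space it is `j`. -/
def Phi (z : TwistorSpace Ω) :
    TangentSpace (𝓡 (2 * n)) (proj z) →L[ℝ] TangentSpace (𝓡 (2 * n)) (proj z) := z.1.2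

theorem contMDiff_val : ContMDiff 𝓘(ℝ, twistorModel n)
    ((𝓡 (2 * n)).prod 𝓘(ℝ, EuclideanSpace ℝ (Fin (2 * n)) →L[ℝ] EuclideanSpace ℝ (Fin (2 * n)))) ∞
    (fun z : TwistorSpace Ω => (z.1 : EndTM n M)) := by
  intro z
  let c : OpenPartialHomeomorph (TwistorSpace Ω) (twistorModel n) := chartAt (twistorModel n) z
  have hc : IsSliceChart ((𝓡 (2 * n)).prod 𝓘(ℝ, EuclideanSpace ℝ (Fin (2 * n)) →L[ℝ] EuclideanSpace ℝ (Fin (2 * n))))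
    (compatSet Ω) c := chart_mem_atlas (twistorModel n) z
  have h1 : ContMDiffAt 𝓘(ℝ, twistorModel n) 𝓘(ℝ, twistorModel n) ∞ (chartAt (twistorModel n) z) z :=
    contMDiffAt_of_mem_maximalAtlas (IsManifold.chart_mem_maximalAtlas z) (mem_chart_source _ z)
  have h3 : ContMDiffAt 𝓘(ℝ, twistorModel n)
      ((𝓡 (2 * n)).prod 𝓘(ℝ, EuclideanSpace ℝ (Fin (2 * n)) →L[ℝ] EuclideanSpace ℝ (Fin (2 * n)))) ∞
      (fun t => ((c.symm t).1 : EndTM n M)) (c z) :=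
    hc.symm_smooth _ (mem_chart_target (twistorModel n) z)
  have h2 : ContMDiffAt 𝓘(ℝ, twistorModel n)
      ((𝓡 (2 * n)).prod 𝓘(ℝ, EuclideanSpace ℝ (Fin (2 * n)) →L[ℝ] EuclideanSpace ℝ (Fin (2 * n)))) ∞
      (fun z' : TwistorSpace Ω => ((c.symm (c z')).1 : EndTM n M)) z :=
    ContMDiffAt.comp (M := TwistorSpace Ω) (I' := 𝓘(ℝ, twistorModel n))
      (g := fun t => ((c.symm t).1 : EndTM n M)) z h3 h1
  refine h2.congr_of_eventuallyEq ?_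
  filter_upwards [(chartAt (twistorModel n) z).open_source.mem_nhds (mem_chart_source _ z)] with z' hz'
  exact congrArg Subtype.val ((chartAt (twistorModel n) z).left_inv hz').symm

/-- The section `Φ` as a matrix-valued function on the twistor space, near the fibre over `x₀`, in
the frame of `TM` given by the chart at `x₀`. -/
def PhiInCoordinates (x₀ : M) (z : TwistorSpace Ω) :
    EuclideanSpace ℝ (Fin (2 * n)) →L[ℝ] EuclideanSpace ℝ (Fin (2 * n)) :=
  ContinuousLinearMap.inCoordinates (EuclideanSpace ℝ (Fin (2 * n))) (TangentSpace (𝓡 (2 * n)) : M → Type _)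
    (EuclideanSpace ℝ (Fin (2 * n))) (TangentSpace (𝓡 (2 * n)) : M → Type _) x₀ (proj z) x₀ (proj z) (Phi z)

/-- The derivative of `Φ` at `z` in the frame of `TM` given by the chart at `π z`. It depends on the
chart, except on vertical vectors `X`: these are tangent to the fibre over `x = π z`, which is a submanifold of
the vector space `End(T_x M)`, and then `fibreVelocity z X` is the tangent vector `X` as an element of
`End(T_x M)`, that is, the derivative `j'(0)` of a curve `j(t)` in the fibre that represents `X`. -/
def fibreVelocity (z : TwistorSpace Ω) :
    TangentSpace 𝓘(ℝ, twistorModel n) z →ₗ[ℝ] Module.End ℝ (TangentSpace (𝓡 (2 * n)) (proj z)) where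
  toFun X :=
    let e := trivializationAt (EuclideanSpace ℝ (Fin (2 * n))) (TangentSpace (𝓡 (2 * n)) : M → Type _) (proj z)
    let D : EuclideanSpace ℝ (Fin (2 * n)) →L[ℝ] EuclideanSpace ℝ (Fin (2 * n)) :=
      mfderiv 𝓘(ℝ, twistorModel n) 𝓘(ℝ, EuclideanSpace ℝ (Fin (2 * n)) →L[ℝ] EuclideanSpace ℝ (Fin (2 * n)))
        (PhiInCoordinates (Ω := Ω) (proj z)) z X
    ((e.symmL ℝ (proj z)).comp (D.comp (e.continuousLinearMapAt ℝ (proj z)))).toLinearMap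
  map_add' X Y := by
    refine LinearMap.ext fun v => ?_
    have h := ContinuousLinearMap.map_add
      (mfderiv 𝓘(ℝ, twistorModel n) 𝓘(ℝ, EuclideanSpace ℝ (Fin (2 * n)) →L[ℝ] EuclideanSpace ℝ (Fin (2 * n)))
        (PhiInCoordinates (Ω := Ω) (proj z)) z) X Y
    rw [h]
    exact ContinuousLinearMap.map_add (Trivialization.symmL ℝ _ (proj z)) _ _
  map_smul' c X := by
    refine LinearMap.ext fun v => ?_
    have h := ContinuousLinearMap.map_smul
      (mfderiv 𝓘(ℝ, twistorModel n) 𝓘(ℝ, EuclideanSpace ℝ (Fin (2 * n)) →L[ℝ] EuclideanSpace ℝ (Fin (2 * n)))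
        (PhiInCoordinates (Ω := Ω) (proj z)) z) c X
    rw [h]
    exact ContinuousLinearMap.map_smul (Trivialization.symmL ℝ _ (proj z)) c _

theorem fibreVelocity_anticomm (z : TwistorSpace Ω) (X : TangentSpace 𝓘(ℝ, twistorModel n) z)
    (v : TangentSpace (𝓡 (2 * n)) (proj z)) :
    fibreVelocity z X (Phi z v) = - Phi z (fibreVelocity z X v) := by
  set e := trivializationAt (EuclideanSpace ℝ (Fin (2 * n))) (TangentSpace (𝓡 (2 * n)) : M → Type _) (proj z) with he
  have hz : proj z ∈ e.baseSet := FiberBundle.mem_baseSet_trivializationAt' (proj z)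
  have hdiff : ContMDiffAt 𝓘(ℝ, twistorModel n)
     𝓘(ℝ, EuclideanSpace ℝ (Fin (2 * n)) →L[ℝ] EuclideanSpace ℝ (Fin (2 * n))) ∞ (PhiInCoordinates (Ω := Ω) (proj z)) z :=
    ((contMDiffAt_hom_bundle _).1 (contMDiff_val z)).2
  have hproj : ContinuousAt (proj (Ω := Ω)) z :=
    ((contMDiffAt_hom_bundle _).1 (contMDiff_val z)).1.continuousAt
  have hcoord : ∀ z' : TwistorSpace Ω, proj z' ∈ e.baseSet → ∀ u, PhiInCoordinates (proj z) z' u =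
      e.continuousLinearMapAt ℝ (proj z') (Phi z' (e.symmL ℝ (proj z') u)) := by
    intro z' h u
    rfl
  have hsq : ∀ z' : TwistorSpace Ω, proj z' ∈ e.baseSet →
      (PhiInCoordinates (proj z) z').comp (PhiInCoordinates (proj z) z') = -1 := by
    intro z' h
    ext1 u
    have h4 : ∀ w, Phi z' (Phi z' w) = - w := z'.2.sq
    rw [ContinuousLinearMap.comp_apply, hcoord z' h, hcoord z' h,
      e.symmL_continuousLinearMapAt h, h4, map_neg, e.continuousLinearMapAt_symmL h]
    rfl
  set D : EuclideanSpace ℝ (Fin (2 * n)) →L[ℝ] EuclideanSpace ℝ (Fin (2 * n)) :=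
      mfderiv 𝓘(ℝ, twistorModel n) 𝓘(ℝ, EuclideanSpace ℝ (Fin (2 * n)) →L[ℝ] EuclideanSpace ℝ (Fin (2 * n)))
        (PhiInCoordinates (Ω := Ω) (proj z)) z X with hD
  have hvel : ∀ w, fibreVelocity z X w = e.symmL ℝ (proj z) (D (e.continuousLinearMapAt ℝ (proj z) w)) :=
    fun w => rfl
  have hanti : ∀ u, D (PhiInCoordinates (proj z) z u) = - PhiInCoordinates (proj z) z (D u) := by
    have hm : HasMFDerivAt 𝓘(ℝ, twistorModel n)
      𝓘(ℝ, EuclideanSpace ℝ (Fin (2 * n)) →L[ℝ] EuclideanSpace ℝ (Fin (2 * n)))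
      (PhiInCoordinates (Ω := Ω) (proj z)) z
      (mfderiv 𝓘(ℝ, twistorModel n) 𝓘(ℝ, EuclideanSpace ℝ (Fin (2 * n)) →L[ℝ] EuclideanSpace ℝ (Fin (2 * n)))
        (PhiInCoordinates (Ω := Ω) (proj z)) z) := (hdiff.mdifferentiableAt (by simp)).hasMFDerivAt
    have hq : HasFDerivAt (fun B : EuclideanSpace ℝ (Fin (2 * n)) →L[ℝ] EuclideanSpace ℝ (Fin (2 * n)) => B.comp B)
       _ (PhiInCoordinates (proj z) z) := (hasFDerivAt_id _).clm_comp (hasFDerivAt_id _)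
    have hc := (hq.hasMFDerivAt).comp z hm
    have hconst := (hasMFDerivAt_const (I := 𝓘(ℝ, twistorModel n))
       (I' := 𝓘(ℝ, EuclideanSpace ℝ (Fin (2 * n)) →L[ℝ] EuclideanSpace ℝ (Fin (2 * n))))
       (-1 : EuclideanSpace ℝ (Fin (2 * n)) →L[ℝ] EuclideanSpace ℝ (Fin (2 * n))) z)
    have hev : (fun z' : TwistorSpace Ω => (PhiInCoordinates (proj z) z').comp (PhiInCoordinates (proj z) z'))
        =ᶠ[𝓝 z] fun _ => -1 := by
      filter_upwards [hproj (e.open_baseSet.mem_nhds hz)] with z' hz'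
      exact hsq z' hz'
    have hu := hasMFDerivAt_unique hc (hconst.congr_of_eventuallyEq hev)
    intro u
    have h5 := congrArg (fun L => L X) hu
    have h6 : (PhiInCoordinates (proj z) z).comp D + D.comp (PhiInCoordinates (proj z) z) = 0 := h5
    have h7 := congrArg (fun L => L u) h6
    have h8 : PhiInCoordinates (proj z) z (D u) + D (PhiInCoordinates (proj z) z u) = 0 := h7
    exact eq_neg_of_add_eq_zero_right h8
  rw [hvel, hvel]
  have h9 : e.continuousLinearMapAt ℝ (proj z) (Phi z v) =
      PhiInCoordinates (proj z) z (e.continuousLinearMapAt ℝ (proj z) v) := by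
    rw [hcoord z hz, e.symmL_continuousLinearMapAt hz]
  rw [h9, hanti, hcoord z hz, map_neg, e.symmL_continuousLinearMapAt hz]

end
end TwistorSpace

/-- A symplectic connection: a smooth linear connection `∇` on `TM` without torsion and with
`∇ω = 0`, that is, `X (ω(Y, Z)) = ω(∇_X Y, Z) + ω(Y, ∇_X Z)`. -/
structure SymplecticConnection (Ω : SymplecticForm n M) where
  cov : CovariantDerivative (𝓡 (2 * n)) (EuclideanSpace ℝ (Fin (2 * n)))
    (TangentSpace (𝓡 (2 * n)) : M → Type _)
  smooth : CovariantDerivative.ContMDiffCovariantDerivative cov ∞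
  torsion_free : cov.torsion = 0
  parallel : ∀ (Y Z : Π x : M, TangentSpace (𝓡 (2 * n)) x) (x : M),
    MDifferentiableAt (𝓡 (2 * n)) (𝓡 (2 * n)).tangent
      (fun x => (⟨x, Y x⟩ : TangentBundle (𝓡 (2 * n)) M)) x →
    MDifferentiableAt (𝓡 (2 * n)) (𝓡 (2 * n)).tangent
      (fun x => (⟨x, Z x⟩ : TangentBundle (𝓡 (2 * n)) M)) x →
    ∀ X : TangentSpace (𝓡 (2 * n)) x,
      mfderiv (𝓡 (2 * n)) 𝓘(ℝ, ℝ) (fun y => Ω.toForm y ![Y y, Z y]) x X =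
        Ω.toForm x ![cov Y x X, Z x] + Ω.toForm x ![Y x, cov Z x X]

namespace TwistorSpace
noncomputable section
variable {Ω : SymplecticForm n M} (conn : SymplecticConnection Ω) (z : TwistorSpace Ω)

/-- The vertical space `𝒱 = ker dπ` at `z`. -/
def vertical : Submodule ℝ (TangentSpace 𝓘(ℝ, twistorModel n) z) :=
  LinearMap.ker (mfderiv 𝓘(ℝ, twistorModel n) (𝓡 (2 * n)) (proj (Ω := Ω)) z).toLinearMap

/-- The curvature `R_{X,Y}` of `π*∇`. -/
def curvature (X Y : TangentSpace 𝓘(ℝ, twistorModel n) z) :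
    Module.End ℝ (TangentSpace (𝓡 (2 * n)) (proj z)) :=
  pullbackCurvature 𝓘(ℝ, twistorModel n) proj conn.cov z X Y

/-- The covariant derivative `X ↦ (π*∇)_X Φ`. -/
def covPhi : TangentSpace 𝓘(ℝ, twistorModel n) z →ₗ[ℝ] Module.End ℝ (TangentSpace (𝓡 (2 * n)) (proj z)) :=
  pullbackCovEnd 𝓘(ℝ, twistorModel n) proj conn.cov Phi z

/-- The horizontal space `{X | (π*∇)_X Φ = 0}` at `z`. -/
def horizontal : Submodule ℝ (TangentSpace 𝓘(ℝ, twistorModel n) z) :=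
  LinearMap.ker (covPhi conn z)

open Classical in
/-- The projection of the tangent space of the twistor space onto the vertical space, with kernel the
horizontal space. (The two are always complementary for a symplectic connection, so that the value `0` in the
other case never occurs.) -/
def verticalProj : TangentSpace 𝓘(ℝ, twistorModel n) z →ₗ[ℝ] TangentSpace 𝓘(ℝ, twistorModel n) z :=
  if h : IsCompl (vertical z) (horizontal conn z) then (vertical z).projection (horizontal conn z) h else 0

/-- The identification of the vertical space at `j` with `𝔪_j = {A ∈ sp(T_x M, ω) | A j = -j A}`. The
vertical vector with velocity `a = j'(0)` corresponds to the infinitesimal symplectic transformation `A` that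
generates it: `A` is the unique element of `𝔪_j` with `a = [A, j]`. As `a j = -j a`, this is
`A = ½ j a`. Only the values on vertical vectors are used. -/
def toEnd : TangentSpace 𝓘(ℝ, twistorModel n) z →ₗ[ℝ] Module.End ℝ (TangentSpace (𝓡 (2 * n)) (proj z)) :=
  (1 / 2 : ℝ) • (LinearMap.mulLeft ℝ ((Phi z).toLinearMap : Module.End ℝ (TangentSpace (𝓡 (2 * n)) (proj z))) ∘ₗ
    fibreVelocity z)

/-- The projection `P` onto the vertical space, with values in `𝔪_j ⊆ End(T_x M)`. -/
def P : TangentSpace 𝓘(ℝ, twistorModel n) z →ₗ[ℝ] Module.End ℝ (TangentSpace (𝓡 (2 * n)) (proj z)) :=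
  toEnd z ∘ₗ verticalProj conn z

theorem toEnd_anticomm (X : TangentSpace 𝓘(ℝ, twistorModel n) z) :
    toEnd z X * (Phi z).toLinearMap = - ((Phi z).toLinearMap * toEnd z X) := by
  refine LinearMap.ext fun v => ?_
  change (1 / 2 : ℝ) • Phi z (fibreVelocity z X (Phi z v)) = - Phi z ((1 / 2 : ℝ) • Phi z (fibreVelocity z X v))
  rw [fibreVelocity_anticomm, map_neg, map_smul, smul_neg]

/-- The differential `2`-form `τ(X, Y) = ½ Tr ((P X) Φ (P Y))` on the twistor space. -/
def tau : TangentSpace 𝓘(ℝ, twistorModel n) z [⋀^Fin 2]→L[ℝ] ℝ :=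
  skewTraceForm (F := twistorModel n) (Phi z).toLinearMap (P conn z)
    fun X => toEnd_anticomm z (verticalProj conn z X)

theorem tau_apply (X Y : TangentSpace 𝓘(ℝ, twistorModel n) z) : tau conn z ![X, Y] =
  (1 / 2) * LinearMap.trace ℝ (TangentSpace (𝓡 (2 * n)) (proj z))
          (P conn z X * (Phi z).toLinearMap * P conn z Y) := rfl

end
end TwistorSpace

end twistorSpace

/-! Write `N_X = (π*∇)_X Φ`. On horizontal vectors `N` vanishes, and on vertical vectors it is the
velocity in the fibre, so `N_X` is the velocity of the vertical part of `X`. A velocity `a`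
corresponds to the endomorphism `½ Φ a`, hence `P X = ½ Φ N_X`, and `Φ² = -1` gives `τ(X, Y) = -⅛
Tr(Φ N_X N_Y)` (`P_apply`, `tau_eq_trace_covPhi`). It remains to differentiate this trace.

In a chart of the twistor space and a frame of `TM` the connection is `d + θ` and `N = dΦ + [θ, Φ]`.
The trace kills commutators with `θ`, so partial derivatives of the trace may be computed with
covariant derivatives of the factors. The derivative of the factor `Φ` contributes `Tr(N_X N_Y
N_Z)`, which is zero because each `N` anticommutes with `Φ`. The other terms of the cyclic sum
combine into `Tr(Φ (∇_X N_Y - ∇_Y N_X) N_Z)` and its cyclic permutations. The antisymmetrized second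
derivative of `Φ` is `[R_{X,Y}, Φ]`, and `Tr(Φ [R, Φ] N) = 2 Tr(R N)` for `N` anticommuting with
`Φ`. This yields the constant `2 · (-⅛) = -¼`. The algebra is `cyclic_trace_identity`, the calculus
on a vector space is `extDeriv_trace_covDerivForm`.

The passage from the manifold to the vector space rests on `pullbackCovEnd_in_chart` and
`pullbackCurvature_in_chart`: the connection on `End(π*TM)` becomes `d + [θ, ·]`, and the curvature
becomes `dθ + θ ∧ θ`, since coordinate fields have zero bracket.

The formula for `P` presupposes that the vertical and horizontal spaces are complementary
(`isCompl_vertical_horizontal`). They meet only in zero, because a tangent vector of the submanifold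
is determined by its projection to `M` and its velocity in the fibre. Differentiating the
compatibility of `Φ` with the parallel form `ω` shows that `N` takes values in a copy of the model
space of the fibre, so its kernel is large enough for the dimensions to add up. -/

set_option linter.unusedSectionVars false

/-! ### Trace identities for an almost complex structure -/

section traceIdentity
variable {𝒜 : Type*} [Ring 𝒜] [Algebra ℝ 𝒜] (tr : 𝒜 →ₗ[ℝ] ℝ) {J : 𝒜}

/-- An odd number of factors makes `p = a * b * c` anticommute with `J`. Then `J p J = p`, whereas
cyclicity of the trace gives `tr (J p J) = -tr p`. -/
theorem trace_mul_anticomm_eq_zero (htr : ∀ a b, tr (a * b) = tr (b * a)) (hJ : J * J = -1)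
    {a b c : 𝒜} (ha : a * J = -(J * a)) (hb : b * J = -(J * b)) (hc : c * J = -(J * c)) :
    tr (a * b * c) = 0 := by
  have h1 : a * b * c * J = -(J * (a * b * c)) := by
    rw [mul_assoc _ c, hc, mul_neg, ← mul_assoc, mul_assoc a b, hb, mul_neg, ← mul_assoc a, ha]
    noncomm_ring
  have h2 : tr (J * (a * b * c * J)) = -tr (a * b * c) := by
    rw [htr, mul_assoc, hJ]; simp
  have h3 : tr (J * (a * b * c * J)) = tr (a * b * c) := by
    rw [h1, mul_neg, ← mul_assoc, hJ]; simp
  linarith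

/-- The part of `r` that commutes with `J` contributes to neither side, and for the part that
anticommutes with `J` one has `J [r, J] = 2 r`. -/
theorem trace_curvature_bracket (htr : ∀ a b, tr (a * b) = tr (b * a)) (hJ : J * J = -1)
    {r c : 𝒜} (hc : c * J = -(J * c)) :
    tr (J * (r * J - J * r) * c) = 2 * tr (r * c) := by
  have h1 : tr (J * r * (J * c)) = tr (r * c) := by
    rw [← neg_eq_iff_eq_neg.2 hc, mul_neg, map_neg, ← mul_assoc, htr, ← mul_assoc, ← mul_assoc, hJ]
    simp
  have h2 : J * (r * J - J * r) * c = J * r * (J * c) - (J * J) * (r * c) := by noncomm_ring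
  rw [h2, map_sub, h1, hJ, neg_one_mul, map_neg]
  ring

/-- The cyclic sum of the derivatives of `tr (J N_Y N_Z)`, where `N` is the covariant derivative of
an almost complex structure `J` for a connection form `t`. Here `a`, `h` and `s` are the first and
second derivatives of `J` and the derivative of `t` at a point. -/
theorem cyclic_trace_identity (htr : ∀ a b, tr (a * b) = tr (b * a)) (hJ : J * J = -1)
    {ι : Type*} (a t N : ι → 𝒜) (h s m : ι → ι → 𝒜)
    (hN : ∀ x, N x = a x + (t x * J - J * t x)) (hNJ : ∀ x, N x * J = -(J * N x))
    (hh : ∀ x y, h x y = h y x)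
    (hm : ∀ x y, m x y = h x y + ((s x y * J + t y * a x) - (a x * t y + J * s x y)))
    (x y z : ι) :
    tr (a x * N y * N z + J * m x y * N z + J * N y * m x z)
      + tr (a y * N z * N x + J * m y z * N x + J * N z * m y x)
      + tr (a z * N x * N y + J * m z x * N y + J * N x * m z y) =
    2 * (tr ((s x y - s y x + (t x * t y - t y * t x)) * N z)
      + tr ((s y z - s z y + (t y * t z - t z * t y)) * N x)
      + tr ((s z x - s x z + (t z * t x - t x * t z)) * N y)) := by
  -- `m x y` is the partial derivative of `N y` in the direction `x`; `k x y` is the covariant one.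
  let k : ι → ι → 𝒜 := fun x y => m x y + (t x * N y - N y * t x)
  -- The Ricci identity for `J`: the symmetric second derivatives `h` cancel, and the commutator of
  -- the curvature with `J` is left.
  have hk : ∀ x y, k x y - k y x = (s x y - s y x + (t x * t y - t y * t x)) * J
      - J * (s x y - s y x + (t x * t y - t y * t x)) := by
    intro x y
    simp only [k, hm, hN, hh x y]
    noncomm_ring
  have h3 : ∀ x y z, tr (N x * N y * N z) = 0 := fun x y z =>
    trace_mul_anticomm_eq_zero tr htr hJ (hNJ x) (hNJ y) (hNJ z)
  -- Passing from partial to covariant derivatives of the three factors changes the product by its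
  -- commutator with `t x`, which has trace zero. The minus sign on the right comes from moving `J`
  -- past `N y`.
  have hexp : ∀ x y z, tr (a x * N y * N z + J * m x y * N z + J * N y * m x z) =
      tr (J * k x y * N z) - tr (J * k x z * N y) := by
    intro x y z
    have e1 : a x * N y * N z + J * m x y * N z + J * N y * m x z =
        N x * N y * N z + J * k x y * N z + J * N y * k x z
          - (t x * (J * N y * N z) - (J * N y * N z) * t x) := by
      rw [eq_sub_of_add_eq (hN x).symm]
      simp only [k]
      noncomm_ring
    have e2 : tr (J * N y * k x z) = - tr (J * k x z * N y) := by
      rw [← neg_eq_iff_eq_neg.2 (hNJ y), neg_mul, map_neg, mul_assoc, htr]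
    rw [e1, map_sub, map_sub, htr (t x), sub_self, sub_zero, map_add, map_add, h3, e2]
    ring
  have hR : ∀ x y z, tr ((s x y - s y x + (t x * t y - t y * t x)) * N z) * 2 =
      tr (J * k x y * N z) - tr (J * k y x * N z) := by
    intro x y z
    rw [mul_comm, ← trace_curvature_bracket tr htr hJ (hNJ z), ← hk, mul_sub, sub_mul, map_sub]
  rw [hexp, hexp, hexp]
  linarith [hR x y z, hR y z x, hR z x y]

end traceIdentity

/-! ### The exterior derivative of the trace form on a vector space -/

section calculus
variable {F : Type*} [NormedAddCommGroup F] [NormedSpace ℝ F]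

/-- A `2`-form on a finite-dimensional space is differentiable if its values are. -/
theorem differentiableAt_twoForm [FiniteDimensional ℝ F] {η : F → F [⋀^Fin 2]→L[ℝ] ℝ} {u₀ : F}
    (h : ∀ X Y, DifferentiableAt ℝ (fun u => η u ![X, Y]) u₀) : DifferentiableAt ℝ η u₀ := by
  let b := Module.finBasis ℝ F
  let ev : (F [⋀^Fin 2]→L[ℝ] ℝ) →ₗ[ℝ] ((Fin 2 → Fin (Module.finrank ℝ F)) → ℝ) :=
    { toFun := fun ζ v => ζ fun i => b (v i)
      map_add' := fun _ _ => rfl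
      map_smul' := fun _ _ => rfl }
  have hinj : LinearMap.ker ev = ⊥ := by
    rw [LinearMap.ker_eq_bot]
    intro ζ ζ' hζ
    have h1 : ζ.toMultilinearMap = ζ'.toMultilinearMap :=
      Module.Basis.ext_multilinear (fun _ => b) fun v => congrFun hζ v
    ext m
    exact congrArg (fun L => L m) h1
  -- A left inverse of the evaluation on pairs of basis vectors reconstructs `η` linearly from
  -- finitely many of its values.
  obtain ⟨A, hA⟩ := ev.exists_leftInverse_of_injective hinj
  have hη : η = fun u => LinearMap.toContinuousLinearMap A (ev (η u)) :=
    funext fun u => (LinearMap.congr_fun hA (η u)).symm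
  rw [hη]
  refine (LinearMap.toContinuousLinearMap A).differentiableAt.comp u₀ ?_
  rw [differentiableAt_pi]
  intro v
  refine (h (b (v 0)) (b (v 1))).congr_of_eventuallyEq (Filter.Eventually.of_forall fun u => ?_)
  change η u _ = η u _
  congr 1
  ext i : 1
  fin_cases i <;> rfl

/-- For constant fields the bracket terms of `d` vanish. Exchanging the arguments of the middle term
absorbs its alternating sign and makes the sum cyclic. -/
theorem extDeriv_twoForm_apply {η : F → F [⋀^Fin 2]→L[ℝ] ℝ} {u₀ : F} (h : DifferentiableAt ℝ η u₀)
    (X Y Z : F) : extDeriv η u₀ ![X, Y, Z] = fderiv ℝ (fun u => η u ![Y, Z]) u₀ X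
      + fderiv ℝ (fun u => η u ![Z, X]) u₀ Y + fderiv ℝ (fun u => η u ![X, Y]) u₀ Z := by
  rw [extDeriv_apply h, Fin.sum_univ_three]
  have e0 : (0 : Fin 3).removeNth ![X, Y, Z] = ![Y, Z] := by ext i; fin_cases i <;> rfl
  have e1 : (1 : Fin 3).removeNth ![X, Y, Z] = ![X, Z] := by ext i; fin_cases i <;> rfl
  have e2 : (2 : Fin 3).removeNth ![X, Y, Z] = ![X, Y] := by ext i; fin_cases i <;> rfl
  have e3 : (fun u => η u ![Z, X]) = fun u => -η u ![X, Z] := by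
    funext u
    have := (η u).toAlternatingMap.map_swap ![X, Z] (i := 0) (j := 1) (by decide)
    refine Eq.trans ?_ this
    change η u _ = η u _
    congr 1
    ext i : 1
    fin_cases i <;> rfl
  rw [e0, e1, e2, e3, fderiv_fun_neg]
  simp

variable {𝒜 : Type*} [NormedRing 𝒜] [NormedAlgebra ℝ 𝒜]

/-- The covariant derivative `dJ + [θ, J]` of an algebra-valued function, for the connection form `θ`. -/
noncomputable def covDerivForm (J : F → 𝒜) (θ : F → F →L[ℝ] 𝒜) (u X : F) : 𝒜 :=
  fderiv ℝ J u X + (θ u X * J u - J u * θ u X)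

/-- The curvature `dθ + θ ∧ θ` of the connection form `θ`. -/
noncomputable def curvatureForm (θ : F → F →L[ℝ] 𝒜) (u X Y : F) : 𝒜 :=
  fderiv ℝ θ u X Y - fderiv ℝ θ u Y X + (θ u X * θ u Y - θ u Y * θ u X)

/-- The operator `d + [θ, ·]` is a derivation and kills constants that are central, so it can be
applied to `J² = -1`. -/
theorem covDerivForm_anticomm {J : F → 𝒜} (θ : F → F →L[ℝ] 𝒜) {u : F} (hJ : DifferentiableAt ℝ J u)
    (hJ2 : ∀ᶠ u in 𝓝 u, J u * J u = -1) (X : F) :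
    covDerivForm J θ u X * J u = -(J u * covDerivForm J θ u X) := by
  have h1 : fderiv ℝ (fun u => J u * J u) u = 0 := by
    have : (fun u => J u * J u) =ᶠ[𝓝 u] fun _ => -1 := hJ2
    rw [this.fderiv_eq]
    simp
  rw [fderiv_fun_mul' hJ hJ] at h1
  have h2 := congrArg (fun L => L X) h1
  simp at h2
  have h3 := hJ2.self_of_nhds
  have e : covDerivForm J θ u X * J u + J u * covDerivForm J θ u X =
      (J u * fderiv ℝ J u X + fderiv ℝ J u X * J u) + θ u X * (J u * J u) - (J u * J u) * θ u X := by
    rw [covDerivForm]; noncomm_ring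
  rw [h2, h3] at e
  refine eq_neg_of_add_eq_zero_left (e.trans ?_)
  simp

/-- The theorem in local form. The product rule produces exactly the terms of
`cyclic_trace_identity`, with symmetric second derivatives because `J` is twice continuously
differentiable. The form `η` enters only through its values, which also provide its
differentiability. -/
theorem extDeriv_trace_covDerivForm [FiniteDimensional ℝ F] {tr : 𝒜 →L[ℝ] ℝ}
    (htr : ∀ a b, tr (a * b) = tr (b * a)) {J : F → 𝒜} {θ : F → F →L[ℝ] 𝒜} {u₀ : F}
    (hJ : ContDiffAt ℝ 2 J u₀) (hJ2 : ∀ᶠ u in 𝓝 u₀, J u * J u = -1) (hθ : DifferentiableAt ℝ θ u₀)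
    {η : F → F [⋀^Fin 2]→L[ℝ] ℝ} {c : ℝ}
    (hη : ∀ᶠ u in 𝓝 u₀, ∀ X Y, η u ![X, Y] =
      c * tr (J u * covDerivForm J θ u X * covDerivForm J θ u Y)) (X Y Z : F) :
    extDeriv η u₀ ![X, Y, Z] = 2 * c * (tr (curvatureForm θ u₀ X Y * covDerivForm J θ u₀ Z)
      + tr (curvatureForm θ u₀ Y Z * covDerivForm J θ u₀ X)
      + tr (curvatureForm θ u₀ Z X * covDerivForm J θ u₀ Y)) := by
  have hJd : HasFDerivAt J (fderiv ℝ J u₀) u₀ := (hJ.differentiableAt (by simp)).hasFDerivAt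
  have hJdd : DifferentiableAt ℝ (fderiv ℝ J) u₀ :=
    (hJ.fderiv_right (m := 1) (by norm_num)).differentiableAt (by simp)
  have hsymm : ∀ X Y, fderiv ℝ (fderiv ℝ J) u₀ X Y = fderiv ℝ (fderiv ℝ J) u₀ Y X := fun X Y =>
    (hJ.isSymmSndFDerivAt (by simp)).eq X Y
  -- The derivative in the direction `X` of `covDerivForm J θ · Y`, with `Y` held constant.
  let m : F → F → 𝒜 := fun X Y => fderiv ℝ (fderiv ℝ J) u₀ X Y
    + ((fderiv ℝ θ u₀ X Y * J u₀ + θ u₀ Y * fderiv ℝ J u₀ X)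
      - (fderiv ℝ J u₀ X * θ u₀ Y + J u₀ * fderiv ℝ θ u₀ X Y))
  have hN : ∀ Y, ∃ L : F →L[ℝ] 𝒜, HasFDerivAt (fun u => covDerivForm J θ u Y) L u₀ ∧ ∀ X, L X = m X Y := by
    intro Y
    have h1 : HasFDerivAt (fun u => fderiv ℝ J u Y) _ u₀ := hJdd.hasFDerivAt.clm_apply (hasFDerivAt_const Y u₀)
    have h2 : HasFDerivAt (fun u => θ u Y) _ u₀ := hθ.hasFDerivAt.clm_apply (hasFDerivAt_const Y u₀)
    refine ⟨_, h1.add ((h2.mul' hJd).sub (hJd.mul' h2)), fun X => ?_⟩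
    simp [m]
    abel
  have hgen : ∀ Y Z, ∃ L : F →L[ℝ] ℝ, HasFDerivAt (fun u => η u ![Y, Z]) L u₀ ∧
      ∀ X, L X = c * tr (fderiv ℝ J u₀ X * covDerivForm J θ u₀ Y * covDerivForm J θ u₀ Z
        + J u₀ * m X Y * covDerivForm J θ u₀ Z + J u₀ * covDerivForm J θ u₀ Y * m X Z) := by
    intro Y Z
    obtain ⟨LY, hLY, eY⟩ := hN Y
    obtain ⟨LZ, hLZ, eZ⟩ := hN Z
    have h1 := ((tr.hasFDerivAt (x := _)).comp u₀ ((hJd.mul' hLY).mul' hLZ)).const_mul c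
    refine ⟨_, h1.congr_of_eventuallyEq ?_, fun X => ?_⟩
    · filter_upwards [hη] with u hu
      rw [hu]; rfl
    · simp [eY, eZ]
      ring
  have hd : DifferentiableAt ℝ η u₀ := differentiableAt_twoForm fun X Y => by
    obtain ⟨L, hL, -⟩ := hgen X Y
    exact hL.differentiableAt
  have hfd : ∀ X Y Z, fderiv ℝ (fun u => η u ![Y, Z]) u₀ X = c * tr (fderiv ℝ J u₀ X * covDerivForm J θ u₀ Y * covDerivForm J θ u₀ Z
        + J u₀ * m X Y * covDerivForm J θ u₀ Z + J u₀ * covDerivForm J θ u₀ Y * m X Z) := by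
    intro X Y Z
    obtain ⟨L, hL, e⟩ := hgen Y Z
    rw [hL.fderiv, e]
  rw [extDeriv_twoForm_apply hd, hfd, hfd, hfd, ← mul_add, ← mul_add]
  have := cyclic_trace_identity (tr : 𝒜 →ₗ[ℝ] ℝ) htr hJ2.self_of_nhds (fun X => fderiv ℝ J u₀ X) (fun X => θ u₀ X)
    (fun X => covDerivForm J θ u₀ X) (fun X Y => fderiv ℝ (fderiv ℝ J) u₀ X Y) (fun X Y => fderiv ℝ θ u₀ X Y)
    m (fun X => rfl) (covDerivForm_anticomm θ hJd.differentiableAt hJ2) hsymm (fun X Y => rfl) X Y Z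
  simp only [ContinuousLinearMap.coe_coe] at this
  rw [this]
  simp only [curvatureForm]
  ring
end calculus

/-! ### Derivatives of vector-valued functions on a manifold -/

section vectorValued
variable {EN N V W : Type*} [NormedAddCommGroup EN] [NormedSpace ℝ EN] [TopologicalSpace N] [ChartedSpace EN N]
  [NormedAddCommGroup V] [NormedSpace ℝ V] [NormedAddCommGroup W] [NormedSpace ℝ W]

theorem mvfderiv_congr {g g' : N → V} {z : N} (h : g =ᶠ[𝓝 z] g') :
    mvfderiv 𝓘(ℝ, EN) g z = mvfderiv 𝓘(ℝ, EN) g' z := by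
  have h1 : g z = g' z := h.self_of_nhds
  refine ContinuousLinearMap.ext fun X => ?_
  have h2 := h.mfderiv_eq (I := 𝓘(ℝ, EN)) (I' := 𝓘(ℝ, V))
  exact DFunLike.congr_fun h2 X

theorem mvfderiv_comp_vector {E M : Type*} [NormedAddCommGroup E] [NormedSpace ℝ E] [TopologicalSpace M]
    [ChartedSpace E M] {g : M → V} {f : N → M} {z : N} (hg : MDifferentiableAt 𝓘(ℝ, E) 𝓘(ℝ, V) g (f z))
    (hf : MDifferentiableAt 𝓘(ℝ, EN) 𝓘(ℝ, E) f z) (X : TangentSpace 𝓘(ℝ, EN) z) :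
    mvfderiv 𝓘(ℝ, EN) (fun z => g (f z)) z X = mvfderiv 𝓘(ℝ, E) g (f z) (mfderiv 𝓘(ℝ, EN) 𝓘(ℝ, E) f z X) :=
  mfderiv_comp_apply z hg hf X

theorem mvfderiv_eq_fderiv (g : V → W) (u X : V) : mvfderiv 𝓘(ℝ, V) g u X = fderiv ℝ g u X :=
  DFunLike.congr_fun (mfderiv_eq_fderiv (𝕜 := ℝ) (f := g) (x := u)) X

theorem MDifferentiableAt.differentiableAt_chart [IsManifold 𝓘(ℝ, EN) 1 N] {g : N → V} {z z₀ : N}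
    (hg : MDifferentiableAt 𝓘(ℝ, EN) 𝓘(ℝ, V) g z) (hz : z ∈ (extChartAt 𝓘(ℝ, EN) z₀).source) :
    DifferentiableAt ℝ (g ∘ (extChartAt 𝓘(ℝ, EN) z₀).symm) (extChartAt 𝓘(ℝ, EN) z₀ z) := by
  have h2 : MDifferentiableAt 𝓘(ℝ, EN) 𝓘(ℝ, EN) (extChartAt 𝓘(ℝ, EN) z₀).symm (extChartAt 𝓘(ℝ, EN) z₀ z) :=
    (contMDiffOn_extChartAt_symm (n := 1) z₀).mdifferentiableOn (by simp)
      |>.mdifferentiableAt ((isOpen_extChartAt_target z₀).mem_nhds ((extChartAt 𝓘(ℝ, EN) z₀).map_source hz))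
  have hg' : MDifferentiableAt 𝓘(ℝ, EN) 𝓘(ℝ, V) g ((extChartAt 𝓘(ℝ, EN) z₀).symm (extChartAt 𝓘(ℝ, EN) z₀ z)) := by
    rwa [(extChartAt 𝓘(ℝ, EN) z₀).left_inv hz]
  exact (hg'.comp _ h2).differentiableAt

/-- The chain rule for `g = (g ∘ φ⁻¹) ∘ φ` near `z`. The chart may be centred at another point `z₀`,
so that one chart serves a whole neighbourhood. -/
theorem mvfderiv_eq_fderiv_chart [IsManifold 𝓘(ℝ, EN) 1 N] {g : N → V} {z z₀ : N}
    (hg : MDifferentiableAt 𝓘(ℝ, EN) 𝓘(ℝ, V) g z)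
    (hz : z ∈ (extChartAt 𝓘(ℝ, EN) z₀).source) (X : TangentSpace 𝓘(ℝ, EN) z) :
    mvfderiv 𝓘(ℝ, EN) g z X = fderiv ℝ (g ∘ (extChartAt 𝓘(ℝ, EN) z₀).symm) (extChartAt 𝓘(ℝ, EN) z₀ z)
      (mvfderiv 𝓘(ℝ, EN) (extChartAt 𝓘(ℝ, EN) z₀) z X) := by
  have h1 : MDifferentiableAt 𝓘(ℝ, EN) 𝓘(ℝ, EN) (extChartAt 𝓘(ℝ, EN) z₀) z :=
    mdifferentiableAt_extChartAt (by rwa [extChartAt_source] at hz)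
  have h3 := hg.differentiableAt_chart hz
  have h4 : g =ᶠ[𝓝 z] fun z => (g ∘ (extChartAt 𝓘(ℝ, EN) z₀).symm) (extChartAt 𝓘(ℝ, EN) z₀ z) := by
    filter_upwards [(isOpen_extChartAt_source z₀).mem_nhds hz] with y hy
    exact congrArg g ((extChartAt 𝓘(ℝ, EN) z₀).left_inv hy).symm
  rw [mvfderiv_congr h4, mvfderiv_comp_vector h3.mdifferentiableAt h1, ← mvfderiv_eq_fderiv]
  rfl

theorem mvfderiv_clm_apply [IsManifold 𝓘(ℝ, EN) 1 N] {A : N → V →L[ℝ] W} {v : N → V} {z : N}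
    (hA : MDifferentiableAt 𝓘(ℝ, EN) 𝓘(ℝ, V →L[ℝ] W) A z) (hv : MDifferentiableAt 𝓘(ℝ, EN) 𝓘(ℝ, V) v z)
    (X : TangentSpace 𝓘(ℝ, EN) z) :
    mvfderiv 𝓘(ℝ, EN) (fun z => A z (v z)) z X =
      mvfderiv 𝓘(ℝ, EN) A z X (v z) + A z (mvfderiv 𝓘(ℝ, EN) v z X) := by
  have hz := mem_extChartAt_source (I := 𝓘(ℝ, EN)) z
  rw [mvfderiv_eq_fderiv_chart (hA.clm_apply hv) hz, mvfderiv_eq_fderiv_chart hA hz,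
    mvfderiv_eq_fderiv_chart hv hz]
  have := fderiv_clm_apply (hA.differentiableAt_chart hz) (hv.differentiableAt_chart hz)
  simp only [Function.comp_apply, (extChartAt 𝓘(ℝ, EN) z).left_inv hz] at this
  have e : ((fun z => A z (v z)) ∘ (extChartAt 𝓘(ℝ, EN) z).symm) =
    fun u => A ((extChartAt 𝓘(ℝ, EN) z).symm u) (v ((extChartAt 𝓘(ℝ, EN) z).symm u)) := rfl
  rw [e, this]
  simp [Function.comp_def, add_comm]

end vectorValued

/-! ### Connections in a local frame -/

section frame
variable {E M EN N : Type*} [NormedAddCommGroup E] [NormedSpace ℝ E] [FiniteDimensional ℝ E]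
  [TopologicalSpace M] [ChartedSpace E M] [IsManifold 𝓘(ℝ, E) 1 M]
  [ContMDiffVectorBundle ∞ E (TangentSpace 𝓘(ℝ, E) : M → Type _) 𝓘(ℝ, E)]

/-- The section of `TM` over the domain of a trivialization with constant coordinates `w`. -/
noncomputable def frameSection (e : Trivialization E (π E (TangentSpace 𝓘(ℝ, E) : M → Type _)))
    (w : E) (x : M) : TangentSpace 𝓘(ℝ, E) x := e.symm x w

variable (e : Trivialization E (π E (TangentSpace 𝓘(ℝ, E) : M → Type _))) [MemTrivializationAtlas e]

theorem trivialization_frameSection {x : M} (hx : x ∈ e.baseSet) (w : E) :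
    (e ⟨x, frameSection e w x⟩).2 = w := by
  have h := e.apply_mk_symm hx w
  exact congrArg Prod.snd h

theorem frameSection_trivialization {x : M} (hx : x ∈ e.baseSet) (v : TangentSpace 𝓘(ℝ, E) x) :
    frameSection e (e ⟨x, v⟩).2 x = v := e.symm_apply_apply_mk hx v

theorem contMDiffAt_frameSection {x : M} (hx : x ∈ e.baseSet) (w : E) :
    ContMDiffAt 𝓘(ℝ, E) (𝓘(ℝ, E).prod 𝓘(ℝ, E)) ∞
      (fun x => (⟨x, frameSection e w x⟩ : TangentBundle 𝓘(ℝ, E) M)) x := by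
  refine (e.contMDiffAt_section_iff hx).2 ?_
  refine (contMDiffAt_const (c := w)).congr_of_eventuallyEq ?_
  filter_upwards [e.open_baseSet.mem_nhds hx] with y hy
  exact trivialization_frameSection e hy w

theorem mdifferentiableAt_frameSection {x : M} (hx : x ∈ e.baseSet) (w : E) :
    MDifferentiableAt 𝓘(ℝ, E) (𝓘(ℝ, E).prod 𝓘(ℝ, E))
      (fun x => (⟨x, frameSection e w x⟩ : TangentBundle 𝓘(ℝ, E) M)) x :=
  (contMDiffAt_frameSection e hx w).mdifferentiableAt (by simp)

/-- A connection in a local frame: `∇s = ds + Γ s`. -/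
theorem cov_apply_in_frame (nab : CovariantDerivative 𝓘(ℝ, E) E (TangentSpace 𝓘(ℝ, E) : M → Type _))
    {x : M} (hx : x ∈ e.baseSet) {s : Π x : M, TangentSpace 𝓘(ℝ, E) x}
    (hs : MDifferentiableAt 𝓘(ℝ, E) (𝓘(ℝ, E).prod 𝓘(ℝ, E))
      (fun x => (⟨x, s x⟩ : TangentBundle 𝓘(ℝ, E) M)) x) (v : TangentSpace 𝓘(ℝ, E) x) :
    e.continuousLinearMapAt ℝ x (nab s x v) =
      mvfderiv 𝓘(ℝ, E) (fun x' => (e ⟨x', s x'⟩).2) x v +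
      e.continuousLinearMapAt ℝ x (nab (frameSection e (e ⟨x, s x⟩).2) x v) := by
  -- In the difference between the covariant derivative and the derivative of the components, the
  -- Leibniz terms cancel. It is therefore tensorial in `s`, and `s` may be replaced by the section
  -- with the same value at `x` and constant components, whose component derivative is zero.
  let Φ : (Π x : M, TangentSpace 𝓘(ℝ, E) x) → E := fun s =>
    e.continuousLinearMapAt ℝ x (nab s x v) - mvfderiv 𝓘(ℝ, E) (fun x' => (e ⟨x', s x'⟩).2) x v
  have hd : ∀ {s : Π x : M, TangentSpace 𝓘(ℝ, E) x}, MDifferentiableAt 𝓘(ℝ, E) (𝓘(ℝ, E).prod 𝓘(ℝ, E))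
      (fun x => (⟨x, s x⟩ : TangentBundle 𝓘(ℝ, E) M)) x →
      MDifferentiableAt 𝓘(ℝ, E) 𝓘(ℝ, E) (fun x' => (e ⟨x', s x'⟩).2) x := fun hs =>
    (e.mdifferentiableAt_section_iff _ _ hx).1 hs
  have hlin : ∀ y ∈ e.baseSet, ∀ u, (e ⟨y, u⟩).2 = e.continuousLinearMapAt ℝ y u :=
    fun y hy u => (e.continuousLinearMapAt_apply_of_mem (R := ℝ) hy u).symm
  have hΦ : TensorialAt 𝓘(ℝ, E) E Φ x := by
    constructor
    · intro f σ hf hσ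
      have h1 : (fun x' => (e ⟨x', (f • σ) x'⟩).2) =ᶠ[𝓝 x] f • (fun x' => (e ⟨x', σ x'⟩).2) := by
        filter_upwards [e.open_baseSet.mem_nhds hx] with y hy
        simp only [Pi.smul_apply', hlin y hy, map_smul]
      simp only [Φ]
      rw [mvfderiv_congr h1, mvfderiv_smul hf (hd hσ), nab.isCovariantDerivativeOnUniv.leibniz hσ hf]
      simp [hlin x hx, smul_sub]
    · intro σ σ' hσ hσ'
      have h1 : (fun x' => (e ⟨x', (σ + σ') x'⟩).2) =ᶠ[𝓝 x]
          (fun x' => (e ⟨x', σ x'⟩).2) + (fun x' => (e ⟨x', σ' x'⟩).2) := by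
        filter_upwards [e.open_baseSet.mem_nhds hx] with y hy
        simp only [Pi.add_apply, hlin y hy, map_add]
      simp only [Φ]
      rw [mvfderiv_congr h1, mvfderiv_add (hd hσ) (hd hσ'), nab.isCovariantDerivativeOnUniv.add hσ hσ']
      simp
      abel
  have h3 : Φ s = Φ (frameSection e (e ⟨x, s x⟩).2) :=
    hΦ.pointwise hs (mdifferentiableAt_frameSection e hx _) (frameSection_trivialization e hx _).symm
  have h4 : mvfderiv 𝓘(ℝ, E) (fun x' => (e ⟨x', frameSection e (e ⟨x, s x⟩).2 x'⟩).2) x = 0 := by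
    have : (fun x' => (e ⟨x', frameSection e (e ⟨x, s x⟩).2 x'⟩).2) =ᶠ[𝓝 x] fun _ => (e ⟨x, s x⟩).2 := by
      filter_upwards [e.open_baseSet.mem_nhds hx] with y hy
      exact trivialization_frameSection e hy _
    rw [mvfderiv_congr this, mvfderiv_const]
  simp only [Φ] at h3
  rw [h4] at h3
  rw [← sub_eq_iff_eq_add', h3]
  simp

variable [TopologicalSpace N] [NormedAddCommGroup EN] [NormedSpace ℝ EN] [ChartedSpace EN N]
  [IsManifold 𝓘(ℝ, EN) 1 N]

/-- The pullback connection in a local frame of `TM`. -/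
theorem pullbackCov_in_frame (nab : CovariantDerivative 𝓘(ℝ, E) E (TangentSpace 𝓘(ℝ, E) : M → Type _))
    {f : N → M} {z : N} (hf : MDifferentiableAt 𝓘(ℝ, EN) 𝓘(ℝ, E) f z) (hz : f z ∈ e.baseSet)
    {s : Π z : N, TangentSpace 𝓘(ℝ, E) (f z)}
    (hs : MDifferentiableAt 𝓘(ℝ, EN) 𝓘(ℝ, E) (fun z' => (e ⟨f z', s z'⟩).2) z) (X : TangentSpace 𝓘(ℝ, EN) z) :
    e.continuousLinearMapAt ℝ (f z) (pullbackCov 𝓘(ℝ, EN) f nab s z X) =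
      mvfderiv 𝓘(ℝ, EN) (fun z' => (e ⟨f z', s z'⟩).2) z X +
      e.continuousLinearMapAt ℝ (f z)
        (nab (frameSection e (e ⟨f z, s z⟩).2) (f z) (mfderiv 𝓘(ℝ, EN) 𝓘(ℝ, E) f z X)) := by
  -- `pullbackCov` is defined by the frame `e₁` centred at `f z`; the point is to change to an
  -- arbitrary frame `e`.
  set e₁ := trivializationAt E (TangentSpace 𝓘(ℝ, E) : M → Type _) (f z) with he₁
  have hz₁ : f z ∈ e₁.baseSet := FiberBundle.mem_baseSet_trivializationAt' (f z)
  have hf' := hf.continuousAt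
  have hmem : ∀ᶠ z' in 𝓝 z, f z' ∈ e.baseSet ∧ f z' ∈ e₁.baseSet :=
    hf' ((e.open_baseSet.inter e₁.open_baseSet).mem_nhds ⟨hz, hz₁⟩)
  have hlin : ∀ y ∈ e.baseSet, ∀ u, (e ⟨y, u⟩).2 = e.continuousLinearMapAt ℝ y u :=
    fun y hy u => (e.continuousLinearMapAt_apply_of_mem (R := ℝ) hy u).symm
  have hd : pullbackCov 𝓘(ℝ, EN) f nab s z X = e₁.symmL ℝ (f z) (mvfderiv 𝓘(ℝ, EN) (fun z' => (e₁ ⟨f z', s z'⟩).2) z X)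
      + nab (frameSection e₁ (e₁ ⟨f z, s z⟩).2) (f z) (mfderiv 𝓘(ℝ, EN) 𝓘(ℝ, E) f z X) := rfl
  have hcc : ∀ y, y ∈ e.baseSet → y ∈ e₁.baseSet → ∀ w, (e₁.coordChangeL ℝ e y : E →L[ℝ] E) w =
      (e ⟨y, frameSection e₁ w y⟩).2 := by
    intro y h h₁ w
    exact e₁.coordChangeL_apply (R := ℝ) e ⟨h₁, h⟩ w
  have hcs : ∀ y, y ∈ e.baseSet → y ∈ e₁.baseSet → ∀ u : TangentSpace 𝓘(ℝ, E) y,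
      (e.coordChangeL ℝ e₁ y : E →L[ℝ] E) (e ⟨y, u⟩).2 = (e₁ ⟨y, u⟩).2 := by
    intro y h h₁ u
    have := e.coordChangeL_apply (R := ℝ) e₁ ⟨h, h₁⟩ (e ⟨y, u⟩).2
    refine this.trans ?_
    congr 3
    exact frameSection_trivialization e h u
  have hcs' : ∀ y, y ∈ e.baseSet → y ∈ e₁.baseSet → ∀ u : TangentSpace 𝓘(ℝ, E) y,
      (e₁.coordChangeL ℝ e y : E →L[ℝ] E) (e₁ ⟨y, u⟩).2 = (e ⟨y, u⟩).2 := by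
    intro y h h₁ u
    have := e₁.coordChangeL_apply (R := ℝ) e ⟨h₁, h⟩ (e₁ ⟨y, u⟩).2
    refine this.trans ?_
    congr 3
    exact frameSection_trivialization e₁ h₁ u
  have hC : MDifferentiableAt 𝓘(ℝ, E) 𝓘(ℝ, E →L[ℝ] E) (fun y : M => (e₁.coordChangeL ℝ e y : E →L[ℝ] E)) (f z) :=
    (contMDiffAt_coordChangeL (n := ∞) hz₁ hz).mdifferentiableAt (by simp)
  have hC' : MDifferentiableAt 𝓘(ℝ, E) 𝓘(ℝ, E →L[ℝ] E) (fun y : M => (e.coordChangeL ℝ e₁ y : E →L[ℝ] E)) (f z) :=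
    (contMDiffAt_coordChangeL (n := ∞) hz hz₁).mdifferentiableAt (by simp)
  have hs₁ : MDifferentiableAt 𝓘(ℝ, EN) 𝓘(ℝ, E) (fun z' => (e₁ ⟨f z', s z'⟩).2) z := by
    refine ((hC'.comp z hf).clm_apply hs).congr_of_eventuallyEq ?_
    filter_upwards [hmem] with z' hz'
    exact (hcs _ hz'.1 hz'.2 _).symm
  -- The product rule for the change of frame gives a term with the derivative of the transition
  -- function. The same term arises in `h2` and `h3`, when the connection is applied to a section
  -- that is constant in `e₁` but not in `e`.
  have h1 : mvfderiv 𝓘(ℝ, EN) (fun z' => (e ⟨f z', s z'⟩).2) z X =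
      mvfderiv 𝓘(ℝ, E) (fun y : M => (e₁.coordChangeL ℝ e y : E →L[ℝ] E)) (f z)
        (mfderiv 𝓘(ℝ, EN) 𝓘(ℝ, E) f z X) (e₁ ⟨f z, s z⟩).2 +
      (e₁.coordChangeL ℝ e (f z) : E →L[ℝ] E) (mvfderiv 𝓘(ℝ, EN) (fun z' => (e₁ ⟨f z', s z'⟩).2) z X) := by
    have : (fun z' => (e ⟨f z', s z'⟩).2) =ᶠ[𝓝 z]
        fun z' => (e₁.coordChangeL ℝ e (f z') : E →L[ℝ] E) (e₁ ⟨f z', s z'⟩).2 := by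
      filter_upwards [hmem] with z' hz'
      exact (hcs' _ hz'.1 hz'.2 _).symm
    have h := mvfderiv_clm_apply (A := fun z' => (e₁.coordChangeL ℝ e (f z') : E →L[ℝ] E)) (hC.comp z hf) hs₁ X
    rw [mvfderiv_congr this, h, mvfderiv_comp_vector hC hf]
  have h2 := cov_apply_in_frame e nab hz (mdifferentiableAt_frameSection e₁ hz₁ (e₁ ⟨f z, s z⟩).2)
    (mfderiv 𝓘(ℝ, EN) 𝓘(ℝ, E) f z X)
  rw [frameSection_trivialization e₁ hz₁] at h2
  have h3 : mvfderiv 𝓘(ℝ, E) (fun y => (e ⟨y, frameSection e₁ (e₁ ⟨f z, s z⟩).2 y⟩).2) (f z)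
      (mfderiv 𝓘(ℝ, EN) 𝓘(ℝ, E) f z X) = mvfderiv 𝓘(ℝ, E) (fun y : M => (e₁.coordChangeL ℝ e y : E →L[ℝ] E)) (f z)
        (mfderiv 𝓘(ℝ, EN) 𝓘(ℝ, E) f z X) (e₁ ⟨f z, s z⟩).2 := by
    have : (fun y => (e ⟨y, frameSection e₁ (e₁ ⟨f z, s z⟩).2 y⟩).2) =ᶠ[𝓝 (f z)]
        fun y => (e₁.coordChangeL ℝ e y : E →L[ℝ] E) (e₁ ⟨f z, s z⟩).2 := by
      filter_upwards [(e.open_baseSet.inter e₁.open_baseSet).mem_nhds ⟨hz, hz₁⟩] with y hy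
      exact (hcc _ hy.1 hy.2 _).symm
    rw [mvfderiv_congr this, mvfderiv_clm_apply hC mdifferentiableAt_const, mvfderiv_const]
    simp
  have h4 : ∀ w, e.continuousLinearMapAt ℝ (f z) (e₁.symmL ℝ (f z) w) = (e₁.coordChangeL ℝ e (f z) : E →L[ℝ] E) w := by
    intro w
    rw [hcc _ hz hz₁, e₁.symmL_apply hz₁, hlin _ hz]
    rfl
  rw [hd, map_add, h2, h1, h3, h4]
  abel

end frame

/-! ### Christoffel symbols -/

section christoffel
variable {E M : Type*} [NormedAddCommGroup E] [NormedSpace ℝ E] [FiniteDimensional ℝ E]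
  [TopologicalSpace M] [ChartedSpace E M] [IsManifold 𝓘(ℝ, E) 1 M]
  [ContMDiffVectorBundle ∞ E (TangentSpace 𝓘(ℝ, E) : M → Type _) 𝓘(ℝ, E)]

theorem frameSection_eq_symmL (e : Trivialization E (π E (TangentSpace 𝓘(ℝ, E) : M → Type _)))
    [MemTrivializationAtlas e] (w : E) {x : M} (hx : x ∈ e.baseSet) : frameSection e w x = e.symmL ℝ x w :=
  (e.symmL_apply hx w).symm

variable (nab : CovariantDerivative 𝓘(ℝ, E) E (TangentSpace 𝓘(ℝ, E) : M → Type _)) (x₀ : M)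

/-- The Christoffel symbols of a connection on `TM` in the frame given by the chart at `x₀`: the
first argument is the section, the second one the direction. -/
noncomputable def christoffel (x : M) : E →L[ℝ] E →L[ℝ] E :=
  ∑ i, (LinearMap.toContinuousLinearMap ((Module.finBasis ℝ E).coord i)).smulRight
    (ContinuousLinearMap.inCoordinates E (TangentSpace 𝓘(ℝ, E) : M → Type _)
      E (TangentSpace 𝓘(ℝ, E) : M → Type _) x₀ x x₀ x
      (nab (frameSection (trivializationAt E (TangentSpace 𝓘(ℝ, E) : M → Type _) x₀) (Module.finBasis ℝ E i)) x))

theorem christoffel_apply {x : M}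
    (hx : x ∈ (trivializationAt E (TangentSpace 𝓘(ℝ, E) : M → Type _) x₀).baseSet)
    (w : E) (v : TangentSpace 𝓘(ℝ, E) x) :
    christoffel nab x₀ x w ((trivializationAt E (TangentSpace 𝓘(ℝ, E) : M → Type _) x₀).continuousLinearMapAt ℝ x v) =
      (trivializationAt E (TangentSpace 𝓘(ℝ, E) : M → Type _) x₀).continuousLinearMapAt ℝ x
        (nab (frameSection (trivializationAt E (TangentSpace 𝓘(ℝ, E) : M → Type _) x₀) w) x v) := by
  set e := trivializationAt E (TangentSpace 𝓘(ℝ, E) : M → Type _) x₀ with he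
  -- `christoffel` is assembled from the basis sections. Linearity of the connection over constants
  -- extends the formula to all `w`; locality is needed because frame sections are additive in `w`
  -- only over the base set.
  let L : E →ₗ[ℝ] E :=
    { toFun := fun w => e.continuousLinearMapAt ℝ x (nab (frameSection e w) x v)
      map_add' := fun w w' => by
        have h : nab (frameSection e (w + w')) x = nab (frameSection e w + frameSection e w') x := by
          refine nab.isCovariantDerivativeOnUniv.congr_of_eventuallyEq (mdifferentiableAt_frameSection e hx _)
            (mdifferentiableAt_add_section (mdifferentiableAt_frameSection e hx _) (mdifferentiableAt_frameSection e hx _))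
            Filter.univ_mem ?_
          filter_upwards [e.open_baseSet.mem_nhds hx] with y hy
          simp only [Pi.add_apply, frameSection_eq_symmL e _ hy, map_add]
        rw [h, nab.isCovariantDerivativeOnUniv.add (mdifferentiableAt_frameSection e hx _)
          (mdifferentiableAt_frameSection e hx _), add_apply, map_add]
      map_smul' := fun c w => by
        have h : nab (frameSection e (c • w)) x = nab (c • frameSection e w) x := by
          refine nab.isCovariantDerivativeOnUniv.congr_of_eventuallyEq (mdifferentiableAt_frameSection e hx _)
            ((mdifferentiableAt_frameSection e hx _).smul_const_section) Filter.univ_mem ?_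
          filter_upwards [e.open_baseSet.mem_nhds hx] with y hy
          simp only [Pi.smul_apply, frameSection_eq_symmL e _ hy, map_smul]
        rw [h, nab.isCovariantDerivativeOnUniv.smul_const _ (mdifferentiableAt_frameSection e hx _),
          smul_apply, map_smul, RingHom.id_apply] }
  change _ = L w
  conv_rhs => rw [← (Module.finBasis ℝ E).sum_repr w, map_sum]
  rw [christoffel, sum_apply, sum_apply]
  refine Finset.sum_congr rfl fun i _ => ?_
  rw [map_smul]
  change ((Module.finBasis ℝ E).repr w i) • e.continuousLinearMapAt ℝ x
    (nab (frameSection e (Module.finBasis ℝ E i)) x (e.symmL ℝ x (e.continuousLinearMapAt ℝ x v))) = _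
  rw [e.symmL_continuousLinearMapAt hx]
  rfl

/-- Smoothness of a connection concerns sections that are smooth on all of `M`. The frame sections
are therefore multiplied by a bump function; it equals `1` near `x₀`, so by locality the covariant
derivatives there do not change. -/
theorem contMDiffAt_christoffel [T2Space M] [IsManifold 𝓘(ℝ, E) ∞ M]
    (hnab : CovariantDerivative.ContMDiffCovariantDerivative nab ∞) :
    ContMDiffAt 𝓘(ℝ, E) 𝓘(ℝ, E →L[ℝ] E →L[ℝ] E) ∞ (christoffel nab x₀) x₀ := by
  set e := trivializationAt E (TangentSpace 𝓘(ℝ, E) : M → Type _) x₀ with he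
  have hx₀ : x₀ ∈ e.baseSet := FiberBundle.mem_baseSet_trivializationAt' x₀
  have hcov : ∀ w : E, ContMDiffAt 𝓘(ℝ, E) 𝓘(ℝ, E →L[ℝ] E) ∞ (fun x =>
      ContinuousLinearMap.inCoordinates E (TangentSpace 𝓘(ℝ, E) : M → Type _)
      E (TangentSpace 𝓘(ℝ, E) : M → Type _) x₀ x x₀ x (nab (frameSection e w) x)) x₀ := by
    intro w
    let ψ : SmoothBumpFunction 𝓘(ℝ, E) x₀ := Classical.arbitrary _
    have h1 : ContMDiff 𝓘(ℝ, E) (𝓘(ℝ, E).prod 𝓘(ℝ, E)) ∞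
        (fun x => (⟨x, ((ψ : M → ℝ) • frameSection e w) x⟩ : TangentBundle 𝓘(ℝ, E) M)) := by
      refine ContMDiffOn.smul_section_of_tsupport (u := e.baseSet) ψ.contMDiff.contMDiffOn e.open_baseSet
        ψ.tsupport_subset_chartAt_source ?_
      exact fun x hx => (contMDiffAt_frameSection e hx w).contMDiffWithinAt
    have h2 := (hnab.contMDiff.contMDiff (σ := (ψ : M → ℝ) • frameSection e w)
      (h1.of_le (by simp)).contMDiffOn).contMDiffAt Filter.univ_mem (x := x₀)
    have h3 := ((contMDiffAt_hom_bundle _).1 h2).2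
    refine h3.congr_of_eventuallyEq ?_
    filter_upwards [ψ.eventuallyEq_one.eventuallyEq_nhds, e.open_baseSet.mem_nhds hx₀] with x hx hxe
    have h4 : nab (frameSection e w) x = nab ((ψ : M → ℝ) • frameSection e w) x := by
      refine nab.isCovariantDerivativeOnUniv.congr_of_eventuallyEq (mdifferentiableAt_frameSection e hxe w)
        ((h1 x).mdifferentiableAt (by simp)) Filter.univ_mem ?_
      filter_upwards [hx] with y hy
      simp only [Pi.smul_apply', hy, Pi.one_apply, one_smul]
    simp only [h4]
  have h5 : christoffel nab x₀ = fun x => ∑ i, ContinuousLinearMap.smulRightL ℝ E (E →L[ℝ] E)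
      (LinearMap.toContinuousLinearMap ((Module.finBasis ℝ E).coord i))
      (ContinuousLinearMap.inCoordinates E (TangentSpace 𝓘(ℝ, E) : M → Type _)
      E (TangentSpace 𝓘(ℝ, E) : M → Type _) x₀ x x₀ x (nab (frameSection e (Module.finBasis ℝ E i)) x)) := rfl
  rw [h5]
  refine ContMDiffAt.sum fun i _ => ?_
  exact (ContinuousLinearMap.contMDiff _).contMDiffAt.comp x₀ (hcov _)

end christoffel

/-! ### The connection form of the pullback connection -/

section pullbackForm
variable {E M EN N : Type*} [NormedAddCommGroup E] [NormedSpace ℝ E] [FiniteDimensional ℝ E]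
  [TopologicalSpace M] [ChartedSpace E M] [IsManifold 𝓘(ℝ, E) 1 M]
  [ContMDiffVectorBundle ∞ E (TangentSpace 𝓘(ℝ, E) : M → Type _) 𝓘(ℝ, E)]
  [TopologicalSpace N] [NormedAddCommGroup EN] [NormedSpace ℝ EN] [ChartedSpace EN N]
  [IsManifold 𝓘(ℝ, EN) 1 N]
  (nab : CovariantDerivative 𝓘(ℝ, E) E (TangentSpace 𝓘(ℝ, E) : M → Type _)) (f : N → M) (z₀ : N)

/-- The connection form of the pullback connection `f*∇`, in the chart of `N` at `z₀` and the frame of `TM`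
given by the chart at `f z₀`. -/
noncomputable def pullbackForm (u : EN) : EN →L[ℝ] E →L[ℝ] E :=
  (christoffel nab (f z₀) (f ((extChartAt 𝓘(ℝ, EN) z₀).symm u))).flip.comp
    (fderiv ℝ ((fun z => extChartAt 𝓘(ℝ, E) (f z₀) (f z)) ∘ (extChartAt 𝓘(ℝ, EN) z₀).symm) u)

variable {f z₀}

/-- The trivialization of `TM` is the differential of the chart of `M`. The derivative of `f` read
in the charts thus gives the components of `df X`, which are the direction argument of the
Christoffel symbols. -/
theorem pullbackForm_apply {z : N} (hz : z ∈ (extChartAt 𝓘(ℝ, EN) z₀).source)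
    (hfz : f z ∈ (trivializationAt E (TangentSpace 𝓘(ℝ, E) : M → Type _) (f z₀)).baseSet)
    (hf : MDifferentiableAt 𝓘(ℝ, EN) 𝓘(ℝ, E) f z) (X : TangentSpace 𝓘(ℝ, EN) z) (w : E) :
    pullbackForm nab f z₀ (extChartAt 𝓘(ℝ, EN) z₀ z) (mvfderiv 𝓘(ℝ, EN) (extChartAt 𝓘(ℝ, EN) z₀) z X) w =
      (trivializationAt E (TangentSpace 𝓘(ℝ, E) : M → Type _) (f z₀)).continuousLinearMapAt ℝ (f z)
        (nab (frameSection (trivializationAt E (TangentSpace 𝓘(ℝ, E) : M → Type _) (f z₀)) w) (f z)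
          (mfderiv 𝓘(ℝ, EN) 𝓘(ℝ, E) f z X)) := by
  have h1 : MDifferentiableAt 𝓘(ℝ, E) 𝓘(ℝ, E) (extChartAt 𝓘(ℝ, E) (f z₀)) (f z) :=
    mdifferentiableAt_extChartAt hfz
  rw [← christoffel_apply nab (f z₀) hfz]
  change christoffel nab (f z₀) (f ((extChartAt 𝓘(ℝ, EN) z₀).symm (extChartAt 𝓘(ℝ, EN) z₀ z))) w
    (fderiv ℝ ((fun z => extChartAt 𝓘(ℝ, E) (f z₀) (f z)) ∘ (extChartAt 𝓘(ℝ, EN) z₀).symm)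
      (extChartAt 𝓘(ℝ, EN) z₀ z) (mvfderiv 𝓘(ℝ, EN) (extChartAt 𝓘(ℝ, EN) z₀) z X)) = _
  have h2 := mvfderiv_eq_fderiv_chart (g := fun z => extChartAt 𝓘(ℝ, E) (f z₀) (f z)) (h1.comp z hf) hz X
  rw [← h2, (extChartAt 𝓘(ℝ, EN) z₀).left_inv hz,
    mvfderiv_comp_vector h1 hf, TangentBundle.continuousLinearMapAt_trivializationAt hfz]
  rfl

theorem contDiffAt_pullbackForm [T2Space M] [IsManifold 𝓘(ℝ, E) ∞ M] [IsManifold 𝓘(ℝ, EN) ∞ N]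
    (hnab : CovariantDerivative.ContMDiffCovariantDerivative nab ∞) (hf : ContMDiff 𝓘(ℝ, EN) 𝓘(ℝ, E) ∞ f) :
    ContDiffAt ℝ ∞ (pullbackForm nab f z₀) (extChartAt 𝓘(ℝ, EN) z₀ z₀) := by
  have hs : ContMDiffAt 𝓘(ℝ, EN) 𝓘(ℝ, EN) ∞ (extChartAt 𝓘(ℝ, EN) z₀).symm (extChartAt 𝓘(ℝ, EN) z₀ z₀) :=
    (contMDiffOn_extChartAt_symm z₀).contMDiffAt
      ((isOpen_extChartAt_target z₀).mem_nhds (mem_extChartAt_target z₀))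
  have h0 : (extChartAt 𝓘(ℝ, EN) z₀).symm (extChartAt 𝓘(ℝ, EN) z₀ z₀) = z₀ := extChartAt_to_inv z₀
  have hfs : ContMDiffAt 𝓘(ℝ, EN) 𝓘(ℝ, E) ∞ (fun u => f ((extChartAt 𝓘(ℝ, EN) z₀).symm u)) (extChartAt 𝓘(ℝ, EN) z₀ z₀) :=
    hf.contMDiffAt.comp _ hs
  have h1 : ContMDiffAt 𝓘(ℝ, EN) 𝓘(ℝ, E →L[ℝ] E →L[ℝ] E) ∞
      (fun u => christoffel nab (f z₀) (f ((extChartAt 𝓘(ℝ, EN) z₀).symm u))) (extChartAt 𝓘(ℝ, EN) z₀ z₀) := by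
    refine ContMDiffAt.comp (I' := 𝓘(ℝ, E)) (g := christoffel nab (f z₀)) _ ?_ hfs
    rw [h0]
    exact contMDiffAt_christoffel nab (f z₀) hnab
  have h2 : ContMDiffAt 𝓘(ℝ, EN) 𝓘(ℝ, E) ∞ ((fun z => extChartAt 𝓘(ℝ, E) (f z₀) (f z)) ∘ (extChartAt 𝓘(ℝ, EN) z₀).symm)
      (extChartAt 𝓘(ℝ, EN) z₀ z₀) := by
    refine ContMDiffAt.comp (I' := 𝓘(ℝ, E)) (g := extChartAt 𝓘(ℝ, E) (f z₀)) _ ?_ hfs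
    rw [h0]
    exact contMDiffAt_extChartAt
  have h3 : ContDiffAt ℝ ∞ (fun u => (christoffel nab (f z₀) (f ((extChartAt 𝓘(ℝ, EN) z₀).symm u))).flip)
      (extChartAt 𝓘(ℝ, EN) z₀ z₀) :=
    (ContinuousLinearMap.flipₗᵢ ℝ E E E).contDiff.contDiffAt.comp _ h1.contDiffAt
  exact h3.clm_comp (h2.contDiffAt.fderiv_right (by simp))

/-- The pullback connection in a chart of `N` and the frame of `TM` given by a chart of `M`. -/
theorem pullbackCov_in_chart {z : N} (hz : z ∈ (extChartAt 𝓘(ℝ, EN) z₀).source)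
    (hfz : f z ∈ (trivializationAt E (TangentSpace 𝓘(ℝ, E) : M → Type _) (f z₀)).baseSet)
    (hf : MDifferentiableAt 𝓘(ℝ, EN) 𝓘(ℝ, E) f z) {s : Π z : N, TangentSpace 𝓘(ℝ, E) (f z)}
    (hs : MDifferentiableAt 𝓘(ℝ, EN) 𝓘(ℝ, E)
      (fun z' => (trivializationAt E (TangentSpace 𝓘(ℝ, E) : M → Type _) (f z₀) ⟨f z', s z'⟩).2) z)
    (X : TangentSpace 𝓘(ℝ, EN) z) :
    (trivializationAt E (TangentSpace 𝓘(ℝ, E) : M → Type _) (f z₀)).continuousLinearMapAt ℝ (f z)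
      (pullbackCov 𝓘(ℝ, EN) f nab s z X) =
      mvfderiv 𝓘(ℝ, EN)
        (fun z' => (trivializationAt E (TangentSpace 𝓘(ℝ, E) : M → Type _) (f z₀) ⟨f z', s z'⟩).2) z X +
      pullbackForm nab f z₀ (extChartAt 𝓘(ℝ, EN) z₀ z) (mvfderiv 𝓘(ℝ, EN) (extChartAt 𝓘(ℝ, EN) z₀) z X)
        (trivializationAt E (TangentSpace 𝓘(ℝ, E) : M → Type _) (f z₀) ⟨f z, s z⟩).2 := by
  rw [pullbackForm_apply nab hz hfz hf]
  exact pullbackCov_in_frame _ nab hf hfz hs X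

/-- A section of `End(f*TM)` as a matrix-valued function on `N`. -/
noncomputable def endInFrame (x₀ : M) (A : Π z : N, TangentSpace 𝓘(ℝ, E) (f z) →L[ℝ] TangentSpace 𝓘(ℝ, E) (f z)) (z : N) :
    E →L[ℝ] E :=
  ContinuousLinearMap.inCoordinates E (TangentSpace 𝓘(ℝ, E) : M → Type _)
    E (TangentSpace 𝓘(ℝ, E) : M → Type _) x₀ (f z) x₀ (f z) (A z)

theorem endInFrame_apply {x₀ : M} {z : N}
    (hz : f z ∈ (trivializationAt E (TangentSpace 𝓘(ℝ, E) : M → Type _) x₀).baseSet)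
    (A : Π z : N, TangentSpace 𝓘(ℝ, E) (f z) →L[ℝ] TangentSpace 𝓘(ℝ, E) (f z)) (v : TangentSpace 𝓘(ℝ, E) (f z)) :
    endInFrame x₀ A z ((trivializationAt E (TangentSpace 𝓘(ℝ, E) : M → Type _) x₀) ⟨f z, v⟩).2 =
      ((trivializationAt E (TangentSpace 𝓘(ℝ, E) : M → Type _) x₀) ⟨f z, A z v⟩).2 := by
  set e := trivializationAt E (TangentSpace 𝓘(ℝ, E) : M → Type _) x₀
  rw [← e.continuousLinearMapAt_apply_of_mem (R := ℝ) hz, ← e.continuousLinearMapAt_apply_of_mem (R := ℝ) hz]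
  change e.continuousLinearMapAt ℝ (f z) (A z (e.symmL ℝ (f z) (e.continuousLinearMapAt ℝ (f z) v))) = _
  rw [e.symmL_continuousLinearMapAt hz]

/-- In components, `∇(A s) - A ∇s = (dA) s + A ds + θ A s - A ds - A θ s`. The derivatives of `s`
cancel, which leaves `dA + [θ, A]` applied to the value of `s`. -/
theorem pullbackCovEnd_in_chart {z : N} (hz : z ∈ (extChartAt 𝓘(ℝ, EN) z₀).source)
    (hfz : f z ∈ (trivializationAt E (TangentSpace 𝓘(ℝ, E) : M → Type _) (f z₀)).baseSet)
    (hf : MDifferentiableAt 𝓘(ℝ, EN) 𝓘(ℝ, E) f z)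
    (A : Π z : N, TangentSpace 𝓘(ℝ, E) (f z) →L[ℝ] TangentSpace 𝓘(ℝ, E) (f z))
    (hA : MDifferentiableAt 𝓘(ℝ, EN) 𝓘(ℝ, E →L[ℝ] E) (endInFrame (f z₀) A) z)
    (X : TangentSpace 𝓘(ℝ, EN) z) (v : TangentSpace 𝓘(ℝ, E) (f z)) :
    (trivializationAt E (TangentSpace 𝓘(ℝ, E) : M → Type _) (f z₀)).continuousLinearMapAt ℝ (f z)
      (pullbackCovEnd 𝓘(ℝ, EN) f nab A z X v) =
    covDerivForm (endInFrame (f z₀) A ∘ (extChartAt 𝓘(ℝ, EN) z₀).symm) (pullbackForm nab f z₀)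
      (extChartAt 𝓘(ℝ, EN) z₀ z) (mvfderiv 𝓘(ℝ, EN) (extChartAt 𝓘(ℝ, EN) z₀) z X)
      ((trivializationAt E (TangentSpace 𝓘(ℝ, E) : M → Type _) (f z₀)).continuousLinearMapAt ℝ (f z) v) := by
  set e := trivializationAt E (TangentSpace 𝓘(ℝ, E) : M → Type _) (f z₀) with he
  set φ := extChartAt 𝓘(ℝ, EN) z₀ with hφ
  have hlin : ∀ y ∈ e.baseSet, ∀ u, e.continuousLinearMapAt ℝ y u = (e ⟨y, u⟩).2 :=
    fun y hy u => e.continuousLinearMapAt_apply_of_mem (R := ℝ) hy u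
  have hmem : ∀ᶠ z' in 𝓝 z, f z' ∈ e.baseSet := hf.continuousAt (e.open_baseSet.mem_nhds hfz)
  let L : TangentSpace 𝓘(ℝ, E) (f z) →ₗ[ℝ] E :=
    ((covDerivForm (endInFrame (f z₀) A ∘ φ.symm) (pullbackForm nab f z₀) (φ z) (mvfderiv 𝓘(ℝ, EN) φ z X)).comp
      (e.continuousLinearMapAt ℝ (f z))).toLinearMap
  suffices h : (e.continuousLinearMapAt ℝ (f z)).toLinearMap ∘ₗ pullbackCovEnd 𝓘(ℝ, EN) f nab A z X = L from
    LinearMap.congr_fun h v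
  -- `pullbackCovEnd` is defined by its values on this basis, with each vector extended by
  -- `pullbackSection`, so the comparison takes place there.
  refine (Module.finBasis ℝ (TangentSpace 𝓘(ℝ, E) (f z))).ext fun i => ?_
  set b := Module.finBasis ℝ (TangentSpace 𝓘(ℝ, E) (f z)) i with hb
  have hcov : pullbackCovEnd 𝓘(ℝ, EN) f nab A z X b =
      pullbackCov 𝓘(ℝ, EN) f nab (fun z' => A z' (pullbackSection f b z')) z X
        - A z (pullbackCov 𝓘(ℝ, EN) f nab (pullbackSection f b) z X) := by
    exact (Module.finBasis ℝ (TangentSpace 𝓘(ℝ, E) (f z))).constr_basis ℝ _ i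
  have hsd : MDifferentiableAt 𝓘(ℝ, EN) 𝓘(ℝ, E) (fun z' => (e ⟨f z', pullbackSection f b z'⟩).2) z := by
    have h1 := (e.mdifferentiableAt_section_iff 𝓘(ℝ, E) _ hfz).1 (mdifferentiableAt_frameSection
      (trivializationAt E (TangentSpace 𝓘(ℝ, E) : M → Type _) (f z))
      (FiberBundle.mem_baseSet_trivializationAt' (f z))
      ((trivializationAt E (TangentSpace 𝓘(ℝ, E) : M → Type _) (f z)) ⟨f z, b⟩).2)
    exact h1.comp z hf
  have hAs : (fun z' => (e ⟨f z', A z' (pullbackSection f b z')⟩).2) =ᶠ[𝓝 z]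
      fun z' => endInFrame (f z₀) A z' (e ⟨f z', pullbackSection f b z'⟩).2 := by
    filter_upwards [hmem] with z' hz'
    rw [endInFrame_apply hz']
  have hs0 : pullbackSection f b z = b := FiberBundle.extend_apply_self _ _
  have h2 := mvfderiv_clm_apply hA hsd X
  have h3 : MDifferentiableAt 𝓘(ℝ, EN) 𝓘(ℝ, E) (fun z' => (e ⟨f z', A z' (pullbackSection f b z')⟩).2) z :=
    (hA.clm_apply hsd).congr_of_eventuallyEq hAs
  change e.continuousLinearMapAt ℝ (f z) (pullbackCovEnd 𝓘(ℝ, EN) f nab A z X b) =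
    covDerivForm (endInFrame (f z₀) A ∘ φ.symm) (pullbackForm nab f z₀) (φ z) (mvfderiv 𝓘(ℝ, EN) φ z X)
      (e.continuousLinearMapAt ℝ (f z) b)
  have h4 : ∀ u, e.continuousLinearMapAt ℝ (f z) (A z u) =
      endInFrame (f z₀) A z (e.continuousLinearMapAt ℝ (f z) u) := fun u => by
    rw [hlin _ hfz, hlin _ hfz, endInFrame_apply hfz]
  rw [hcov, map_sub, pullbackCov_in_chart nab hz hfz hf h3, mvfderiv_congr hAs, h2, h4,
    pullbackCov_in_chart nab hz hfz hf hsd, hs0, ← hlin _ hfz b, ← hlin _ hfz (A z b), h4]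
  have h5 := mvfderiv_eq_fderiv_chart hA hz X
  rw [← hφ] at h5
  simp only [covDerivForm, add_apply, sub_apply, mul_apply_eq_comp, Function.comp_apply, φ.left_inv hz, map_add,
    ← hφ, ← he, ← h5]
  abel

end pullbackForm

theorem hasFDerivAt_apply_apply {F G E E' : Type*} [NormedAddCommGroup F] [NormedSpace ℝ F] [NormedAddCommGroup G]
    [NormedSpace ℝ G] [NormedAddCommGroup E] [NormedSpace ℝ E] [NormedAddCommGroup E'] [NormedSpace ℝ E']
    {θ : F → G →L[ℝ] E →L[ℝ] E'} {u : F} (hθ : DifferentiableAt ℝ θ u) (y : G) (w : E) :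
    ∃ L : F →L[ℝ] E', HasFDerivAt (fun u => θ u y w) L u ∧ ∀ X, L X = fderiv ℝ θ u X y w :=
  ⟨_, (hθ.hasFDerivAt.clm_apply (hasFDerivAt_const y u)).clm_apply (hasFDerivAt_const w u), fun X => by simp⟩

/-! ### Coordinate vector fields -/

section coordinateFields
variable {EN N : Type*} [NormedAddCommGroup EN] [NormedSpace ℝ EN] [TopologicalSpace N] [ChartedSpace EN N]
  [IsManifold 𝓘(ℝ, EN) 1 N]

theorem extend_eq_symmL {z₀ z : N} (hz : z ∈ (chartAt EN z₀).source) (X : TangentSpace 𝓘(ℝ, EN) z₀) :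
    FiberBundle.extend EN X z = (trivializationAt EN (TangentSpace 𝓘(ℝ, EN) : N → Type _) z₀).symmL ℝ z
      (mvfderiv 𝓘(ℝ, EN) (extChartAt 𝓘(ℝ, EN) z₀) z₀ X) := by
  set e := trivializationAt EN (TangentSpace 𝓘(ℝ, EN) : N → Type _) z₀ with he
  have hz₀ : z₀ ∈ (chartAt EN z₀).source := mem_chart_source EN z₀
  have h1 : (e ⟨z₀, X⟩).2 = mvfderiv 𝓘(ℝ, EN) (extChartAt 𝓘(ℝ, EN) z₀) z₀ X := by
    rw [← e.continuousLinearMapAt_apply_of_mem (R := ℝ) hz₀,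
      TangentBundle.continuousLinearMapAt_trivializationAt hz₀]
    rfl
  rw [← h1, e.symmL_apply hz]
  rfl

theorem mvfderiv_extChartAt_extend {z₀ z : N} (hz : z ∈ (chartAt EN z₀).source) (X : TangentSpace 𝓘(ℝ, EN) z₀) :
    mvfderiv 𝓘(ℝ, EN) (extChartAt 𝓘(ℝ, EN) z₀) z (FiberBundle.extend EN X z) =
      mvfderiv 𝓘(ℝ, EN) (extChartAt 𝓘(ℝ, EN) z₀) z₀ X := by
  have h := TangentBundle.continuousLinearMapAt_trivializationAt (I := 𝓘(ℝ, EN)) hz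
  rw [extend_eq_symmL hz]
  refine Eq.trans ?_ ((trivializationAt EN (TangentSpace 𝓘(ℝ, EN) : N → Type _) z₀).continuousLinearMapAt_symmL
    (R := ℝ) hz (mvfderiv 𝓘(ℝ, EN) (extChartAt 𝓘(ℝ, EN) z₀) z₀ X))
  rw [h]
  rfl

/-- The trivialization at `z₀` is the differential of the chart, so constant components in it mean
that the field is constant in the chart. -/
theorem mpullbackWithin_extend {z₀ : N} (X : TangentSpace 𝓘(ℝ, EN) z₀) {u : EN}
    (hu : u ∈ (extChartAt 𝓘(ℝ, EN) z₀).target) :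
    VectorField.mpullbackWithin 𝓘(ℝ, EN) 𝓘(ℝ, EN) (extChartAt 𝓘(ℝ, EN) z₀).symm (FiberBundle.extend EN X)
      (range 𝓘(ℝ, EN)) u = mvfderiv 𝓘(ℝ, EN) (extChartAt 𝓘(ℝ, EN) z₀) z₀ X := by
  have hz : (extChartAt 𝓘(ℝ, EN) z₀).symm u ∈ (chartAt EN z₀).source := by
    rw [← extChartAt_source 𝓘(ℝ, EN)]
    exact (extChartAt 𝓘(ℝ, EN) z₀).map_target hu
  have h := TangentBundle.symmL_trivializationAt (I := 𝓘(ℝ, EN)) hz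
  -- The trivialization involves the derivative at `φ (φ⁻¹ u)` instead of `u`. Regarding both
  -- derivatives as maps `EN →L[ℝ] EN` permits the substitution although their types depend on the
  -- point.
  have key : ∀ u' : EN, u' = u → ∀ w : EN,
      (mfderivWithin 𝓘(ℝ, EN) 𝓘(ℝ, EN) (extChartAt 𝓘(ℝ, EN) z₀).symm (range 𝓘(ℝ, EN)) u' : EN →L[ℝ] EN) w =
      (mfderivWithin 𝓘(ℝ, EN) 𝓘(ℝ, EN) (extChartAt 𝓘(ℝ, EN) z₀).symm (range 𝓘(ℝ, EN)) u : EN →L[ℝ] EN) w := by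
    rintro _ rfl w; rfl
  have h2 : FiberBundle.extend EN X ((extChartAt 𝓘(ℝ, EN) z₀).symm u) =
      mfderivWithin 𝓘(ℝ, EN) 𝓘(ℝ, EN) (extChartAt 𝓘(ℝ, EN) z₀).symm (range 𝓘(ℝ, EN)) u
        (mvfderiv 𝓘(ℝ, EN) (extChartAt 𝓘(ℝ, EN) z₀) z₀ X) := by
    rw [extend_eq_symmL hz, h]
    exact key _ ((extChartAt 𝓘(ℝ, EN) z₀).right_inv hu) _
  rw [VectorField.mpullbackWithin_apply, h2]
  exact ContinuousLinearMap.IsInvertible.inverse_apply_eq (isInvertible_mfderivWithin_extChartAt_symm hu) |>.2 rfl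

/-- Both fields are constant in the chart. This removes the bracket term from the curvature. -/
theorem mlieBracket_extend (z₀ : N) (X Y : TangentSpace 𝓘(ℝ, EN) z₀) :
    VectorField.mlieBracket 𝓘(ℝ, EN) (FiberBundle.extend EN X) (FiberBundle.extend EN Y) z₀ = 0 := by
  rw [VectorField.mlieBracket, VectorField.mlieBracketWithin_apply]
  have hnb := (isOpen_extChartAt_target (I := 𝓘(ℝ, EN)) z₀).mem_nhds (mem_extChartAt_target z₀)
  have h : ∀ X : TangentSpace 𝓘(ℝ, EN) z₀, VectorField.mpullbackWithin 𝓘(ℝ, EN) 𝓘(ℝ, EN) (extChartAt 𝓘(ℝ, EN) z₀).symm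
      (FiberBundle.extend EN X) (range 𝓘(ℝ, EN)) =ᶠ[𝓝 (extChartAt 𝓘(ℝ, EN) z₀ z₀)]
      fun _ => mvfderiv 𝓘(ℝ, EN) (extChartAt 𝓘(ℝ, EN) z₀) z₀ X := fun X => by
    filter_upwards [hnb] with u hu using mpullbackWithin_extend X hu
  rw [Filter.EventuallyEq.lieBracketWithin_vectorField_eq_nhds (h X) (h Y)]
  simp only [VectorField.lieBracketWithin, fderivWithin_fun_const, Pi.zero_apply, zero_apply, sub_zero]
  exact ContinuousLinearMap.map_zero _

end coordinateFields

/-! ### The curvature of the pullback connection -/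

section curvature
variable {E M EN N : Type*} [NormedAddCommGroup E] [NormedSpace ℝ E] [FiniteDimensional ℝ E]
  [TopologicalSpace M] [ChartedSpace E M] [IsManifold 𝓘(ℝ, E) 1 M]
  [ContMDiffVectorBundle ∞ E (TangentSpace 𝓘(ℝ, E) : M → Type _) 𝓘(ℝ, E)]
  [TopologicalSpace N] [NormedAddCommGroup EN] [NormedSpace ℝ EN] [ChartedSpace EN N]
  [IsManifold 𝓘(ℝ, EN) 1 N]
  (nab : CovariantDerivative 𝓘(ℝ, E) E (TangentSpace 𝓘(ℝ, E) : M → Type _)) {f : N → M} (z₀ : N)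

/-- The first covariant derivative of a section with constant coordinates. -/
theorem pullbackCov_frameSection {z : N} (hz : z ∈ (extChartAt 𝓘(ℝ, EN) z₀).source)
    (hfz : f z ∈ (trivializationAt E (TangentSpace 𝓘(ℝ, E) : M → Type _) (f z₀)).baseSet)
    (hf : MDifferentiableAt 𝓘(ℝ, EN) 𝓘(ℝ, E) f z) (w : E) (X : TangentSpace 𝓘(ℝ, EN) z) :
    (trivializationAt E (TangentSpace 𝓘(ℝ, E) : M → Type _) (f z₀) ⟨f z, pullbackCov 𝓘(ℝ, EN) f nab
      (fun z' => frameSection (trivializationAt E (TangentSpace 𝓘(ℝ, E) : M → Type _) (f z₀)) w (f z')) z X⟩).2 =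
      pullbackForm nab f z₀ (extChartAt 𝓘(ℝ, EN) z₀ z) (mvfderiv 𝓘(ℝ, EN) (extChartAt 𝓘(ℝ, EN) z₀) z X) w := by
  set e := trivializationAt E (TangentSpace 𝓘(ℝ, E) : M → Type _) (f z₀) with he
  have hconst : (fun z' => (e ⟨f z', frameSection e w (f z')⟩).2) =ᶠ[𝓝 z] fun _ => w := by
    filter_upwards [hf.continuousAt (e.open_baseSet.mem_nhds hfz)] with z' hz'
    exact trivialization_frameSection e hz' w
  have hd : MDifferentiableAt 𝓘(ℝ, EN) 𝓘(ℝ, E) (fun z' => (e ⟨f z', frameSection e w (f z')⟩).2) z :=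
    mdifferentiableAt_const.congr_of_eventuallyEq hconst
  rw [← e.continuousLinearMapAt_apply_of_mem (R := ℝ) hfz, pullbackCov_in_chart nab hz hfz hf hd,
    mvfderiv_congr (EN := EN) hconst, mvfderiv_const, ← he, trivialization_frameSection e hfz]
  simp

/-- For coordinate fields `X`, `Y` and a section with constant components `w`, the first derivative
is `θ(Y) w` and the second is `dθ(X)(Y) w + θ(X) θ(Y) w`. Antisymmetrization gives `dθ + θ ∧ θ`. -/
theorem pullbackCurvature_in_chart (hf : ContMDiff 𝓘(ℝ, EN) 𝓘(ℝ, E) 1 f)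
    (hθ : DifferentiableAt ℝ (pullbackForm nab f z₀) (extChartAt 𝓘(ℝ, EN) z₀ z₀))
    (X Y : TangentSpace 𝓘(ℝ, EN) z₀) (v : TangentSpace 𝓘(ℝ, E) (f z₀)) :
    (trivializationAt E (TangentSpace 𝓘(ℝ, E) : M → Type _) (f z₀)).continuousLinearMapAt ℝ (f z₀)
      (pullbackCurvature 𝓘(ℝ, EN) f nab z₀ X Y v) =
    curvatureForm (pullbackForm nab f z₀) (extChartAt 𝓘(ℝ, EN) z₀ z₀)
      (mvfderiv 𝓘(ℝ, EN) (extChartAt 𝓘(ℝ, EN) z₀) z₀ X) (mvfderiv 𝓘(ℝ, EN) (extChartAt 𝓘(ℝ, EN) z₀) z₀ Y)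
      ((trivializationAt E (TangentSpace 𝓘(ℝ, E) : M → Type _) (f z₀)).continuousLinearMapAt ℝ (f z₀) v) := by
  set e := trivializationAt E (TangentSpace 𝓘(ℝ, E) : M → Type _) (f z₀) with he
  set φ := extChartAt 𝓘(ℝ, EN) z₀ with hφ
  set θ := pullbackForm (EN := EN) nab f z₀ with hθdef
  have hz₀ : z₀ ∈ φ.source := mem_extChartAt_source z₀
  have hfz₀ : f z₀ ∈ e.baseSet := FiberBundle.mem_baseSet_trivializationAt' (f z₀)
  have hfd : ∀ z, MDifferentiableAt 𝓘(ℝ, EN) 𝓘(ℝ, E) f z := fun z => (hf z).mdifferentiableAt (by simp)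
  let L : TangentSpace 𝓘(ℝ, E) (f z₀) →ₗ[ℝ] E :=
    ((curvatureForm θ (φ z₀) (mvfderiv 𝓘(ℝ, EN) φ z₀ X) (mvfderiv 𝓘(ℝ, EN) φ z₀ Y)).comp
      (e.continuousLinearMapAt ℝ (f z₀))).toLinearMap
  suffices h : (e.continuousLinearMapAt ℝ (f z₀)).toLinearMap ∘ₗ pullbackCurvature 𝓘(ℝ, EN) f nab z₀ X Y = L from
    LinearMap.congr_fun h v
  refine (Module.finBasis ℝ (TangentSpace 𝓘(ℝ, E) (f z₀))).ext fun i => ?_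
  set b := Module.finBasis ℝ (TangentSpace 𝓘(ℝ, E) (f z₀)) i with hb
  have hcurv : pullbackCurvature 𝓘(ℝ, EN) f nab z₀ X Y b =
      pullbackCov 𝓘(ℝ, EN) f nab (fun z' => pullbackCov 𝓘(ℝ, EN) f nab (pullbackSection f b) z'
        (FiberBundle.extend EN Y z')) z₀ X
      - pullbackCov 𝓘(ℝ, EN) f nab (fun z' => pullbackCov 𝓘(ℝ, EN) f nab (pullbackSection f b) z'
        (FiberBundle.extend EN X z')) z₀ Y
      - pullbackCov 𝓘(ℝ, EN) f nab (pullbackSection f b) z₀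
        (VectorField.mlieBracket 𝓘(ℝ, EN) (FiberBundle.extend EN X) (FiberBundle.extend EN Y) z₀) := by
    exact (Module.finBasis ℝ (TangentSpace 𝓘(ℝ, E) (f z₀))).constr_basis ℝ _ i
  have hw : e.continuousLinearMapAt ℝ (f z₀) b = (e ⟨f z₀, b⟩).2 := e.continuousLinearMapAt_apply_of_mem (R := ℝ) hfz₀ b
  set w := (e ⟨f z₀, b⟩).2 with hwdef
  -- The first derivative is needed on a neighbourhood, because it is differentiated again. There
  -- `pullbackSection f b` is the frame section with components `w`, and the extension of `Y` has
  -- constant components.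
  have hcoord : ∀ Y : TangentSpace 𝓘(ℝ, EN) z₀, (fun z' => (e ⟨f z', pullbackCov 𝓘(ℝ, EN) f nab (pullbackSection f b) z'
        (FiberBundle.extend EN Y z')⟩).2) =ᶠ[𝓝 z₀] fun z' => θ (φ z') (mvfderiv 𝓘(ℝ, EN) φ z₀ Y) w := by
    intro Y
    filter_upwards [(hfd z₀).continuousAt (e.open_baseSet.mem_nhds hfz₀),
      (isOpen_extChartAt_source (I := 𝓘(ℝ, EN)) z₀).mem_nhds hz₀] with z hz hz'
    have h1 := pullbackCov_frameSection nab z₀ hz' hz (hfd z) w (FiberBundle.extend EN Y z)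
    rw [mvfderiv_extChartAt_extend (by rwa [extChartAt_source] at hz')] at h1
    exact h1
  have hφd : MDifferentiableAt 𝓘(ℝ, EN) 𝓘(ℝ, EN) φ z₀ := mdifferentiableAt_extChartAt (mem_chart_source EN z₀)
  choose θ' hθd hθ' using fun y : EN => hasFDerivAt_apply_apply hθ y w
  have hmd : ∀ y : EN, MDifferentiableAt 𝓘(ℝ, EN) 𝓘(ℝ, E) (fun z' => θ (φ z') y w) z₀ := fun y =>
    MDifferentiableAt.comp (g := fun u => θ u y w) z₀ (hθd y).differentiableAt.mdifferentiableAt hφd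
  have hsecond : ∀ X Y : TangentSpace 𝓘(ℝ, EN) z₀, e.continuousLinearMapAt ℝ (f z₀)
      (pullbackCov 𝓘(ℝ, EN) f nab (fun z' => pullbackCov 𝓘(ℝ, EN) f nab (pullbackSection f b) z'
        (FiberBundle.extend EN Y z')) z₀ X) =
      fderiv ℝ θ (φ z₀) (mvfderiv 𝓘(ℝ, EN) φ z₀ X) (mvfderiv 𝓘(ℝ, EN) φ z₀ Y) w +
      θ (φ z₀) (mvfderiv 𝓘(ℝ, EN) φ z₀ X) (θ (φ z₀) (mvfderiv 𝓘(ℝ, EN) φ z₀ Y) w) := by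
    intro X Y
    have h1 := pullbackCov_in_chart nab hz₀ hfz₀ (hfd z₀) ((hmd _).congr_of_eventuallyEq (hcoord Y)) X
    rw [mvfderiv_congr (hcoord Y), mvfderiv_comp_vector (g := fun u => θ u (mvfderiv 𝓘(ℝ, EN) φ z₀ Y) w)
      (hθd _).differentiableAt.mdifferentiableAt hφd] at h1
    have h2 := mvfderiv_eq_fderiv (fun u => θ u (mvfderiv 𝓘(ℝ, EN) φ z₀ Y) w) (φ z₀) (mvfderiv 𝓘(ℝ, EN) φ z₀ X)
    rw [(hθd _).fderiv, hθ'] at h2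
    exact h1.trans (congrArg₂ (· + ·) h2 (congrArg _ (hcoord Y).self_of_nhds))
  change e.continuousLinearMapAt ℝ (f z₀) (pullbackCurvature 𝓘(ℝ, EN) f nab z₀ X Y b) =
    curvatureForm θ (φ z₀) (mvfderiv 𝓘(ℝ, EN) φ z₀ X) (mvfderiv 𝓘(ℝ, EN) φ z₀ Y)
      (e.continuousLinearMapAt ℝ (f z₀) b)
  rw [hcurv, mlieBracket_extend, map_zero, sub_zero, map_sub, hsecond, hsecond, hw]
  simp only [curvatureForm, add_apply, sub_apply, mul_apply_eq_comp]
  abel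

end curvature

/-- If `J` preserves the bilinear forms `b`, and these are parallel in the direction `X` for the connection with
connection form `θ`, then `∇_X J` satisfies the infinitesimal version of the invariance. -/
theorem covDerivForm_skew {F E : Type*} [NormedAddCommGroup F] [NormedSpace ℝ F] [NormedAddCommGroup E] [NormedSpace ℝ E]
    {b : F → E →L[ℝ] E →L[ℝ] ℝ} {J : F → E →L[ℝ] E} (θ : F → F →L[ℝ] E →L[ℝ] E) {u : F} (X : F)
    (hb : DifferentiableAt ℝ b u) (hJ : DifferentiableAt ℝ J u)
    (hinv : ∀ᶠ u in 𝓝 u, ∀ v w, b u (J u v) (J u w) = b u v w)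
    (hpar : ∀ v w, fderiv ℝ b u X v w = b u (θ u X v) w + b u v (θ u X w)) (v w : E) :
    b u (covDerivForm J θ u X v) (J u w) + b u (J u v) (covDerivForm J θ u X w) = 0 := by
  have hJd : ∀ v, HasFDerivAt (fun u => J u v) _ u := fun v => hJ.hasFDerivAt.clm_apply (hasFDerivAt_const v u)
  have h1 := (hb.hasFDerivAt.clm_apply (hJd v)).clm_apply (hJd w)
  have h2 := (hb.hasFDerivAt.clm_apply (hasFDerivAt_const v u)).clm_apply (hasFDerivAt_const w u)
  have h3 : (fun u => b u (J u v) (J u w)) =ᶠ[𝓝 u] fun u => b u v w := by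
    filter_upwards [hinv] with u hu using hu v w
  have h4 := DFunLike.congr_fun ((h1.congr_of_eventuallyEq h3.symm).unique h2) X
  simp only [add_apply, ContinuousLinearMap.comp_apply, ContinuousLinearMap.flip_apply, hpar, zero_apply, map_zero,
    zero_add] at h4
  -- Invariance for the pairs `(θ v, w)` and `(v, θ w)` rewrites the derivative of `b u v w` as the
  -- missing halves of the commutators `[θ, J]`.
  have h5 := fun v w => hinv.self_of_nhds v w
  have h6 := h5 (θ u X v) w
  have h7 := h5 v (θ u X w)
  simp only [covDerivForm, add_apply, sub_apply, mul_apply_eq_comp, map_add, map_sub]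
  linarith

/-- To be applied with `a` and `b` the base and fibre coordinates on `End(TM)`, and `h` the
expression of a chart of the twistor space in these coordinates. -/
theorem mvfderiv_comp_prodMk_eq_zero {EN N V W U : Type*} [NormedAddCommGroup EN] [NormedSpace ℝ EN] [TopologicalSpace N]
    [ChartedSpace EN N] [NormedAddCommGroup V] [NormedSpace ℝ V] [NormedAddCommGroup W] [NormedSpace ℝ W]
    [NormedAddCommGroup U] [NormedSpace ℝ U] {h : V × W → U} {a : N → V} {b : N → W} {z : N}
    (hh : DifferentiableAt ℝ h (a z, b z)) (ha : MDifferentiableAt 𝓘(ℝ, EN) 𝓘(ℝ, V) a z)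
    (hb : MDifferentiableAt 𝓘(ℝ, EN) 𝓘(ℝ, W) b z) {X : TangentSpace 𝓘(ℝ, EN) z}
    (ha0 : mvfderiv 𝓘(ℝ, EN) a z X = 0) (hb0 : mvfderiv 𝓘(ℝ, EN) b z X = 0) :
    mvfderiv 𝓘(ℝ, EN) (fun z => h (a z, b z)) z X = 0 := by
  have hab : MDifferentiableAt 𝓘(ℝ, EN) 𝓘(ℝ, V × W) (fun z => (a z, b z)) z := ha.prodMk_space hb
  have hfst : mvfderiv 𝓘(ℝ, EN) a z X = (mvfderiv 𝓘(ℝ, EN) (fun z => (a z, b z)) z X).1 :=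
    DFunLike.congr_fun ((ContinuousLinearMap.fst ℝ V W).hasMFDerivAt.comp z hab.hasMFDerivAt).mfderiv X
  have hsnd : mvfderiv 𝓘(ℝ, EN) b z X = (mvfderiv 𝓘(ℝ, EN) (fun z => (a z, b z)) z X).2 :=
    DFunLike.congr_fun ((ContinuousLinearMap.snd ℝ V W).hasMFDerivAt.comp z hab.hasMFDerivAt).mfderiv X
  have h0 : mvfderiv 𝓘(ℝ, EN) (fun z => (a z, b z)) z X = 0 := Prod.ext (hfst.symm.trans ha0) (hsnd.symm.trans hb0)
  have h1 := mvfderiv_comp_vector (g := h) (f := fun z => (a z, b z)) hh.mdifferentiableAt hab X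
  exact h1.trans ((congrArg _ h0).trans (ContinuousLinearMap.map_zero _))

/-! ### The symplectic form in a local frame -/

section symplectic
variable {n : ℕ} {M : Type*} [TopologicalSpace M] [ChartedSpace (EuclideanSpace ℝ (Fin (2 * n))) M]
  [IsManifold (𝓡 (2 * n)) ∞ M]

/-- The symplectic form in a chart and the corresponding frame, as a smooth family of bilinear forms. -/
theorem SymplecticForm.exists_inFrame (Ω : SymplecticForm n M) (x₀ : M) :
    ∃ β : EuclideanSpace ℝ (Fin (2 * n)) →
        EuclideanSpace ℝ (Fin (2 * n)) →L[ℝ] EuclideanSpace ℝ (Fin (2 * n)) →L[ℝ] ℝ,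
      ContDiffOn ℝ ∞ β (extChartAt (𝓡 (2 * n)) x₀).target ∧
      ∀ x ∈ (trivializationAt (EuclideanSpace ℝ (Fin (2 * n))) (TangentSpace (𝓡 (2 * n)) : M → Type _) x₀).baseSet,
        ∀ v w : TangentSpace (𝓡 (2 * n)) x, β (extChartAt (𝓡 (2 * n)) x₀ x)
          ((trivializationAt (EuclideanSpace ℝ (Fin (2 * n))) (TangentSpace (𝓡 (2 * n)) : M → Type _)
            x₀).continuousLinearMapAt ℝ x v)
          ((trivializationAt (EuclideanSpace ℝ (Fin (2 * n))) (TangentSpace (𝓡 (2 * n)) : M → Type _)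
            x₀).continuousLinearMapAt ℝ x w) = Ω.toForm x ![v, w] := by
  obtain ⟨β, hβs, hβ⟩ := exists_bilinear (Ω.smooth x₀)
  refine ⟨β, hβs, fun x hx v w => ?_⟩
  set e := trivializationAt (EuclideanSpace ℝ (Fin (2 * n))) (TangentSpace (𝓡 (2 * n)) : M → Type _) x₀ with he
  have hsymm := TangentBundle.symmL_trivializationAt (I := 𝓡 (2 * n)) hx
  rw [hβ, formInChart, ← hsymm]
  -- The chart expression evaluates the form at `φ⁻¹ (φ x)`. Generalizing this point to `y`, with
  -- `L` a map between the model spaces, makes the dependent substitution possible.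
  have key : ∀ y (hy : y = x) (L : EuclideanSpace ℝ (Fin (2 * n)) →L[ℝ] EuclideanSpace ℝ (Fin (2 * n))),
      (∀ v : TangentSpace (𝓡 (2 * n)) x, L (e.continuousLinearMapAt ℝ x v) = v) →
      ((Ω.toForm y).compContinuousLinearMap
        (L : EuclideanSpace ℝ (Fin (2 * n)) →L[ℝ] TangentSpace (𝓡 (2 * n)) y))
        ![e.continuousLinearMapAt ℝ x v, e.continuousLinearMapAt ℝ x w] = Ω.toForm x ![v, w] := by
    rintro _ rfl L hL
    change Ω.toForm _ (fun i => L (![e.continuousLinearMapAt ℝ _ v, e.continuousLinearMapAt ℝ _ w] i)) = _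
    congr 1
    ext i : 1
    fin_cases i
    · exact hL v
    · exact hL w
  exact key _ ((extChartAt (𝓡 (2 * n)) x₀).left_inv (by rw [extChartAt_source]; exact hx)) _
    fun v => e.symmL_continuousLinearMapAt hx v

end symplectic

/-! ### The canonical section and tangent vectors of the twistor space -/

namespace TwistorSpace
variable {n : ℕ} {M : Type*} [TopologicalSpace M] [ChartedSpace (EuclideanSpace ℝ (Fin (2 * n))) M]
  [IsManifold (𝓡 (2 * n)) ∞ M] {Ω : SymplecticForm n M}

theorem contMDiff_proj : ContMDiff 𝓘(ℝ, twistorModel n) (𝓡 (2 * n)) ∞ (proj (Ω := Ω)) :=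
  fun z => ((contMDiffAt_hom_bundle _).1 (contMDiff_val z)).1

theorem mdifferentiableAt_proj (z : TwistorSpace Ω) :
    MDifferentiableAt 𝓘(ℝ, twistorModel n) (𝓡 (2 * n)) (proj (Ω := Ω)) z :=
  (contMDiff_proj z).mdifferentiableAt (by simp)

theorem contMDiffAt_PhiInCoordinates (z : TwistorSpace Ω) :
    ContMDiffAt 𝓘(ℝ, twistorModel n) 𝓘(ℝ, EuclideanSpace ℝ (Fin (2 * n)) →L[ℝ] EuclideanSpace ℝ (Fin (2 * n))) ∞
      (PhiInCoordinates (Ω := Ω) (proj z)) z :=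
  ((contMDiffAt_hom_bundle _).1 (contMDiff_val z)).2

theorem eventually_mem_baseSet (z₀ : TwistorSpace Ω) : ∀ᶠ z in 𝓝 z₀, proj z ∈
    (trivializationAt (EuclideanSpace ℝ (Fin (2 * n))) (TangentSpace (𝓡 (2 * n)) : M → Type _) (proj z₀)).baseSet :=
  (contMDiff_proj z₀).continuousAt ((Trivialization.open_baseSet _).mem_nhds
    (FiberBundle.mem_baseSet_trivializationAt' (proj z₀)))

theorem PhiInCoordinates_apply {z : TwistorSpace Ω} {x₀ : M}
    (hz : proj z ∈ (trivializationAt (EuclideanSpace ℝ (Fin (2 * n)))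
      (TangentSpace (𝓡 (2 * n)) : M → Type _) x₀).baseSet) (v : TangentSpace (𝓡 (2 * n)) (proj z)) :
    PhiInCoordinates x₀ z ((trivializationAt (EuclideanSpace ℝ (Fin (2 * n)))
      (TangentSpace (𝓡 (2 * n)) : M → Type _) x₀).continuousLinearMapAt ℝ (proj z) v) =
    (trivializationAt (EuclideanSpace ℝ (Fin (2 * n)))
      (TangentSpace (𝓡 (2 * n)) : M → Type _) x₀).continuousLinearMapAt ℝ (proj z) (Phi z v) := by
  set e := trivializationAt (EuclideanSpace ℝ (Fin (2 * n))) (TangentSpace (𝓡 (2 * n)) : M → Type _) x₀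
  change e.continuousLinearMapAt ℝ (proj z) (Phi z (e.symmL ℝ (proj z) (e.continuousLinearMapAt ℝ (proj z) v))) = _
  rw [e.symmL_continuousLinearMapAt hz]

theorem compatWith_Phi (z : TwistorSpace Ω) :
    CompatWith (fun v w => Ω.toForm (proj z) ![v, w]) (Phi z) := z.2

theorem PhiInCoordinates_sq {z : TwistorSpace Ω} {x₀ : M}
    (hz : proj z ∈ (trivializationAt (EuclideanSpace ℝ (Fin (2 * n)))
      (TangentSpace (𝓡 (2 * n)) : M → Type _) x₀).baseSet) :
    PhiInCoordinates x₀ z * PhiInCoordinates x₀ z = -1 := by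
  set e := trivializationAt (EuclideanSpace ℝ (Fin (2 * n))) (TangentSpace (𝓡 (2 * n)) : M → Type _) x₀
  ext1 a
  rw [← e.continuousLinearMapAt_symmL (R := ℝ) hz a, mul_apply_eq_comp, PhiInCoordinates_apply hz,
    PhiInCoordinates_apply hz, (compatWith_Phi z).sq, map_neg]
  rfl

/-- A vertical tangent vector along which `Φ` is constant vanishes. -/
theorem eq_zero_of_mfderiv_eq_zero (z : TwistorSpace Ω) (X : TangentSpace 𝓘(ℝ, twistorModel n) z)
    (h1 : mfderiv 𝓘(ℝ, twistorModel n) (𝓡 (2 * n)) (proj (Ω := Ω)) z X = 0)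
    (h2 : mvfderiv 𝓘(ℝ, twistorModel n) (PhiInCoordinates (Ω := Ω) (proj z)) z X = 0) : X = 0 := by
  set IN := ((𝓡 (2 * n)).prod 𝓘(ℝ, EuclideanSpace ℝ (Fin (2 * n)) →L[ℝ] EuclideanSpace ℝ (Fin (2 * n)))) with hIN
  let p : EndTM n M := z.1
  let c : OpenPartialHomeomorph (TwistorSpace Ω) (twistorModel n) := chartAt (twistorModel n) z
  have hc : IsSliceChart IN (compatSet Ω) c := chart_mem_atlas (twistorModel n) z
  -- Here the embedding is used: near `z` the chart is the restriction of a smooth map `f` on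
  -- `End(TM)`, hence a smooth function of the base coordinates and of the matrix of `Φ`. Both are
  -- stationary along `X`, so the differential of the chart kills `X`.
  obtain ⟨f, hf, hfe⟩ := hc.exists_extension z (mem_chart_source (twistorModel n) z)
  let Ψ : TwistorSpace Ω → EuclideanSpace ℝ (Fin (2 * n)) ×
      (EuclideanSpace ℝ (Fin (2 * n)) →L[ℝ] EuclideanSpace ℝ (Fin (2 * n))) := fun z' =>
    (extChartAt (𝓡 (2 * n)) (proj z) (proj z'), PhiInCoordinates (proj z) z')
  have hΨ : ∀ z' : TwistorSpace Ω, Ψ z' = extChartAt IN p z'.1 := fun z' =>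
    (hom_chart (HB := EuclideanSpace ℝ (Fin (2 * n))) p z'.1).symm
  have hchart : MDifferentiableAt (𝓡 (2 * n)) 𝓘(ℝ, EuclideanSpace ℝ (Fin (2 * n)))
      (extChartAt (𝓡 (2 * n)) (proj z)) (proj z) := mdifferentiableAt_extChartAt (mem_chart_source _ _)
  have hd1 : MDifferentiableAt 𝓘(ℝ, twistorModel n) 𝓘(ℝ, EuclideanSpace ℝ (Fin (2 * n)))
      (fun z' => extChartAt (𝓡 (2 * n)) (proj z) (proj z')) z := hchart.comp z (mdifferentiableAt_proj z)
  have hd2 : MDifferentiableAt 𝓘(ℝ, twistorModel n)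
      𝓘(ℝ, EuclideanSpace ℝ (Fin (2 * n)) →L[ℝ] EuclideanSpace ℝ (Fin (2 * n)))
      (PhiInCoordinates (Ω := Ω) (proj z)) z := (contMDiffAt_PhiInCoordinates z).mdifferentiableAt (by simp)
  have h3 : mvfderiv 𝓘(ℝ, twistorModel n) (fun z' => extChartAt (𝓡 (2 * n)) (proj z) (proj z')) z X = 0 := by
    rw [mvfderiv_comp_vector hchart (mdifferentiableAt_proj z), h1, map_zero]
  have hmem : extChartAt IN p p ∈ (extChartAt IN p).target := mem_extChartAt_target p
  have hh : DifferentiableAt ℝ (fun y => f ((extChartAt IN p).symm y)) (Ψ z) := by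
    rw [hΨ z]
    have h5 : ContMDiffAt 𝓘(ℝ, EuclideanSpace ℝ (Fin (2 * n)) ×
      (EuclideanSpace ℝ (Fin (2 * n)) →L[ℝ] EuclideanSpace ℝ (Fin (2 * n)))) IN ∞ (extChartAt IN p).symm (extChartAt IN p p) :=
      (contMDiffOn_extChartAt_symm (I := IN) p).contMDiffAt ((isOpen_extChartAt_target (I := IN) p).mem_nhds hmem)
    have h6 : ContMDiffAt IN 𝓘(ℝ, twistorModel n) ∞ f ((extChartAt IN p).symm (extChartAt IN p p)) := by
      rw [(extChartAt IN p).left_inv (mem_extChartAt_source p)]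
      exact hf
    exact ((h6.comp _ h5).mdifferentiableAt (by simp)).differentiableAt
  have hev : (extChartAt 𝓘(ℝ, twistorModel n) z : TwistorSpace Ω → twistorModel n) =ᶠ[𝓝 z]
      fun z' => f ((extChartAt IN p).symm (Ψ z')) := by
    have hcont : ContinuousAt (fun z' : TwistorSpace Ω => (z'.1 : EndTM n M)) z := (contMDiff_val z).continuousAt
    filter_upwards [hfe, hcont ((isOpen_extChartAt_source (I := IN) p).mem_nhds (mem_extChartAt_source p))] with z' hz' hz''
    rw [hΨ, (extChartAt IN p).left_inv hz'']
    exact hz'.symm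
  have h7 : mvfderiv 𝓘(ℝ, twistorModel n) (extChartAt 𝓘(ℝ, twistorModel n) z) z X = 0 := by
    have h := mvfderiv_comp_prodMk_eq_zero (h := fun y => f ((extChartAt IN p).symm y)) hh hd1 hd2 h3 h2
    rw [mvfderiv_congr hev]
    exact h
  have h8 := isInvertible_mfderiv_extChartAt (I := 𝓘(ℝ, twistorModel n)) (mem_extChartAt_source z)
  exact h8.injective (h7.trans (ContinuousLinearMap.map_zero _).symm)

end TwistorSpace

theorem ContMDiffAt.contDiffAt_chart {EN N V : Type*} [NormedAddCommGroup EN] [NormedSpace ℝ EN] [TopologicalSpace N]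
    [ChartedSpace EN N] [IsManifold 𝓘(ℝ, EN) ∞ N] [NormedAddCommGroup V] [NormedSpace ℝ V] {g : N → V} {z₀ : N}
    (hg : ContMDiffAt 𝓘(ℝ, EN) 𝓘(ℝ, V) ∞ g z₀) :
    ContDiffAt ℝ ∞ (g ∘ (extChartAt 𝓘(ℝ, EN) z₀).symm) (extChartAt 𝓘(ℝ, EN) z₀ z₀) := by
  have h1 : ContMDiffAt 𝓘(ℝ, EN) 𝓘(ℝ, EN) ∞ (extChartAt 𝓘(ℝ, EN) z₀).symm (extChartAt 𝓘(ℝ, EN) z₀ z₀) :=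
    (contMDiffOn_extChartAt_symm z₀).contMDiffAt
      ((isOpen_extChartAt_target z₀).mem_nhds (mem_extChartAt_target z₀))
  have h2 : ContMDiffAt 𝓘(ℝ, EN) 𝓘(ℝ, V) ∞ g ((extChartAt 𝓘(ℝ, EN) z₀).symm (extChartAt 𝓘(ℝ, EN) z₀ z₀)) := by
    rwa [extChartAt_to_inv]
  exact (h2.comp _ h1).contDiffAt

/-! ### Parallel bilinear forms under pullback -/

section parallel
variable {E M EN N : Type*} [NormedAddCommGroup E] [NormedSpace ℝ E] [FiniteDimensional ℝ E]
  [TopologicalSpace M] [ChartedSpace E M] [IsManifold 𝓘(ℝ, E) 1 M]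
  [ContMDiffVectorBundle ∞ E (TangentSpace 𝓘(ℝ, E) : M → Type _) 𝓘(ℝ, E)]
  [TopologicalSpace N] [NormedAddCommGroup EN] [NormedSpace ℝ EN] [ChartedSpace EN N]
  [IsManifold 𝓘(ℝ, EN) 1 N]
  (nab : CovariantDerivative 𝓘(ℝ, E) E (TangentSpace 𝓘(ℝ, E) : M → Type _)) {f : N → M} (z₀ : N)

set_option synthInstance.maxHeartbeats 100000 in
/-- The pullback of a parallel bilinear form is parallel for the pullback connection. -/
theorem fderiv_pullback_of_parallel (hf : MDifferentiableAt 𝓘(ℝ, EN) 𝓘(ℝ, E) f z₀) {B : M → E →L[ℝ] E →L[ℝ] ℝ}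
    (hB : MDifferentiableAt 𝓘(ℝ, E) 𝓘(ℝ, E →L[ℝ] E →L[ℝ] ℝ) B (f z₀))
    (hpar : ∀ (v w : E) (Y : TangentSpace 𝓘(ℝ, E) (f z₀)), mvfderiv 𝓘(ℝ, E) (fun x => B x v w) (f z₀) Y =
      B (f z₀) ((trivializationAt E (TangentSpace 𝓘(ℝ, E) : M → Type _) (f z₀)).continuousLinearMapAt ℝ (f z₀)
        (nab (frameSection (trivializationAt E (TangentSpace 𝓘(ℝ, E) : M → Type _) (f z₀)) v) (f z₀) Y)) w +
      B (f z₀) v ((trivializationAt E (TangentSpace 𝓘(ℝ, E) : M → Type _) (f z₀)).continuousLinearMapAt ℝ (f z₀)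
        (nab (frameSection (trivializationAt E (TangentSpace 𝓘(ℝ, E) : M → Type _) (f z₀)) w) (f z₀) Y)))
    (X : TangentSpace 𝓘(ℝ, EN) z₀) (v w : E) :
    fderiv ℝ ((fun z => B (f z)) ∘ (extChartAt 𝓘(ℝ, EN) z₀).symm) (extChartAt 𝓘(ℝ, EN) z₀ z₀)
        (mvfderiv 𝓘(ℝ, EN) (extChartAt 𝓘(ℝ, EN) z₀) z₀ X) v w =
      B (f z₀) (pullbackForm nab f z₀ (extChartAt 𝓘(ℝ, EN) z₀ z₀)
        (mvfderiv 𝓘(ℝ, EN) (extChartAt 𝓘(ℝ, EN) z₀) z₀ X) v) w +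
      B (f z₀) v (pullbackForm nab f z₀ (extChartAt 𝓘(ℝ, EN) z₀ z₀)
        (mvfderiv 𝓘(ℝ, EN) (extChartAt 𝓘(ℝ, EN) z₀) z₀ X) w) := by
  have hz₀ : z₀ ∈ (extChartAt 𝓘(ℝ, EN) z₀).source := mem_extChartAt_source z₀
  have hx₀ : f z₀ ∈ (trivializationAt E (TangentSpace 𝓘(ℝ, E) : M → Type _) (f z₀)).baseSet :=
    FiberBundle.mem_baseSet_trivializationAt' (f z₀)
  have hBf : MDifferentiableAt 𝓘(ℝ, EN) 𝓘(ℝ, E →L[ℝ] E →L[ℝ] ℝ) (fun z => B (f z)) z₀ := hB.comp z₀ hf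
  have hBv : MDifferentiableAt 𝓘(ℝ, E) 𝓘(ℝ, E →L[ℝ] ℝ) (fun x => B x v) (f z₀) :=
    hB.clm_apply mdifferentiableAt_const
  have hBvw : MDifferentiableAt 𝓘(ℝ, E) 𝓘(ℝ, ℝ) (fun x => B x v w) (f z₀) :=
    hBv.clm_apply mdifferentiableAt_const
  have h2 := mvfderiv_clm_apply (v := fun _ => w) hBv mdifferentiableAt_const
    (mfderiv 𝓘(ℝ, EN) 𝓘(ℝ, E) f z₀ X)
  have h3 := mvfderiv_clm_apply (v := fun _ => v) hB mdifferentiableAt_const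
    (mfderiv 𝓘(ℝ, EN) 𝓘(ℝ, E) f z₀ X)
  rw [mvfderiv_const, zero_apply, map_zero, add_zero] at h2 h3
  rw [pullbackForm_apply nab hz₀ hx₀ hf, pullbackForm_apply nab hz₀ hx₀ hf, ← hpar, h2, h3,
    ← mvfderiv_eq_fderiv_chart hBf hz₀, mvfderiv_comp_vector hB hf]

end parallel

/-! ### The canonical section and the symplectic form in a chart -/

namespace TwistorSpace
variable {n : ℕ} {M : Type*} [TopologicalSpace M] [ChartedSpace (EuclideanSpace ℝ (Fin (2 * n))) M]
  [IsManifold (𝓡 (2 * n)) ∞ M] {Ω : SymplecticForm n M} (conn : SymplecticConnection Ω) (z₀ : TwistorSpace Ω)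

/-- The section `Φ` in the chart at `z₀` and the frame given by the chart at `π z₀`. -/
noncomputable def PhiInChart :
    twistorModel n → EuclideanSpace ℝ (Fin (2 * n)) →L[ℝ] EuclideanSpace ℝ (Fin (2 * n)) :=
  PhiInCoordinates (proj z₀) ∘ (extChartAt 𝓘(ℝ, twistorModel n) z₀).symm

/-- The connection form of `π*∇` in the chart at `z₀` and the frame given by the chart at `π z₀`. -/
noncomputable def connectionForm : twistorModel n → twistorModel n →L[ℝ]
    EuclideanSpace ℝ (Fin (2 * n)) →L[ℝ] EuclideanSpace ℝ (Fin (2 * n)) :=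
  pullbackForm (EN := twistorModel n) conn.cov (proj (Ω := Ω)) z₀

/-- The differential of the chart at `z₀`. -/
noncomputable def chartDeriv (z : TwistorSpace Ω) : TangentSpace 𝓘(ℝ, twistorModel n) z →L[ℝ] twistorModel n :=
  mvfderiv 𝓘(ℝ, twistorModel n) (extChartAt 𝓘(ℝ, twistorModel n) z₀) z

theorem contDiffAt_PhiInChart : ContDiffAt ℝ ∞ (PhiInChart z₀) (extChartAt 𝓘(ℝ, twistorModel n) z₀ z₀) :=
  (contMDiffAt_PhiInCoordinates z₀).contDiffAt_chart

theorem continuousAt_chart_symm : Filter.Tendsto (extChartAt 𝓘(ℝ, twistorModel n) z₀).symm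
    (𝓝 (extChartAt 𝓘(ℝ, twistorModel n) z₀ z₀)) (𝓝 z₀) := by
  have h := continuousAt_extChartAt_symm (I := 𝓘(ℝ, twistorModel n)) z₀
  rwa [ContinuousAt, extChartAt_to_inv] at h

theorem PhiInChart_sq : ∀ᶠ u in 𝓝 (extChartAt 𝓘(ℝ, twistorModel n) z₀ z₀), PhiInChart z₀ u * PhiInChart z₀ u = -1 :=
  (continuousAt_chart_symm z₀).eventually <| (eventually_mem_baseSet z₀).mono fun _ hz => PhiInCoordinates_sq hz

theorem eventually_mdifferentiableAt_PhiInCoordinates : ∀ᶠ z in 𝓝 z₀, MDifferentiableAt 𝓘(ℝ, twistorModel n)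
    𝓘(ℝ, EuclideanSpace ℝ (Fin (2 * n)) →L[ℝ] EuclideanSpace ℝ (Fin (2 * n)))
      (PhiInCoordinates (Ω := Ω) (proj z₀)) z :=
  -- The frame is fixed at `π z₀`, and smoothness in it is known at `z₀` only. Lowering the order to
  -- `1` makes it spread to nearby points, as finite orders do.
  ((contMDiffAt_iff_contMDiffAt_nhds (by simp)).1 ((contMDiffAt_PhiInCoordinates z₀).of_le (m := 1) (by simp))).mono
    fun _ h => h.mdifferentiableAt (by simp)

/-- The chart and the frame belong to `z₀` while `z` varies, because `τ` must be known near `z₀` in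
order to be differentiated. -/
theorem covPhi_in_chart {z : TwistorSpace Ω} (hz : z ∈ (extChartAt 𝓘(ℝ, twistorModel n) z₀).source)
    (hπz : proj z ∈ (trivializationAt (EuclideanSpace ℝ (Fin (2 * n)))
      (TangentSpace (𝓡 (2 * n)) : M → Type _) (proj z₀)).baseSet)
    (hd : MDifferentiableAt 𝓘(ℝ, twistorModel n)
      𝓘(ℝ, EuclideanSpace ℝ (Fin (2 * n)) →L[ℝ] EuclideanSpace ℝ (Fin (2 * n)))
      (PhiInCoordinates (Ω := Ω) (proj z₀)) z)
    (X : TangentSpace 𝓘(ℝ, twistorModel n) z) (v : TangentSpace (𝓡 (2 * n)) (proj z)) :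
    (trivializationAt (EuclideanSpace ℝ (Fin (2 * n))) (TangentSpace (𝓡 (2 * n)) : M → Type _)
      (proj z₀)).continuousLinearMapAt ℝ (proj z) (covPhi conn z X v) =
    covDerivForm (PhiInChart z₀) (connectionForm conn z₀) (extChartAt 𝓘(ℝ, twistorModel n) z₀ z) (chartDeriv z₀ z X)
      ((trivializationAt (EuclideanSpace ℝ (Fin (2 * n))) (TangentSpace (𝓡 (2 * n)) : M → Type _)
        (proj z₀)).continuousLinearMapAt ℝ (proj z) v) :=
  pullbackCovEnd_in_chart conn.cov hz hπz (mdifferentiableAt_proj z) Phi hd X v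

set_option synthInstance.maxHeartbeats 100000 in
set_option maxHeartbeats 2000000 in
/-- The symplectic form is parallel, in a chart of the twistor space and a frame of `TM`. -/
theorem exists_parallel_formInFrame :
    ∃ b : twistorModel n → EuclideanSpace ℝ (Fin (2 * n)) →L[ℝ] EuclideanSpace ℝ (Fin (2 * n)) →L[ℝ] ℝ,
      DifferentiableAt ℝ b (extChartAt 𝓘(ℝ, twistorModel n) z₀ z₀) ∧
      (∀ z : TwistorSpace Ω, z ∈ (extChartAt 𝓘(ℝ, twistorModel n) z₀).source → proj z ∈ (trivializationAt (EuclideanSpace ℝ (Fin (2 * n)))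
        (TangentSpace (𝓡 (2 * n)) : M → Type _) (proj z₀)).baseSet → ∀ v w : TangentSpace (𝓡 (2 * n)) (proj z),
        b (extChartAt 𝓘(ℝ, twistorModel n) z₀ z)
          ((trivializationAt (EuclideanSpace ℝ (Fin (2 * n))) (TangentSpace (𝓡 (2 * n)) : M → Type _)
            (proj z₀)).continuousLinearMapAt ℝ (proj z) v)
          ((trivializationAt (EuclideanSpace ℝ (Fin (2 * n))) (TangentSpace (𝓡 (2 * n)) : M → Type _)
            (proj z₀)).continuousLinearMapAt ℝ (proj z) w) = Ω.toForm (proj z) ![v, w]) ∧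
      ∀ (X : TangentSpace 𝓘(ℝ, twistorModel n) z₀) (v w : EuclideanSpace ℝ (Fin (2 * n))),
        fderiv ℝ b (extChartAt 𝓘(ℝ, twistorModel n) z₀ z₀) (chartDeriv z₀ z₀ X) v w =
          b (extChartAt 𝓘(ℝ, twistorModel n) z₀ z₀)
            (connectionForm conn z₀ (extChartAt 𝓘(ℝ, twistorModel n) z₀ z₀) (chartDeriv z₀ z₀ X) v) w +
          b (extChartAt 𝓘(ℝ, twistorModel n) z₀ z₀) v
            (connectionForm conn z₀ (extChartAt 𝓘(ℝ, twistorModel n) z₀ z₀) (chartDeriv z₀ z₀ X) w) := by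
  obtain ⟨β, hβs, hβ⟩ := Ω.exists_inFrame (proj z₀)
  set e := trivializationAt (EuclideanSpace ℝ (Fin (2 * n))) (TangentSpace (𝓡 (2 * n)) : M → Type _) (proj z₀) with he
  set φ := extChartAt 𝓘(ℝ, twistorModel n) z₀ with hφ
  set ψ := extChartAt (𝓡 (2 * n)) (proj z₀) with hψ
  have hz₀ : z₀ ∈ φ.source := mem_extChartAt_source z₀
  have hx₀ : proj z₀ ∈ e.baseSet := FiberBundle.mem_baseSet_trivializationAt' (proj z₀)
  have hψd : MDifferentiableAt (𝓡 (2 * n)) 𝓘(ℝ, EuclideanSpace ℝ (Fin (2 * n))) ψ (proj z₀) :=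
    mdifferentiableAt_extChartAt (mem_chart_source _ _)
  have hβd : DifferentiableAt ℝ β (ψ (proj z₀)) :=
    (hβs.contDiffAt ((isOpen_extChartAt_target (I := 𝓡 (2 * n)) (proj z₀)).mem_nhds
      (mem_extChartAt_target (proj z₀)))).differentiableAt (by simp)
  have hBd : MDifferentiableAt (𝓡 (2 * n)) 𝓘(ℝ, EuclideanSpace ℝ (Fin (2 * n)) →L[ℝ] EuclideanSpace ℝ (Fin (2 * n)) →L[ℝ] ℝ)
      (fun x => β (ψ x)) (proj z₀) := hβd.mdifferentiableAt.comp _ hψd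
  have hframe : ∀ x ∈ e.baseSet, ∀ v, e.continuousLinearMapAt ℝ x (frameSection e v x) = v := fun x hx v => by
    rw [e.continuousLinearMapAt_apply_of_mem (R := ℝ) hx, trivialization_frameSection e hx]
  refine ⟨(fun z => β (ψ (proj z))) ∘ φ.symm,
    MDifferentiableAt.differentiableAt_chart (hBd.comp z₀ (mdifferentiableAt_proj z₀)) hz₀,
    fun z hz hzb v w => ?_, fun X v w => ?_⟩
  · rw [Function.comp_apply, φ.left_inv hz]
    exact hβ _ hzb v w
  · rw [Function.comp_apply, φ.left_inv hz₀]
    refine fderiv_pullback_of_parallel conn.cov z₀ (mdifferentiableAt_proj z₀) hBd (fun v w Y => ?_) X v w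
    have h3 : (fun x => β (ψ x) v w) =ᶠ[𝓝 (proj z₀)] fun x => Ω.toForm x ![frameSection e v x, frameSection e w x] := by
      filter_upwards [e.open_baseSet.mem_nhds hx₀] with x hx
      rw [← hβ x hx, hframe x hx, hframe x hx]
    -- `∇ω = 0` is applied to frame sections: their components are constant, so their covariant
    -- derivatives are given by the Christoffel symbols alone.
    have h5 := conn.parallel (frameSection e v) (frameSection e w) (proj z₀) (mdifferentiableAt_frameSection e hx₀ v)
      (mdifferentiableAt_frameSection e hx₀ w) Y
    rw [mvfderiv_congr h3]
    refine h5.trans (congrArg₂ (· + ·) ?_ ?_)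
    · rw [← hβ _ hx₀, hframe _ hx₀]
    · rw [← hβ _ hx₀, hframe _ hx₀]

end TwistorSpace

theorem conj_mem_antiSp {E V : Type*} [NormedAddCommGroup E] [NormedSpace ℝ E] [NormedAddCommGroup V]
    [InnerProductSpace ℝ V] [FiniteDimensional ℝ V] {K : V →L[ℝ] V} (q : E ≃L[ℝ] V) {B : E →L[ℝ] E →L[ℝ] ℝ} {J A : E →L[ℝ] E}
    (hqJ : ∀ v, q (J v) = K (q v)) (hqB : ∀ u v, B u v = ⟪K (q u), q v⟫_ℝ) (hJ : ∀ v, J (J v) = -v)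
    (hinv : ∀ u v, B (J u) (J v) = B u v) (hA : ∀ v, A (J v) = -J (A v))
    (hskew : ∀ u v, B (A u) (J v) + B (J u) (A v) = 0) :
    (q : E →L[ℝ] V).comp (A.comp (q.symm : V →L[ℝ] E)) ∈ antiSp K := by
  have hK : ∀ v, q.symm (K v) = J (q.symm v) := fun v => by
    rw [ContinuousLinearEquiv.symm_apply_eq, hqJ, q.apply_symm_apply]
  refine ⟨fun v => ?_, fun u v => ?_⟩
  · simp only [ContinuousLinearMap.comp_apply, ContinuousLinearEquiv.coe_coe, hK, hA, map_neg, hqJ]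
  · have h1 := hqB (A (q.symm u)) (q.symm v)
    have h2 := hqB (q.symm u) (A (q.symm v))
    rw [q.apply_symm_apply] at h1 h2
    simp only [ContinuousLinearMap.comp_apply, ContinuousLinearEquiv.coe_coe]
    rw [← h1, ← h2]
    -- Replacing the second vector by its image under `J` and using the invariance of `B` turns the
    -- linearized invariance into membership in the symplectic Lie algebra.
    have h3 := hskew (q.symm u) (J (q.symm v))
    rw [hJ, hA, map_neg, map_neg, hinv] at h3
    linarith

/-- `(∇_X J)` as a linear function of `X`. -/
noncomputable def covDerivFormLM {F 𝒜 : Type*} [NormedAddCommGroup F] [NormedSpace ℝ F] [NormedRing 𝒜] [NormedAlgebra ℝ 𝒜]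
    (J : F → 𝒜) (θ : F → F →L[ℝ] 𝒜) (u : F) : F →ₗ[ℝ] 𝒜 where
  toFun := covDerivForm J θ u
  map_add' X Y := by simp only [covDerivForm, map_add, add_mul, mul_add]; abel
  map_smul' c X := by
    simp only [covDerivForm, map_smul, smul_mul_assoc, mul_smul_comm, RingHom.id_apply, smul_add, smul_sub]

set_option synthInstance.maxHeartbeats 100000 in
/-- For a family `J` of complex structures compatible with parallel symplectic forms, the map `X ↦ ∇_X J` at a point
factors through the space `antiSp`. -/
theorem exists_antiSp_covDerivForm {T F E : Type*} [AddCommGroup T] [Module ℝ T] [NormedAddCommGroup F] [NormedSpace ℝ F]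
    [NormedAddCommGroup E] [NormedSpace ℝ E] [FiniteDimensional ℝ E] {n : ℕ} (hn : Module.finrank ℝ E = 2 * n)
    {b : F → E →L[ℝ] E →L[ℝ] ℝ} {J : F → E →L[ℝ] E} (θ : F → F →L[ℝ] E →L[ℝ] E) {u : F} (L : T →ₗ[ℝ] F)
    (hb : DifferentiableAt ℝ b u) (hJ : DifferentiableAt ℝ J u) (hanti : ∀ v w, b u v w = -b u w v)
    (hcompat : ∀ᶠ u in 𝓝 u, CompatWith (fun v w => b u v w) (J u))
    (hpar : ∀ X v w, fderiv ℝ b u (L X) v w = b u (θ u (L X) v) w + b u v (θ u (L X) w)) :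
    ∃ S : T →ₗ[ℝ] antiSp (stdJ n), ∀ X, S X = 0 ↔ covDerivForm J θ u (L X) = 0 := by
  have hu := hcompat.self_of_nhds
  -- A frame adapted at the single point `u` suffices, since only the value of `∇J` at `u` is
  -- transported to the standard model.
  obtain ⟨q, hqJ, hqB⟩ := exists_adapted_frame hn (b u) (J u) hanti hu.sq hu.inv hu.pos
  have hJ2 : ∀ᶠ u in 𝓝 u, J u * J u = -1 := by
    filter_upwards [hcompat] with u hu
    ext1 v
    exact hu.sq v
  let N : T →ₗ[ℝ] (E →L[ℝ] E) := covDerivFormLM J θ u ∘ₗ L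
  have hN : ∀ X, N X = covDerivForm J θ u (L X) := fun X => rfl
  have hmem : ∀ X, (q : E →L[ℝ] EuclideanSpace ℝ (Fin n ⊕ Fin n)).comp ((N X).comp (q.symm : EuclideanSpace ℝ (Fin n ⊕ Fin n) →L[ℝ] E)) ∈ antiSp (stdJ n) := fun X => by
    refine conj_mem_antiSp q hqJ hqB hu.sq hu.inv (fun v => ?_) (fun v w => ?_)
    · exact DFunLike.congr_fun (covDerivForm_anticomm θ hJ hJ2 (L X)) v
    · exact covDerivForm_skew θ (L X) hb hJ (hcompat.mono fun u h => h.inv) (hpar X) v w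
  refine ⟨{ toFun := fun X => ⟨_, hmem X⟩
            map_add' := fun X Y => Subtype.ext ?_
            map_smul' := fun c X => Subtype.ext ?_ }, fun X => ?_⟩
  · ext1 v; simp
  · ext1 v; simp
  · rw [← hN]
    refine (Subtype.ext_iff).trans ⟨fun h => ?_, fun h => ?_⟩
    · ext1 v
      have h1 := DFunLike.congr_fun h (q v)
      have h2 : q (N X (q.symm (q v))) = 0 := h1
      rw [q.symm_apply_apply] at h2
      exact q.map_eq_zero_iff.1 h2
    · change (q : E →L[ℝ] EuclideanSpace ℝ (Fin n ⊕ Fin n)).comp ((N X).comp (q.symm : EuclideanSpace ℝ (Fin n ⊕ Fin n) →L[ℝ] E)) = 0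
      rw [h]
      simp

/-! ### Covariant derivatives in stationary directions -/

section pullback
variable {E M EN N : Type*} [NormedAddCommGroup E] [NormedSpace ℝ E] [FiniteDimensional ℝ E]
  [TopologicalSpace M] [ChartedSpace E M] [IsManifold 𝓘(ℝ, E) 1 M]
  [ContMDiffVectorBundle ∞ E (TangentSpace 𝓘(ℝ, E) : M → Type _) 𝓘(ℝ, E)]
  [TopologicalSpace N] [NormedAddCommGroup EN] [NormedSpace ℝ EN] [ChartedSpace EN N]
  [IsManifold 𝓘(ℝ, EN) 1 N]
  (nab : CovariantDerivative 𝓘(ℝ, E) E (TangentSpace 𝓘(ℝ, E) : M → Type _)) {f : N → M} {z : N}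

/-- In the directions in which `f` is stationary, the covariant derivative is the derivative in the fixed fibre. -/
theorem pullbackCovEnd_of_mfderiv_eq_zero (hf : MDifferentiableAt 𝓘(ℝ, EN) 𝓘(ℝ, E) f z)
    (A : Π z : N, TangentSpace 𝓘(ℝ, E) (f z) →L[ℝ] TangentSpace 𝓘(ℝ, E) (f z))
    (hA : MDifferentiableAt 𝓘(ℝ, EN) 𝓘(ℝ, E →L[ℝ] E) (endInFrame (f z) A) z)
    {X : TangentSpace 𝓘(ℝ, EN) z} (hX : mfderiv 𝓘(ℝ, EN) 𝓘(ℝ, E) f z X = 0) (v : TangentSpace 𝓘(ℝ, E) (f z)) :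
    (trivializationAt E (TangentSpace 𝓘(ℝ, E) : M → Type _) (f z)).continuousLinearMapAt ℝ (f z)
      (pullbackCovEnd 𝓘(ℝ, EN) f nab A z X v) =
    mvfderiv 𝓘(ℝ, EN) (endInFrame (f z) A) z X
      ((trivializationAt E (TangentSpace 𝓘(ℝ, E) : M → Type _) (f z)).continuousLinearMapAt ℝ (f z) v) := by
  have hz : z ∈ (extChartAt 𝓘(ℝ, EN) z).source := mem_extChartAt_source z
  have hfz : f z ∈ (trivializationAt E (TangentSpace 𝓘(ℝ, E) : M → Type _) (f z)).baseSet :=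
    FiberBundle.mem_baseSet_trivializationAt' (f z)
  have hθ : pullbackForm nab f z (extChartAt 𝓘(ℝ, EN) z z) (mvfderiv 𝓘(ℝ, EN) (extChartAt 𝓘(ℝ, EN) z) z X) = 0 := by
    ext1 w
    rw [pullbackForm_apply nab hz hfz hf, hX, map_zero, map_zero, zero_apply]
  rw [pullbackCovEnd_in_chart nab hz hfz hf A hA, covDerivForm, hθ, zero_mul, mul_zero, sub_zero, add_zero,
    mvfderiv_eq_fderiv_chart hA hz]

end pullback

/-! ### The splitting into vertical and horizontal spaces, and the projection `P` -/

namespace TwistorSpace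
variable {n : ℕ} {M : Type*} [TopologicalSpace M] [ChartedSpace (EuclideanSpace ℝ (Fin (2 * n))) M]
  [IsManifold (𝓡 (2 * n)) ∞ M] {Ω : SymplecticForm n M} (conn : SymplecticConnection Ω) (z : TwistorSpace Ω)

theorem covPhi_in_chart_self (X : TangentSpace 𝓘(ℝ, twistorModel n) z) (v : TangentSpace (𝓡 (2 * n)) (proj z)) :
    (trivializationAt (EuclideanSpace ℝ (Fin (2 * n))) (TangentSpace (𝓡 (2 * n)) : M → Type _)
      (proj z)).continuousLinearMapAt ℝ (proj z) (covPhi conn z X v) =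
    covDerivForm (PhiInChart z) (connectionForm conn z) (extChartAt 𝓘(ℝ, twistorModel n) z z) (chartDeriv z z X)
      ((trivializationAt (EuclideanSpace ℝ (Fin (2 * n))) (TangentSpace (𝓡 (2 * n)) : M → Type _)
        (proj z)).continuousLinearMapAt ℝ (proj z) v) :=
  covPhi_in_chart conn z (mem_extChartAt_source z) (FiberBundle.mem_baseSet_trivializationAt' (proj z))
    ((contMDiffAt_PhiInCoordinates z).mdifferentiableAt (by simp)) X v

theorem covPhi_eq_zero_iff (X : TangentSpace 𝓘(ℝ, twistorModel n) z) : covPhi conn z X = 0 ↔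
    covDerivForm (PhiInChart z) (connectionForm conn z) (extChartAt 𝓘(ℝ, twistorModel n) z z) (chartDeriv z z X) = 0 := by
  have hz := FiberBundle.mem_baseSet_trivializationAt' (F := EuclideanSpace ℝ (Fin (2 * n)))
    (E := (TangentSpace (𝓡 (2 * n)) : M → Type _)) (proj z)
  set e := trivializationAt (EuclideanSpace ℝ (Fin (2 * n))) (TangentSpace (𝓡 (2 * n)) : M → Type _) (proj z) with he
  have h := covPhi_in_chart_self conn z X
  constructor
  · intro h0
    ext1 a
    have h1 := h (e.symmL ℝ (proj z) a)
    rw [e.continuousLinearMapAt_symmL hz, h0] at h1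
    rw [← h1]
    exact ContinuousLinearMap.map_zero _
  · intro h0
    refine LinearMap.ext fun v => ?_
    have h1 := h v
    rw [h0] at h1
    rw [← e.symmL_continuousLinearMapAt (R := ℝ) hz (covPhi conn z X v), h1]
    exact ContinuousLinearMap.map_zero _

/-- On vertical vectors, `(π*∇)_X Φ` is the velocity in the fibre. -/
theorem covPhi_eq_fibreVelocity {X : TangentSpace 𝓘(ℝ, twistorModel n) z} (hX : X ∈ vertical z) :
    covPhi conn z X = fibreVelocity z X := by
  have hz := FiberBundle.mem_baseSet_trivializationAt' (F := EuclideanSpace ℝ (Fin (2 * n)))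
    (E := (TangentSpace (𝓡 (2 * n)) : M → Type _)) (proj z)
  set e := trivializationAt (EuclideanSpace ℝ (Fin (2 * n))) (TangentSpace (𝓡 (2 * n)) : M → Type _) (proj z) with he
  have h := pullbackCovEnd_of_mfderiv_eq_zero conn.cov (mdifferentiableAt_proj z) Phi
    ((contMDiffAt_PhiInCoordinates z).mdifferentiableAt (by simp)) (X := X) hX
  refine LinearMap.ext fun v => ?_
  rw [← e.symmL_continuousLinearMapAt (R := ℝ) hz (covPhi conn z X v)]
  exact congrArg (e.symmL ℝ (proj z)) (h v)

/-- On a vertical vector the covariant derivative of `Φ` is the velocity in the fibre. If it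
vanishes as well, the vector moves neither the base point nor `Φ`, and `eq_zero_of_mfderiv_eq_zero`
applies. -/
theorem disjoint_vertical_horizontal : Disjoint (vertical z) (horizontal conn z) := by
  have hz := FiberBundle.mem_baseSet_trivializationAt' (F := EuclideanSpace ℝ (Fin (2 * n)))
    (E := (TangentSpace (𝓡 (2 * n)) : M → Type _)) (proj z)
  rw [Submodule.disjoint_def]
  intro X hX hX'
  refine eq_zero_of_mfderiv_eq_zero z X hX ?_
  set e := trivializationAt (EuclideanSpace ℝ (Fin (2 * n))) (TangentSpace (𝓡 (2 * n)) : M → Type _) (proj z) with he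
  have h0 : fibreVelocity z X = 0 := (covPhi_eq_fibreVelocity conn z hX).symm.trans hX'
  set D : EuclideanSpace ℝ (Fin (2 * n)) →L[ℝ] EuclideanSpace ℝ (Fin (2 * n)) :=
    mvfderiv 𝓘(ℝ, twistorModel n) (PhiInCoordinates (Ω := Ω) (proj z)) z X with hD
  change D = 0
  ext1 a
  have h1 : e.symmL ℝ (proj z) (D (e.continuousLinearMapAt ℝ (proj z) (e.symmL ℝ (proj z) a))) = 0 :=
    LinearMap.congr_fun h0 (e.symmL ℝ (proj z) a)
  rw [e.continuousLinearMapAt_symmL hz] at h1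
  rw [← e.continuousLinearMapAt_symmL (R := ℝ) hz (D a), h1]
  exact ContinuousLinearMap.map_zero _

set_option synthInstance.maxHeartbeats 100000 in
set_option maxHeartbeats 2000000 in
/-- The rank of `X ↦ (π*∇)_X Φ` is at most the dimension of the fibre. -/
theorem exists_ker_eq_horizontal : ∃ S : TangentSpace 𝓘(ℝ, twistorModel n) z →ₗ[ℝ] antiSp (stdJ n),
    LinearMap.ker S = horizontal conn z := by
  obtain ⟨b, hb, hbΩ, hpar⟩ := exists_parallel_formInFrame conn z
  have hz := FiberBundle.mem_baseSet_trivializationAt' (F := EuclideanSpace ℝ (Fin (2 * n)))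
    (E := (TangentSpace (𝓡 (2 * n)) : M → Type _)) (proj z)
  set e := trivializationAt (EuclideanSpace ℝ (Fin (2 * n))) (TangentSpace (𝓡 (2 * n)) : M → Type _) (proj z) with he
  set u := extChartAt 𝓘(ℝ, twistorModel n) z z with hu
  have hJz : ∀ z' ∈ (extChartAt 𝓘(ℝ, twistorModel n) z).source,
      PhiInChart z (extChartAt 𝓘(ℝ, twistorModel n) z z') = PhiInCoordinates (proj z) z' := fun z' hz' =>
    congrArg (PhiInCoordinates (proj z)) ((extChartAt 𝓘(ℝ, twistorModel n) z).left_inv hz')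
  have hcompat : ∀ z' : TwistorSpace Ω, z' ∈ (extChartAt 𝓘(ℝ, twistorModel n) z).source → proj z' ∈ e.baseSet →
      CompatWith (fun v w => b (extChartAt 𝓘(ℝ, twistorModel n) z z') v w)
        (PhiInChart z (extChartAt 𝓘(ℝ, twistorModel n) z z')) := fun z' hz' hz'' => by
    have h1 := (compatWith_Phi z').conj (e.continuousLinearMapAt ℝ (proj z')) (e.symmL ℝ (proj z'))
      (Ω := fun v w => b (extChartAt 𝓘(ℝ, twistorModel n) z z') v w)
      (e.symmL_continuousLinearMapAt hz'') (e.continuousLinearMapAt_symmL hz'') fun v w => (hbΩ z' hz' hz'' v w).symm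
    rw [hJz z' hz']
    exact h1
  -- Every `u'` near `u` is the coordinate of a point of the twistor space, where compatibility
  -- holds by definition. Having it on a neighbourhood is what allows its differentiation.
  have hev : ∀ᶠ u' in 𝓝 u, CompatWith (fun v w => b u' v w) (PhiInChart z u') := by
    have htgt : (extChartAt 𝓘(ℝ, twistorModel n) z).target ∈ 𝓝 u := extChartAt_target_mem_nhds z
    filter_upwards [(continuousAt_chart_symm z).eventually (eventually_mem_baseSet z), htgt] with u' h1 h2
    have h3 := hcompat _ ((extChartAt 𝓘(ℝ, twistorModel n) z).map_target h2) h1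
    rwa [(extChartAt 𝓘(ℝ, twistorModel n) z).right_inv h2] at h3
  have hanti : ∀ v w, b u v w = -b u w v := fun v w => by
    rw [← e.continuousLinearMapAt_symmL (R := ℝ) hz v, ← e.continuousLinearMapAt_symmL (R := ℝ) hz w,
      hbΩ z (mem_extChartAt_source z) hz, hbΩ z (mem_extChartAt_source z) hz]
    have h3 := (Ω.toForm (proj z)).toAlternatingMap.map_swap ![e.symmL ℝ (proj z) w, e.symmL ℝ (proj z) v]
      (i := 0) (j := 1) (by decide)
    refine Eq.trans ?_ h3
    change _ = Ω.toForm (proj z) _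
    congr 1
    ext i : 1
    fin_cases i <;> rfl
  have hd : DifferentiableAt ℝ (PhiInChart z) u := (contDiffAt_PhiInChart z).differentiableAt (by simp)
  have h := exists_antiSp_covDerivForm (n := n) (b := b) (J := PhiInChart z) (by simp) (connectionForm conn z)
    (chartDeriv z z).toLinearMap hb hd hanti hev
  obtain ⟨S, hS⟩ := h fun X v w => hpar X v w
  refine ⟨S, Submodule.ext fun X => ?_⟩
  rw [LinearMap.mem_ker, horizontal, LinearMap.mem_ker, covPhi_eq_zero_iff]
  exact hS X

set_option synthInstance.maxHeartbeats 100000 in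
-- A dimension count. The vertical space is the kernel of a map to a space of dimension `2n`, the
-- horizontal space the kernel of a map to `antiSp (stdJ n)`. As the twistor space has dimension `2n
-- + dim antiSp (stdJ n)`, rank-nullity bounds the sum of the two dimensions from below by that of
-- the tangent space, and disjointness does the rest.
theorem isCompl_vertical_horizontal : IsCompl (vertical z) (horizontal conn z) := by
  have : FiniteDimensional ℝ (TangentSpace 𝓘(ℝ, twistorModel n) z) :=
    inferInstanceAs (FiniteDimensional ℝ (twistorModel n))
  obtain ⟨S, hS⟩ := exists_ker_eq_horizontal conn z
  refine (Submodule.isCompl_iff_disjoint _ _ ?_).2 (disjoint_vertical_horizontal conn z)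
  have h1 := S.finrank_range_add_finrank_ker
  have h2 := (mfderiv 𝓘(ℝ, twistorModel n) (𝓡 (2 * n)) (proj (Ω := Ω)) z).toLinearMap.finrank_range_add_finrank_ker
  have h3 := (LinearMap.range S).finrank_le
  have h4 := (LinearMap.range (mfderiv 𝓘(ℝ, twistorModel n) (𝓡 (2 * n)) (proj (Ω := Ω)) z).toLinearMap).finrank_le
  have h5 : Module.finrank ℝ (TangentSpace 𝓘(ℝ, twistorModel n) z) =
      Module.finrank ℝ (EuclideanSpace ℝ (Fin (2 * n))) + Module.finrank ℝ (antiSp (stdJ n)) :=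
    Module.finrank_prod
  have h6 : Module.finrank ℝ (TangentSpace (𝓡 (2 * n)) (proj z)) = Module.finrank ℝ (EuclideanSpace ℝ (Fin (2 * n))) :=
    rfl
  rw [hS] at h1
  rw [vertical]
  omega

/-- `X` differs from its vertical part by a horizontal vector, on which the covariant derivative of
`Φ` vanishes by definition. -/
theorem covPhi_verticalProj (X : TangentSpace 𝓘(ℝ, twistorModel n) z) :
    fibreVelocity z (verticalProj conn z X) = covPhi conn z X := by
  have h := isCompl_vertical_horizontal conn z
  rw [verticalProj, dif_pos h]
  have h1 : (vertical z).projection (horizontal conn z) h X ∈ vertical z :=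
    Submodule.projection_apply_mem h X
  have h2 : X - (vertical z).projection (horizontal conn z) h X ∈ horizontal conn z :=
    Submodule.sub_projection_mem h X
  rw [← covPhi_eq_fibreVelocity conn z h1]
  have h3 : covPhi conn z (X - (vertical z).projection (horizontal conn z) h X) = 0 := h2
  rw [map_sub, sub_eq_zero] at h3
  exact h3.symm

/-- This inverts the normalization `(π*∇)_X Φ = 2 (P X) Φ`, and removes the choice of a projection
from all that follows. -/
theorem P_apply (X : TangentSpace 𝓘(ℝ, twistorModel n) z) :
    P conn z X = (1 / 2 : ℝ) • ((Phi z).toLinearMap * covPhi conn z X) := by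
  rw [← covPhi_verticalProj]
  rfl

end TwistorSpace

/-! ### Traces in a frame -/

/-- The trace of a continuous endomorphism of a finite-dimensional space, as a continuous linear form. -/
noncomputable def traceCLM (E : Type*) [NormedAddCommGroup E] [NormedSpace ℝ E] [FiniteDimensional ℝ E] :
    (E →L[ℝ] E) →L[ℝ] ℝ :=
  LinearMap.toContinuousLinearMap (LinearMap.trace ℝ E ∘ₗ ContinuousLinearMap.coeLM ℝ)

theorem traceCLM_mul_comm {E : Type*} [NormedAddCommGroup E] [NormedSpace ℝ E] [FiniteDimensional ℝ E] (a b : E →L[ℝ] E) :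
    traceCLM E (a * b) = traceCLM E (b * a) :=
  LinearMap.trace_mul_comm ℝ a.toLinearMap b.toLinearMap

/-- Conjugate endomorphisms have the same trace. -/
theorem trace_eq_traceCLM {V E : Type*} [AddCommGroup V] [Module ℝ V]
    [NormedAddCommGroup E] [NormedSpace ℝ E] [FiniteDimensional ℝ E]
    {g : V →ₗ[ℝ] E} {g' : E →ₗ[ℝ] V} (h1 : ∀ v, g' (g v) = v) (h2 : ∀ w, g (g' w) = w)
    {A : Module.End ℝ V} {B : E →L[ℝ] E} (h : ∀ v, g (A v) = B (g v)) : LinearMap.trace ℝ V A = traceCLM E B := by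
  let q : V ≃ₗ[ℝ] E := LinearEquiv.ofLinearMap g g' (LinearMap.ext h2) (LinearMap.ext h1)
  have hq : q.conj A = B.toLinearMap := by
    ext w
    rw [LinearEquiv.conj_apply_apply]
    change g (A (g' w)) = B w
    rw [h, h2]
  rw [← LinearMap.trace_conj' A q, hq]
  rfl

theorem extDeriv_traceCLM_covDerivForm {F E : Type*} [NormedAddCommGroup F] [NormedSpace ℝ F] [FiniteDimensional ℝ F]
    [NormedAddCommGroup E] [NormedSpace ℝ E] [FiniteDimensional ℝ E] {J : F → E →L[ℝ] E} {θ : F → F →L[ℝ] E →L[ℝ] E} {u₀ : F}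
    (hJ : ContDiffAt ℝ ∞ J u₀) (hJ2 : ∀ᶠ u in 𝓝 u₀, J u * J u = -1) (hθ : DifferentiableAt ℝ θ u₀)
    {η : F → F [⋀^Fin 2]→L[ℝ] ℝ} {c : ℝ}
    (hη : ∀ᶠ u in 𝓝 u₀, ∀ X Y, η u ![X, Y] =
      c * traceCLM E (J u * covDerivForm J θ u X * covDerivForm J θ u Y)) (X Y Z : F) :
    extDeriv η u₀ ![X, Y, Z] = 2 * c * (traceCLM E (curvatureForm θ u₀ X Y * covDerivForm J θ u₀ Z)
      + traceCLM E (curvatureForm θ u₀ Y Z * covDerivForm J θ u₀ X)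
      + traceCLM E (curvatureForm θ u₀ Z X * covDerivForm J θ u₀ Y)) :=
  extDeriv_trace_covDerivForm traceCLM_mul_comm (hJ.of_le (WithTop.coe_le_coe.2 (le_top : (2 : ℕ∞) ≤ ⊤))) hJ2 hθ hη X Y Z

/-! ### Exterior derivatives in a chart -/

section chart
variable {EN N : Type*} [NormedAddCommGroup EN] [NormedSpace ℝ EN] [TopologicalSpace N] [ChartedSpace EN N]
  [IsManifold 𝓘(ℝ, EN) 1 N] {z₀ : N}

theorem mvfderiv_mfderivWithin_extChartAt_symm {u : EN} (hu : u ∈ (extChartAt 𝓘(ℝ, EN) z₀).target) (X : EN) :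
    mvfderiv 𝓘(ℝ, EN) (extChartAt 𝓘(ℝ, EN) z₀) ((extChartAt 𝓘(ℝ, EN) z₀).symm u)
      (mfderivWithin 𝓘(ℝ, EN) 𝓘(ℝ, EN) (extChartAt 𝓘(ℝ, EN) z₀).symm (range 𝓘(ℝ, EN)) u X) = X :=
  DFunLike.congr_fun (mfderiv_extChartAt_comp_mfderivWithin_extChartAt_symm hu) X

theorem formInChart_two_apply (η : Π z : N, TangentSpace 𝓘(ℝ, EN) z [⋀^Fin 2]→L[ℝ] ℝ) (u X Y : EN) :
    formInChart 𝓘(ℝ, EN) η z₀ u ![X, Y] = η ((extChartAt 𝓘(ℝ, EN) z₀).symm u)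
      ![mfderivWithin 𝓘(ℝ, EN) 𝓘(ℝ, EN) (extChartAt 𝓘(ℝ, EN) z₀).symm (range 𝓘(ℝ, EN)) u X,
        mfderivWithin 𝓘(ℝ, EN) 𝓘(ℝ, EN) (extChartAt 𝓘(ℝ, EN) z₀).symm (range 𝓘(ℝ, EN)) u Y] := by
  change η _ _ = η _ _
  congr 1
  ext i : 1
  fin_cases i <;> rfl

theorem mextDeriv_two_apply (η : Π z : N, TangentSpace 𝓘(ℝ, EN) z [⋀^Fin 2]→L[ℝ] ℝ)
    (X Y Z : TangentSpace 𝓘(ℝ, EN) z₀) :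
    mextDeriv 𝓘(ℝ, EN) η z₀ ![X, Y, Z] = extDeriv (formInChart 𝓘(ℝ, EN) η z₀) (extChartAt 𝓘(ℝ, EN) z₀ z₀)
      ![mvfderiv 𝓘(ℝ, EN) (extChartAt 𝓘(ℝ, EN) z₀) z₀ X, mvfderiv 𝓘(ℝ, EN) (extChartAt 𝓘(ℝ, EN) z₀) z₀ Y,
        mvfderiv 𝓘(ℝ, EN) (extChartAt 𝓘(ℝ, EN) z₀) z₀ Z] := by
  -- The model has no boundary, so the derivative within its range is the ordinary one.
  rw [← extDerivWithin_univ, ← ModelWithCorners.range_eq_univ 𝓘(ℝ, EN)]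
  change extDerivWithin _ _ _ _ = extDerivWithin _ _ _ _
  congr 1
  ext i : 1
  fin_cases i <;> rfl

theorem differentiableAt_pullbackForm {E M : Type*} [NormedAddCommGroup E] [NormedSpace ℝ E] [FiniteDimensional ℝ E]
    [TopologicalSpace M] [ChartedSpace E M] [IsManifold 𝓘(ℝ, E) 1 M]
    [ContMDiffVectorBundle ∞ E (TangentSpace 𝓘(ℝ, E) : M → Type _) 𝓘(ℝ, E)]
    [T2Space M] [IsManifold 𝓘(ℝ, E) ∞ M] [IsManifold 𝓘(ℝ, EN) ∞ N]
    {nab : CovariantDerivative 𝓘(ℝ, E) E (TangentSpace 𝓘(ℝ, E) : M → Type _)} {f : N → M}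
    (hnab : CovariantDerivative.ContMDiffCovariantDerivative nab ∞) (hf : ContMDiff 𝓘(ℝ, EN) 𝓘(ℝ, E) ∞ f) :
    DifferentiableAt ℝ (pullbackForm nab f z₀) (extChartAt 𝓘(ℝ, EN) z₀ z₀) :=
  (contDiffAt_pullbackForm nab hnab hf).differentiableAt (by simp)

end chart

/-! ### The form `τ` and the curvature traces in a chart -/

namespace TwistorSpace
variable {n : ℕ} {M : Type*} [TopologicalSpace M] [ChartedSpace (EuclideanSpace ℝ (Fin (2 * n))) M]
  [IsManifold (𝓡 (2 * n)) ∞ M] {Ω : SymplecticForm n M} (conn : SymplecticConnection Ω) (z₀ : TwistorSpace Ω)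

/-- With `P X = ½ Φ N_X` the product `(P X) Φ (P Y)` is `¼ Φ N_X Φ² N_Y = -¼ Φ N_X N_Y`; the factor
`½` in the definition of `τ` gives `-⅛`. -/
theorem tau_eq_trace_covPhi (z : TwistorSpace Ω) (X Y : TangentSpace 𝓘(ℝ, twistorModel n) z) :
    tau conn z ![X, Y] = -(1 / 8) * LinearMap.trace ℝ (TangentSpace (𝓡 (2 * n)) (proj z))
      ((Phi z).toLinearMap * covPhi conn z X * covPhi conn z Y) := by
  have hsq : (Phi z).toLinearMap * (Phi z).toLinearMap = -1 := LinearMap.ext (compatWith_Phi z).sq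
  rw [tau_apply, P_apply, P_apply]
  generalize covPhi conn z X = A
  generalize covPhi conn z Y = B
  have h : ((1 / 2 : ℝ) • ((Phi z).toLinearMap * A)) * (Phi z).toLinearMap * ((1 / 2 : ℝ) • ((Phi z).toLinearMap * B))
      = -(1 / 4 : ℝ) • ((Phi z).toLinearMap * A * B) := by
    have h1 : (Phi z).toLinearMap * A * (Phi z).toLinearMap * ((Phi z).toLinearMap * B) =
        (Phi z).toLinearMap * A * ((Phi z).toLinearMap * (Phi z).toLinearMap) * B := by noncomm_ring
    rw [smul_mul_assoc, smul_mul_assoc, mul_smul_comm, h1, hsq, smul_smul]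
    simp only [mul_neg, mul_one, neg_mul, smul_neg, neg_smul]
    norm_num
  rw [h, map_smul, smul_eq_mul]
  ring

/-- `τ` in a chart of the twistor space and a frame of `TM`. -/
theorem tau_in_chart {z : TwistorSpace Ω} (hz : z ∈ (extChartAt 𝓘(ℝ, twistorModel n) z₀).source)
    (hπz : proj z ∈ (trivializationAt (EuclideanSpace ℝ (Fin (2 * n)))
      (TangentSpace (𝓡 (2 * n)) : M → Type _) (proj z₀)).baseSet)
    (hd : MDifferentiableAt 𝓘(ℝ, twistorModel n)
      𝓘(ℝ, EuclideanSpace ℝ (Fin (2 * n)) →L[ℝ] EuclideanSpace ℝ (Fin (2 * n)))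
      (PhiInCoordinates (Ω := Ω) (proj z₀)) z) (X Y : TangentSpace 𝓘(ℝ, twistorModel n) z) :
    tau conn z ![X, Y] = -(1 / 8) * traceCLM (EuclideanSpace ℝ (Fin (2 * n)))
      (PhiInChart z₀ (extChartAt 𝓘(ℝ, twistorModel n) z₀ z) *
        covDerivForm (PhiInChart z₀) (connectionForm conn z₀) (extChartAt 𝓘(ℝ, twistorModel n) z₀ z) (chartDeriv z₀ z X) *
        covDerivForm (PhiInChart z₀) (connectionForm conn z₀) (extChartAt 𝓘(ℝ, twistorModel n) z₀ z) (chartDeriv z₀ z Y)) := by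
  set e := trivializationAt (EuclideanSpace ℝ (Fin (2 * n))) (TangentSpace (𝓡 (2 * n)) : M → Type _) (proj z₀) with he
  have hJz : PhiInChart z₀ (extChartAt 𝓘(ℝ, twistorModel n) z₀ z) = PhiInCoordinates (proj z₀) z :=
    congrArg (PhiInCoordinates (proj z₀)) ((extChartAt 𝓘(ℝ, twistorModel n) z₀).left_inv hz)
  rw [tau_eq_trace_covPhi]
  congr 1
  -- The frame conjugates each of the three factors into its matrix, and conjugation preserves the
  -- trace.
  refine trace_eq_traceCLM (g := (e.continuousLinearMapAt ℝ (proj z)).toLinearMap) (g' := (e.symmL ℝ (proj z)).toLinearMap)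
    (e.symmL_continuousLinearMapAt hπz) (e.continuousLinearMapAt_symmL hπz) fun v => ?_
  have h1 := covPhi_in_chart conn z₀ hz hπz hd X (covPhi conn z Y v)
  rw [covPhi_in_chart conn z₀ hz hπz hd Y v] at h1
  have h2 := PhiInCoordinates_apply hπz (covPhi conn z X (covPhi conn z Y v))
  rw [h1, ← hJz] at h2
  exact h2.symm

/-- In contrast to `τ`, the right-hand side of the theorem is not differentiated, so the identity is
needed only at the centre of the chart. -/
theorem trace_curvature_covPhi [T2Space M] (X Y Z : TangentSpace 𝓘(ℝ, twistorModel n) z₀) :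
    LinearMap.trace ℝ (TangentSpace (𝓡 (2 * n)) (proj z₀)) (curvature conn z₀ X Y ∘ₗ covPhi conn z₀ Z) =
      traceCLM (EuclideanSpace ℝ (Fin (2 * n)))
        (curvatureForm (connectionForm conn z₀) (extChartAt 𝓘(ℝ, twistorModel n) z₀ z₀)
          (chartDeriv z₀ z₀ X) (chartDeriv z₀ z₀ Y) *
        covDerivForm (PhiInChart z₀) (connectionForm conn z₀) (extChartAt 𝓘(ℝ, twistorModel n) z₀ z₀)
          (chartDeriv z₀ z₀ Z)) := by
  have hz := FiberBundle.mem_baseSet_trivializationAt' (F := EuclideanSpace ℝ (Fin (2 * n)))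
    (E := (TangentSpace (𝓡 (2 * n)) : M → Type _)) (proj z₀)
  set e := trivializationAt (EuclideanSpace ℝ (Fin (2 * n))) (TangentSpace (𝓡 (2 * n)) : M → Type _) (proj z₀) with he
  refine trace_eq_traceCLM (g := (e.continuousLinearMapAt ℝ (proj z₀)).toLinearMap) (g' := (e.symmL ℝ (proj z₀)).toLinearMap)
    (e.symmL_continuousLinearMapAt hz) (e.continuousLinearMapAt_symmL hz) fun v => ?_
  have h1 := pullbackCurvature_in_chart conn.cov z₀ (contMDiff_proj.of_le (by simp))
    (differentiableAt_pullbackForm conn.smooth contMDiff_proj) X Y (covPhi conn z₀ Z v)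
  refine h1.trans ?_
  exact congrArg _ (covPhi_in_chart_self conn z₀ Z v)

set_option maxHeartbeats 2000000 in
theorem chartDeriv_mfderivWithin_symm {u : twistorModel n} (hu : u ∈ (extChartAt 𝓘(ℝ, twistorModel n) z₀).target)
    (X : twistorModel n) : chartDeriv z₀ ((extChartAt 𝓘(ℝ, twistorModel n) z₀).symm u)
      (mfderivWithin 𝓘(ℝ, twistorModel n) 𝓘(ℝ, twistorModel n) (extChartAt 𝓘(ℝ, twistorModel n) z₀).symm
        (range 𝓘(ℝ, twistorModel n)) u X) = X :=
  mvfderiv_mfderivWithin_extChartAt_symm hu X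

set_option maxHeartbeats 2000000 in
-- The differential of the chart undoes that of its inverse, so `X` and `Y` enter as constant
-- vectors. This is the hypothesis on `η` in the local form of the theorem.
theorem formInChart_tau : ∀ᶠ u in 𝓝 (extChartAt 𝓘(ℝ, twistorModel n) z₀ z₀), ∀ X Y : twistorModel n,
    formInChart 𝓘(ℝ, twistorModel n) (tau conn) z₀ u ![X, Y] =
      -(1 / 8) * traceCLM (EuclideanSpace ℝ (Fin (2 * n))) (PhiInChart z₀ u *
        covDerivForm (PhiInChart z₀) (connectionForm conn z₀) u X *
        covDerivForm (PhiInChart z₀) (connectionForm conn z₀) u Y) := by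
  have htgt : (extChartAt 𝓘(ℝ, twistorModel n) z₀).target ∈ 𝓝 (extChartAt 𝓘(ℝ, twistorModel n) z₀ z₀) :=
    extChartAt_target_mem_nhds z₀
  filter_upwards [htgt, (continuousAt_chart_symm z₀).eventually (eventually_mem_baseSet z₀),
    (continuousAt_chart_symm z₀).eventually (eventually_mdifferentiableAt_PhiInCoordinates z₀)] with u hu h1 h2 X Y
  have h := tau_in_chart conn z₀ ((extChartAt 𝓘(ℝ, twistorModel n) z₀).map_target hu) h1 h2
    (mfderivWithin 𝓘(ℝ, twistorModel n) 𝓘(ℝ, twistorModel n) (extChartAt 𝓘(ℝ, twistorModel n) z₀).symm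
        (range 𝓘(ℝ, twistorModel n)) u X)
    (mfderivWithin 𝓘(ℝ, twistorModel n) 𝓘(ℝ, twistorModel n) (extChartAt 𝓘(ℝ, twistorModel n) z₀).symm
        (range 𝓘(ℝ, twistorModel n)) u Y)
  rw [chartDeriv_mfderivWithin_symm z₀ hu, chartDeriv_mfderivWithin_symm z₀ hu,
    (extChartAt 𝓘(ℝ, twistorModel n) z₀).right_inv hu] at h
  exact (formInChart_two_apply (tau conn) u X Y).trans h

end TwistorSpace

set_option maxHeartbeats 1000000 in
theorem proposition5p1 (n : ℕ) {M : Type*} [TopologicalSpace M] [T2Space M]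
    [ChartedSpace (EuclideanSpace ℝ (Fin (2 * n))) M] [IsManifold (𝓡 (2 * n)) ∞ M]
    (Ω : SymplecticForm n M) (conn : SymplecticConnection Ω) (z : TwistorSpace Ω)
    (X Y Z : TangentSpace 𝓘(ℝ, twistorModel n) z) :
    mextDeriv 𝓘(ℝ, twistorModel n) (TwistorSpace.tau conn) z ![X, Y, Z] =
      -(1 / 4) * LinearMap.trace ℝ (TangentSpace (𝓡 (2 * n)) z.proj)
        (TwistorSpace.curvature conn z X Y ∘ₗ TwistorSpace.covPhi conn z Z
          + TwistorSpace.curvature conn z Y Z ∘ₗ TwistorSpace.covPhi conn z X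
          + TwistorSpace.curvature conn z Z X ∘ₗ TwistorSpace.covPhi conn z Y) := by
  -- The constant `c = -⅛` comes from `tau_eq_trace_covPhi`, and `2 c` is the factor `-¼` of the
  -- theorem.
  have h := extDeriv_traceCLM_covDerivForm (η := formInChart 𝓘(ℝ, twistorModel n) (TwistorSpace.tau conn) z)
    (c := -(1 / 8)) (TwistorSpace.contDiffAt_PhiInChart z) (TwistorSpace.PhiInChart_sq z)
    (θ := TwistorSpace.connectionForm conn z) (differentiableAt_pullbackForm conn.smooth TwistorSpace.contMDiff_proj)
    ((TwistorSpace.formInChart_tau conn z).mono fun u hu X Y => (hu X Y).trans rfl)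
    (TwistorSpace.chartDeriv z z X) (TwistorSpace.chartDeriv z z Y) (TwistorSpace.chartDeriv z z Z)
  rw [map_add, map_add, TwistorSpace.trace_curvature_covPhi, TwistorSpace.trace_curvature_covPhi,
    TwistorSpace.trace_curvature_covPhi]
  have hd := mextDeriv_two_apply (TwistorSpace.tau conn) X Y Z
  refine hd.trans (h.trans ?_)
  ring
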